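/- Let $b_1<0<b_2$, $B=\mathrm{diag}(b_1,b_2)$, and let $a,b,c,d\in\mathbb C$. Let $L(0)$ be the operator $y\mapsto -iB^{-1}y'$ in $L^2([0,1];\mathbb C^2)$ whose domain consists of the absolutely continuous $y=\mathrm{col}(y_1,y_2)$ on $[0,1]$ with $y'\in L^2([0,1];\mathbb C^2)$ that satisfy the boundary conditions $$y_1(0)+b\,y_2(0)+a\,y_1(1)=0,\qquad d\,y_2(0)+c\,y_1(1)+y_2(1)=0 .$$ Assume that these boundary conditions are strictly regular, that is, $ad-bc\ne 0$ and the sequence $\{\mu_n\}_{n\in\mathbb Z}$ of zeros (counted with multiplicity) of the characteristic determinant $$\Delta_0(\lambda)=d+a\,e^{i(b_1+b_2)\lambda}+(ad-bc)\,e^{ib_1\lambda}+e^{ib_2\lambda}$$ is asymptotically separated: for some $N\in\mathbb N$ and $\tau>0$ one has $|\mu_j-\mu_k|>2\tau$ whenever $|j|,|k|>N$ and $j\neq k$. Let $\{\lambda_n^0\}_{n\in\mathbb Z}$ be the sequence of the eigenvalues of $L(0)$, counted with algebraic multiplicity, and let $\{f_n\}_{n\in\mathbb Z}$ be a corresponding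 normalized system of root vectors of $L(0)$: $\|f_n\|=1$ for all $n$, and for every eigenvalue $\lambda$ the vectors $f_n$ with $\lambda_n^0=\lambda$ form a basis of the root subspace $\bigcup_{k}\ker(L(0)-\lambda)^k$. Then $\{f_n\}_{n\in\mathbb Z}$ is a Bari basis of $L^2([0,1];\mathbb C^2)$, that is, $\sum_{n\in\mathbb Z}\|f_n-e_n\|^2<\infty$ for some complete orthonormal sequence $\{e_n\}_{n\in\mathbb Z}$, if and only if $$b_1|c|+b_2|b|=0,\qquad \sum_{n\in\mathbb Z}|\operatorname{Im}\lambda_n^0|^2<\infty,\qquad \sum_{n\in\mathbb Z}\bigl(|z_n|-\operatorname{Re}z_n\bigr)<\infty,$$ where $z_n:=\bigl(1+d\,e^{-ib_2\lambda_n^0}\bigr)\,\overline{\bigl(1+a\,e^{ib_1\lambda_n^0}\bigr)}$. -/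

import Mathlib

open MeasureTheory Set
open scoped ComplexConjugate

noncomputable section

namespace DiracBari

/-- The space of values `ℂ²`, with its Euclidean norm. -/
abbrev C2 : Type := EuclideanSpace ℂ (Fin 2)

/-- The Hilbert space `L²([0,1]; ℂ²)`. -/
abbrev L2C2 : Type := Lp C2 2 (volume.restrict (Icc (0 : ℝ) 1))

/-- The boundary forms
`U_j(y) = a_{j1} y₁(0) + a_{j2} y₂(0) + a_{j3} y₁(1) + a_{j4} y₂(1)`, `j = 1, 2`. -/
def bdry (A : Matrix (Fin 2) (Fin 4) ℂ) (j : Fin 2) (y : ℝ → C2) : ℂ :=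
  A j 0 * y 0 0 + A j 1 * y 0 1 + A j 2 * y 1 0 + A j 3 * y 1 1

/-- The graph of the operator `L(0)`: the pairs `(y, -i B⁻¹ y')` in `L² × L²`, `B = diag(β)`, for
absolutely continuous `y` on `[0,1]` satisfying the boundary conditions `U₁(y) = U₂(y) = 0`. -/
def IsInGraph (β : Fin 2 → ℝ) (A : Matrix (Fin 2) (Fin 4) ℂ) (p : L2C2 × L2C2) : Prop :=
  ∃ y y' : ℝ → C2,
    AbsolutelyContinuousOnInterval y 0 1 ∧
    (∀ᵐ x ∂(volume.restrict (Icc (0 : ℝ) 1)), HasDerivAt y (y' x) x) ∧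
    (∀ j, bdry A j y = 0) ∧
    (p.1 =ᵐ[volume.restrict (Icc (0 : ℝ) 1)] y) ∧
    (∀ᵐ x ∂(volume.restrict (Icc (0 : ℝ) 1)),
      ∀ l, p.2 x l = -Complex.I * (β l : ℂ)⁻¹ * y' x l)

theorem IsInGraph.zero (β : Fin 2 → ℝ) (A : Matrix (Fin 2) (Fin 4) ℂ) :
    IsInGraph β A 0 := by
  refine ⟨0, 0, ?_, ?_, ?_, Lp.coeFn_zero _ _ _, ?_⟩
  · simpa [AbsolutelyContinuousOnInterval] using tendsto_const_nhds
  · exact Filter.Eventually.of_forall fun x => hasDerivAt_const x (0 : C2)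
  · intro j; simp [bdry]
  · filter_upwards [Lp.coeFn_zero C2 2 (volume.restrict (Icc (0 : ℝ) 1))] with x hx l
    rw [Prod.snd_zero, hx]
    simp

theorem IsInGraph.add {β : Fin 2 → ℝ} {A : Matrix (Fin 2) (Fin 4) ℂ} {p q : L2C2 × L2C2}
    (hp : IsInGraph β A p) (hq : IsInGraph β A q) : IsInGraph β A (p + q) := by
  obtain ⟨y, y', h1, h2, h3, h4, h5⟩ := hp
  obtain ⟨w, w', k1, k2, k3, k4, k5⟩ := hq
  refine ⟨y + w, y' + w', h1.add k1, ?_, ?_, ?_, ?_⟩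
  · filter_upwards [h2, k2] with x hx kx using hx.add kx
  · intro j
    have hy := h3 j
    have hw := k3 j
    simp only [bdry, Pi.add_apply, PiLp.add_apply] at *
    linear_combination hy + hw
  · filter_upwards [h4, k4, Lp.coeFn_add p.1 q.1] with x hx kx hs
    rw [Prod.fst_add, hs, Pi.add_apply, hx, kx, Pi.add_apply]
  · filter_upwards [h5, k5, Lp.coeFn_add p.2 q.2] with x hx kx hs l
    simp only [Prod.snd_add, hs, Pi.add_apply, PiLp.add_apply, hx l, kx l]
    ring

theorem IsInGraph.smul {β : Fin 2 → ℝ} {A : Matrix (Fin 2) (Fin 4) ℂ} (s : ℂ) {p : L2C2 × L2C2}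
    (hp : IsInGraph β A p) : IsInGraph β A (s • p) := by
  obtain ⟨y, y', h1, h2, h3, h4, h5⟩ := hp
  refine ⟨s • y, s • y', h1.const_smul s, ?_, ?_, ?_, ?_⟩
  · filter_upwards [h2] with x hx using hx.const_smul s
  · intro j
    have hy := h3 j
    simp only [bdry, Pi.smul_apply, PiLp.smul_apply, smul_eq_mul] at *
    linear_combination s * hy
  · filter_upwards [h4, Lp.coeFn_smul s p.1] with x hx hs
    rw [Prod.smul_fst, hs, Pi.smul_apply, hx, Pi.smul_apply]
  · filter_upwards [h5, Lp.coeFn_smul s p.2] with x hx hs l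
    simp only [Prod.smul_snd, hs, Pi.smul_apply, PiLp.smul_apply, hx l, smul_eq_mul]
    ring

/-- The graph of `L(0)` as a subspace of `L² × L²`. -/
def diracGraph (β : Fin 2 → ℝ) (A : Matrix (Fin 2) (Fin 4) ℂ) : Submodule ℂ (L2C2 × L2C2) where
  carrier := {p | IsInGraph β A p}
  zero_mem' := IsInGraph.zero β A
  add_mem' := IsInGraph.add
  smul_mem' := fun s _ hp => hp.smul s

theorem diracGraph_functional (β : Fin 2 → ℝ) (A : Matrix (Fin 2) (Fin 4) ℂ) :
    ∀ p : L2C2 × L2C2, p ∈ diracGraph β A → p.1 = 0 → p.2 = 0 := by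
  rintro ⟨f, g⟩ ⟨y, y', h1, h2, -, h4, h5⟩ hf
  simp only at hf h4 h5
  subst hf
  have hy0 : y =ᵐ[volume.restrict (Icc (0 : ℝ) 1)] 0 :=
    h4.symm.trans (Lp.coeFn_zero _ _ _)
  have hc : ContinuousOn y (Icc 0 1) := by
    simpa using h1.continuousOn
  have heq : EqOn y 0 (Icc 0 1) :=
    Measure.eqOn_Icc_of_ae_eq volume (by norm_num) hy0 hc continuousOn_const
  refine (Lp.eq_zero_iff_ae_eq_zero).2 ?_
  have hIoo : ∀ᵐ x ∂(volume.restrict (Icc (0 : ℝ) 1)), x ∈ Ioo (0 : ℝ) 1 := by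
    rw [← restrict_Ioo_eq_restrict_Icc]
    exact ae_restrict_mem measurableSet_Ioo
  filter_upwards [h2, h5, hIoo] with x hx hg hxI
  have hd : HasDerivAt y 0 x := by
    refine (hasDerivAt_const x (0 : C2)).congr_of_eventuallyEq ?_
    filter_upwards [Icc_mem_nhds hxI.1 hxI.2] with t ht using heq ht
  have hy' : y' x = 0 := hx.unique hd
  ext l
  simp [hg l, hy']

/-- The operator `L(0) = L_U(0)` in `L²([0,1]; ℂ²)`: `L(0) y = -i B⁻¹ y'` with `B = diag(β)`, on
the absolutely continuous `y` with `y' ∈ L²` and `U₁(y) = U₂(y) = 0`. -/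
def diracOp (β : Fin 2 → ℝ) (A : Matrix (Fin 2) (Fin 4) ℂ) : L2C2 →ₗ.[ℂ] L2C2 :=
  (diracGraph β A).toLinearPMap

theorem mem_graph_diracOp (β : Fin 2 → ℝ) (A : Matrix (Fin 2) (Fin 4) ℂ) (p : L2C2 × L2C2) :
    p ∈ (diracOp β A).graph ↔ IsInGraph β A p := by
  rw [diracOp, Submodule.toLinearPMap_graph_eq _ (diracGraph_functional β A)]
  exact Iff.rfl

section Abstract

variable {E : Type*} [NormedAddCommGroup E] [InnerProductSpace ℂ E]

/-- `ker (T - z)^k` for an unbounded operator `T`, with the natural domain of `(T - z)^k`. -/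
def powKer (T : E →ₗ.[ℂ] E) (z : ℂ) : ℕ → Submodule ℂ E
  | 0 => ⊥
  | k + 1 => ((powKer T z k).comap (T.toFun - z • T.domain.subtype)).map T.domain.subtype

/-- The root subspace of `T` at `z`: the union of the increasing sequence `ker (T - z)^k`. -/
def rootSubspace (T : E →ₗ.[ℂ] E) (z : ℂ) : Submodule ℂ E := ⨆ k, powKer T z k

/-- `lam` is the sequence of the eigenvalues of `T`, each repeated as often as its algebraic
multiplicity says, and `f` is a corresponding normalized system of root vectors: `‖f n‖ = 1`, and
for every `z` the vectors `f n` with `lam n = z` form a basis of the root subspace of `T` at `z`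
(which is zero if `z` is not an eigenvalue). -/
structure IsNormalizedRootSystem (T : E →ₗ.[ℂ] E) (lam : ℤ → ℂ) (f : ℤ → E) : Prop where
  norm_eq_one : ∀ n, ‖f n‖ = 1
  linearIndependent : ∀ z, LinearIndependent ℂ (fun n : {n : ℤ // lam n = z} => f n)
  span_eq : ∀ z, Submodule.span ℂ (f '' {n | lam n = z}) = rootSubspace T z

/-- A Bari basis: a sequence quadratically close to a complete orthonormal sequence. -/
def IsBariBasis (f : ℤ → E) : Prop :=
  ∃ e : HilbertBasis ℤ ℂ E, Summable fun n => ‖f n - e n‖ ^ 2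

end Abstract

/-- The `k`-th column of the fundamental matrix `Φ⁰(x, z) = diag(e^{i b₁ z x}, e^{i b₂ z x})` of
the equation `-i B⁻¹ y' = z y`. -/
def fundCol (β : Fin 2 → ℝ) (z : ℂ) (k : Fin 2) (x : ℝ) : C2 :=
  EuclideanSpace.single k (Complex.exp (Complex.I * β k * z * x))

/-- The characteristic determinant `Δ₀(z) = det (U_j(Φ⁰_k(·, z)))`. -/
def charDet (β : Fin 2 → ℝ) (A : Matrix (Fin 2) (Fin 4) ℂ) (z : ℂ) : ℂ :=
  (Matrix.of fun j k => bdry A j (fundCol β z k)).det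

/-- `J_{jk}`, the determinant formed by the columns `j`, `k` of `A` (numbered from `0`). -/
def colMinor (A : Matrix (Fin 2) (Fin 4) ℂ) (j k : Fin 4) : ℂ :=
  (A.submatrix id ![j, k]).det

/-- `lam` lists the zeros of `F`, each as often as its multiplicity says. -/
def IsZeroSequence (F : ℂ → ℂ) (lam : ℤ → ℂ) : Prop :=
  ∀ z, {n | lam n = z}.encard = analyticOrderAt F z

/-- For some `N` the subsequence with `|n| > N` is separated. -/
def AsymptoticallySeparated (lam : ℤ → ℂ) : Prop :=
  ∃ N : ℕ, ∃ τ : ℝ, 0 < τ ∧ ∀ j k : ℤ, (N : ℤ) < |j| → (N : ℤ) < |k| → j ≠ k →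
    2 * τ < ‖lam j - lam k‖

/-- Regular boundary conditions: `J₁₄ J₃₂ ≠ 0` (columns numbered from `1`). -/
def IsRegularBC (A : Matrix (Fin 2) (Fin 4) ℂ) : Prop :=
  colMinor A 0 3 * colMinor A 2 1 ≠ 0

/-- Strictly regular boundary conditions: regular, and the sequence of zeros of `Δ₀`, counted with
multiplicity, is asymptotically separated. (This does not depend on the enumeration.) -/
def IsStrictlyRegularBC (β : Fin 2 → ℝ) (A : Matrix (Fin 2) (Fin 4) ℂ) : Prop :=
  IsRegularBC A ∧ ∃ lam : ℤ → ℂ, IsZeroSequence (charDet β A) lam ∧ AsymptoticallySeparated lam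

/-- The coefficients of the boundary conditions in normal form,
`y₁(0) + b y₂(0) + a y₁(1) = 0`, `d y₂(0) + c y₁(1) + y₂(1) = 0`. -/
def normalForm (a b c d : ℂ) : Matrix (Fin 2) (Fin 4) ℂ :=
  !![1, b, a, 0; 0, d, c, 1]

/-- `z_n = (1 + d e^{-i b₂ μ}) * conj (1 + a e^{i b₁ μ})` at `μ = λ_n`. -/
def zVal (b₁ b₂ : ℝ) (a d μ : ℂ) : ℂ :=
  (1 + d * Complex.exp (-Complex.I * b₂ * μ)) * conj (1 + a * Complex.exp (Complex.I * b₁ * μ))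

end DiracBari

end

open MeasureTheory Set
open scoped ComplexConjugate

noncomputable section

namespace DiracBari

/-! ### Bari bases and biorthogonal sequences in Hilbert space -/

section Hilbert

variable {E : Type*} [NormedAddCommGroup E] [InnerProductSpace ℂ E]

/-! A complete, linearly independent sequence of unit vectors `f n` is a Bari basis exactly when its
biorthogonal vectors `g n`, needed only for all but finitely many `n`, satisfy `∑ (‖g n‖² - 1) < ∞`;
the summand equals `‖f n - g n‖²`. Necessity (`IsBariBasis.summable_biorthogonal`): the map sending
the nearby orthonormal basis to `f` is the identity plus a Hilbert–Schmidt operator, it is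
invertible, and `g` is the image of the basis under the inverse adjoint. Sufficiency
(`isBariBasis_of_biorthogonal`): Gram–Schmidt moves `f n` by at most a multiple of this defect.

For the operator `L(0)` everything is explicit. Separation leaves only finitely many multiple zeros
of `Δ₀`. At a simple zero the adjugate of the characteristic matrix has rank one; its two factors
are the coefficients of the exponential eigenvector and of the adjoint eigenvector, and their
pairing is `Δ₀'` up to the factor `i` (`exists_biorthogonal_of_simple`). Computing the norms gives
`‖g n‖² - 1 = excess / excessDen` (`excess_identity`), where `excess` is a sum of five nonnegative
terms: three are of size `|Im λ|²`, one is a positive multiple of `(b₁|c| + b₂|b|)²`, one is a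
positive multiple of `|z_n| - Re z_n`. The eigenvalues lie in a horizontal strip, so these terms and
the denominator can be estimated uniformly; `exists_le_mul_excess` and `exists_excess_le` are the
two directions.

Completeness is also needed for sufficiency (`eq_zero_of_orthogonal_rootSubspace`). Pairing a vector
orthogonal to all root vectors with analytic families of exponential solutions yields entire
functions divisible by `Δ₀`. The quotients are bounded, hence constant, and they tend to zero along
the imaginary axis. Therefore the transforms of the vector vanish, and so does the vector. -/

theorem HilbertBasis.hasSum_norm_inner_sq (e : HilbertBasis ℤ ℂ E) (x : E) :
    HasSum (fun n => ‖inner ℂ (e n) x‖ ^ 2) (‖x‖ ^ 2) := by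
  have h := Complex.reCLM.hasSum (e.hasSum_inner_mul_inner x x)
  have h2 : (inner ℂ x x : ℂ).re = ‖x‖ ^ 2 := by
    rw [inner_self_eq_norm_sq_to_K]; norm_cast
  simp only [Complex.reCLM_apply, h2] at h
  convert h using 2 with n
  rw [← inner_conj_symm, RCLike.norm_conj, Complex.mul_conj, Complex.ofReal_re,
     Complex.normSq_eq_norm_sq]

theorem cauchySchwarz_tsum {ι : Type*} {p q : ι → ℝ} (hp : ∀ i, 0 ≤ p i) (hq : ∀ i, 0 ≤ q i)
    (hsp : Summable fun i => p i ^ 2) (hsq : Summable fun i => q i ^ 2) :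
    Summable (fun i => p i * q i) ∧
      ∑' i, p i * q i ≤ √(∑' i, p i ^ 2) * √(∑' i, q i ^ 2) := by
  have h2 : Real.HolderConjugate 2 2 := Real.HolderConjugate.two_two
  have hsp' : Summable fun i => p i ^ (2 : ℝ) := by simpa using hsp
  have hsq' : Summable fun i => q i ^ (2 : ℝ) := by simpa using hsq
  refine ⟨Real.summable_mul_of_Lp_Lq_of_nonneg h2 hp hq hsp' hsq', ?_⟩
  have := Real.inner_le_Lp_mul_Lq_tsum_of_nonneg h2 hp hq hsp' hsq'
  simpa [Real.sqrt_eq_rpow] using this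

/-- The Hilbert–Schmidt operator taking a Hilbert basis to a square-summable sequence. -/
theorem exists_hilbertSchmidt [CompleteSpace E] (e : HilbertBasis ℤ ℂ E) (u : ℤ → E)
    (hu : Summable fun n => ‖u n‖ ^ 2) :
    ∃ K : E →L[ℂ] E, (∀ n, K (e n) = u n) ∧ ‖K‖ ≤ √(∑' n, ‖u n‖ ^ 2) := by
  have key (x : E) := cauchySchwarz_tsum (fun n => norm_nonneg (inner ℂ (e n) x))
    (fun n => norm_nonneg (u n)) (HilbertBasis.hasSum_norm_inner_sq e x).summable hu
  have hs (x : E) : Summable fun n => (inner ℂ (e n) x : ℂ) • u n := by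
    refine Summable.of_norm ?_
    simpa only [norm_smul] using (key x).1
  let K₀ : E →ₗ[ℂ] E :=
    { toFun := fun x => ∑' n, (inner ℂ (e n) x : ℂ) • u n
      map_add' := fun x y => by
        rw [← (hs x).tsum_add (hs y)]
        simp only [inner_add_right, add_smul]
      map_smul' := fun c x => by
        rw [RingHom.id_apply, ← (hs x).tsum_const_smul c]
        simp only [inner_smul_right, smul_smul] }
  have hb (x : E) : ‖K₀ x‖ ≤ √(∑' n, ‖u n‖ ^ 2) * ‖x‖ := by
    calc ‖K₀ x‖ ≤ ∑' n, ‖(inner ℂ (e n) x : ℂ) • u n‖ :=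
          norm_tsum_le_tsum_norm (by simpa only [norm_smul] using (key x).1)
      _ = ∑' n, ‖inner ℂ (e n) x‖ * ‖u n‖ := by simp only [norm_smul]
      _ ≤ _ := (key x).2
      _ = _ := by
          rw [(HilbertBasis.hasSum_norm_inner_sq e x).tsum_eq, Real.sqrt_sq (norm_nonneg x),
            mul_comm]
  refine ⟨K₀.mkContinuous _ hb, fun n => ?_, K₀.mkContinuous_norm_le (Real.sqrt_nonneg _) hb⟩
  change ∑' m, (inner ℂ (e m) (e n) : ℂ) • u m = u n
  rw [tsum_eq_single n]
  · rw [orthonormal_iff_ite.1 e.orthonormal n n]; simp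
  · intro m hm
    rw [orthonormal_iff_ite.1 e.orthonormal m n]; simp [hm]

/-- Both sums are the same double sum of squared matrix entries `|⟨e m, A (e n)⟩|²`, summed by rows
or by columns. -/
theorem summable_norm_sq_adjoint [CompleteSpace E] (e : HilbertBasis ℤ ℂ E) (A : E →L[ℂ] E)
    (h : Summable fun n => ‖A (e n)‖ ^ 2) :
    Summable fun n => ‖ContinuousLinearMap.adjoint A (e n)‖ ^ 2 := by
  let φ : ℤ × ℤ → ℝ := fun p => ‖inner ℂ (e p.2) (A (e p.1))‖ ^ 2
  have hrow (n : ℤ) : HasSum (fun m => φ (n, m)) (‖A (e n)‖ ^ 2) :=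
    HilbertBasis.hasSum_norm_inner_sq e (A (e n))
  have h1 : Summable φ := by
    refine (summable_prod_of_nonneg fun p => sq_nonneg _).2 ⟨fun n => (hrow n).summable, ?_⟩
    exact (summable_congr fun n => (hrow n).tsum_eq).2 h
  have h2 := ((summable_prod_of_nonneg fun p => sq_nonneg _).1 h1.prod_symm).2
  convert h2 using 2 with n
  rw [← (HilbertBasis.hasSum_norm_inner_sq e _).tsum_eq]
  congr 1; ext m
  change _ = ‖inner ℂ (e n) (A (e m))‖ ^ 2
  rw [← norm_inner_symm, ContinuousLinearMap.adjoint_inner_left]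

/-- This is what turns quadratic closeness of a biorthogonal sequence into a condition on its norms
alone. -/
theorem norm_sub_sq_of_inner_eq_one {x y : E} (hx : ‖x‖ = 1) (h : inner ℂ y x = (1 : ℂ)) :
    ‖x - y‖ ^ 2 = ‖y‖ ^ 2 - 1 := by
  have := @norm_sub_sq ℂ _ _ _ _ y x
  rw [h, hx] at this
  rw [norm_sub_rev, this]; simp; ring

/-- An injective perturbation of an isomorphism by a finite rank operator is onto. -/
theorem surjective_add_finiteRank {V : Type*} [AddCommGroup V] [Module ℂ V] (S : V ≃ₗ[ℂ] V)
    (R : V →ₗ[ℂ] V) (W : Submodule ℂ V) [FiniteDimensional ℂ W] (hR : ∀ x, R x ∈ W)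
    (hinj : Function.Injective (fun x => S x + R x)) :
    Function.Surjective (fun x => S x + R x) := by
  -- The operator `T = S⁻¹(S + R) = 1 + S⁻¹R` moves each vector by an element of the
  -- finite-dimensional `W' = S⁻¹W`. Thus `W'` is invariant, injectivity gives surjectivity on it,
  -- and any approximate preimage can be corrected inside `W'`.
  let W' : Submodule ℂ V := W.map S.symm.toLinearMap
  let T : V →ₗ[ℂ] V := LinearMap.id + S.symm.toLinearMap ∘ₗ R
  have hST (x : V) : S (T x) = S x + R x := by simp [T]
  have hTinj : Function.Injective T := by
    intro x y hxy
    apply hinj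
    simp only [← hST, hxy]
  have hTmem (x : V) : T x - x ∈ W' := by
    simp only [T, LinearMap.add_apply, LinearMap.id_apply, add_sub_cancel_left]
    exact Submodule.mem_map_of_mem (hR x)
  have hTW : ∀ x ∈ W', T x ∈ W' := fun x hx => by
    simpa using W'.add_mem (hTmem x) hx
  have hsurj : Function.Surjective (T.restrict hTW) := by
    apply LinearMap.injective_iff_surjective.1
    intro x y hxy
    apply Subtype.ext
    apply hTinj
    simpa using congrArg Subtype.val hxy
  intro y
  obtain ⟨w, hw⟩ := hsurj ⟨T (S.symm y) - S.symm y, hTmem _⟩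
  refine ⟨S.symm y - w, ?_⟩
  have : T (S.symm y - w) = S.symm y := by
    rw [map_sub, show T w = T (S.symm y) - S.symm y from by simpa using congrArg Subtype.val hw]
    abel
  change S _ + R _ = y
  rw [← hST, this]; simp

/-- The biorthogonal sequence of a Bari basis is quadratically close to it. -/
theorem IsBariBasis.summable_biorthogonal [CompleteSpace E] {f g : ℤ → E} (hf : IsBariBasis f)
    (hn : ∀ n, ‖f n‖ = 1) (F : Finset ℤ) (hli : LinearIndependent ℂ fun n : F => f n)
    (hg : ∀ n, n ∉ F → ∀ m, inner ℂ (g n) (f m) = if m = n then (1 : ℂ) else 0) :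
    Summable fun n => ‖g n‖ ^ 2 - 1 := by
  obtain ⟨e, he⟩ := hf
  set u : ℤ → E := fun n => f n - e n with hu
  obtain ⟨K, hK, -⟩ := exists_hilbertSchmidt e u he
  -- Dropping finitely many terms makes the Hilbert–Schmidt norm of the remainder `K'` less than 1,
  -- so `1 + K'` is invertible by a Neumann series, while `K - K'` has finite rank.
  obtain ⟨G, hG⟩ : ∃ G : Finset ℤ, ∑' n : {n // n ∉ G}, ‖u n‖ ^ 2 < 1 := by
    have := (tendsto_tsum_compl_atTop_zero fun n => ‖u n‖ ^ 2).eventually_lt_const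
      (zero_lt_one' ℝ)
    exact this.exists
  let v : ℤ → E := fun n => if n ∈ G then 0 else u n
  have hvsum : ∑' n, ‖v n‖ ^ 2 < 1 := by
    have : (fun n => ‖v n‖ ^ 2) = Set.indicator {n | n ∉ G} (fun n => ‖u n‖ ^ 2) := by
      ext n; by_cases h : n ∈ G <;> simp [v, h]
    rw [this, ← tsum_subtype]
    exact hG
  have hvs : Summable fun n => ‖v n‖ ^ 2 := by
    refine he.of_nonneg_of_le (fun n => by positivity) fun n => ?_
    by_cases h : n ∈ G <;> simp [v, h, hu]
  obtain ⟨K', hK', hK'n⟩ := exists_hilbertSchmidt e v hvs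
  have hK'1 : ‖-K'‖ < 1 := by
    rw [norm_neg]
    refine hK'n.trans_lt ?_
    rw [← Real.sqrt_one]
    exact Real.sqrt_lt_sqrt (tsum_nonneg fun n => by positivity) hvsum
  let T : E →L[ℂ] E := 1 + K
  have hT (n : ℤ) : T (e n) = f n := by simp [T, hK, hu]
  have hTsum (x : E) : HasSum (fun n => (inner ℂ (e n) x : ℂ) • f n) (T x) := by
    have := T.hasSum (e.hasSum_repr x)
    simpa only [Function.comp_def, map_smul, hT, e.repr_apply_apply] using this
  -- In other words `T* (g n) = e n` for `n ∉ F`. Hence a vector in `ker T` has coefficients only at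
  -- indices in `F`, and these vanish by the independence of the `f n` with `n ∈ F`.
  have hgT (n : ℤ) (hnF : n ∉ F) (x : E) : inner ℂ (g n) (T x) = inner ℂ (e n) x := by
    have := (innerSL ℂ (g n)).hasSum (hTsum x)
    simp only [map_smul, innerSL_apply_apply, hg n hnF, smul_eq_mul, mul_ite, mul_one,
      mul_zero] at this
    simpa using this.unique (hasSum_single n fun m hm => if_neg hm)
  have hker : ∀ x, T x = 0 → x = 0 := by
    intro x hx
    have h0 : ∀ n ∉ F, inner ℂ (e n) x = (0 : ℂ) := fun n hnF => by
      rw [← hgT n hnF, hx, inner_zero_right]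
    have h1 : T x = ∑ n ∈ F, (inner ℂ (e n) x : ℂ) • f n :=
      (hTsum x).unique (hasSum_sum_of_ne_finset_zero fun n hnF => by rw [h0 n hnF, zero_smul])
    rw [hx, ← Finset.sum_coe_sort] at h1
    have h2 := Fintype.linearIndependent_iff.1 hli _ h1.symm
    have h3 : ‖x‖ ^ 2 = 0 := by
      rw [← (HilbertBasis.hasSum_norm_inner_sq e x).tsum_eq]
      convert tsum_zero with n
      by_cases hnF : n ∈ F
      · simp [h2 ⟨n, hnF⟩]
      · simp [h0 n hnF]
    simpa using h3
  have hinj : Function.Injective T := (injective_iff_map_eq_zero T).2 hker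
  obtain ⟨w, hw⟩ := isUnit_one_sub_of_norm_lt_one hK'1
  have hsurj : Function.Surjective T := by
    let S : E ≃L[ℂ] E := ContinuousLinearEquiv.unitsEquiv ℂ E w
    have hS (x : E) : S x = x + K' x := by
      change (w : E →L[ℂ] E) x = _
      rw [hw]; simp
    let W : Submodule ℂ E := Submodule.span ℂ (u '' G)
    have : FiniteDimensional ℂ W := FiniteDimensional.span_of_finite ℂ (G.finite_toSet.image u)
    have hR (x : E) : (K - K') x ∈ W := by
      have h1 := (K - K').hasSum (e.hasSum_repr x)
      simp only [map_smul, sub_apply, hK, hK'] at h1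
      have h2 : ∀ n ∉ G, e.repr x n • (u n - v n) = 0 := fun n hnG => by simp [v, hnG]
      have h3 := h1.unique (hasSum_sum_of_ne_finset_zero h2)
      rw [sub_apply, h3]
      refine Submodule.sum_mem _ fun n hnG => Submodule.smul_mem _ _ ?_
      simp only [v, if_pos hnG, sub_zero]
      exact Submodule.subset_span ⟨n, hnG, rfl⟩
    have hST (x : E) : S.toLinearEquiv x + (K - K').toLinearMap x = T x := by
      change S x + (K - K') x = T x
      rw [hS]; simp [T]
    have := surjective_add_finiteRank S.toLinearEquiv (K - K').toLinearMap W hR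
      (by simpa only [hST] using hinj)
    simpa only [hST] using this
  let S : E ≃L[ℂ] E := ContinuousLinearEquiv.ofBijective T
    (LinearMap.ker_eq_bot.2 hinj) (LinearMap.range_eq_top.2 hsurj)
  have hTS (x : E) : T (S.symm x) = x := S.apply_symm_apply x
  let S' : E →L[ℂ] E := S.symm.toContinuousLinearMap
  -- With `g n = (T*)⁻¹ (e n)` and `T* = 1 + K*`, the difference is `(T*)⁻¹ (T* - 1) (e n)`; since
  -- `K*` is Hilbert–Schmidt as well, it is square summable.
  have hgS (n : ℤ) (hnF : n ∉ F) : e n - g n =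
      ContinuousLinearMap.adjoint S' (ContinuousLinearMap.adjoint K (e n)) := by
    refine ext_inner_right ℂ fun y => ?_
    rw [ContinuousLinearMap.adjoint_inner_left, ContinuousLinearMap.adjoint_inner_left,
      inner_sub_left]
    have h1 := hgT n hnF (S' y)
    rw [show T (S' y) = y from hTS y] at h1
    rw [h1, ← inner_sub_right]
    congr 1
    rw [sub_eq_iff_eq_add]
    nth_rewrite 1 [← hTS y]
    simp [T, S', add_comm]
  have hadj := summable_norm_sq_adjoint e K (by simpa only [hK] using he)
  have hsum : Summable fun n => 2 * ‖u n‖ ^ 2 + 2 * (‖ContinuousLinearMap.adjoint S'‖ ^ 2 *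
      ‖ContinuousLinearMap.adjoint K (e n)‖ ^ 2) :=
    (he.mul_left 2).add ((hadj.mul_left _).mul_left 2)
  refine Summable.of_norm_bounded_eventually hsum ?_
  filter_upwards [F.finite_toSet.compl_mem_cofinite] with n hnF
  have hnF : n ∉ F := hnF
  have h1 : ‖f n - g n‖ ^ 2 = ‖g n‖ ^ 2 - 1 :=
    norm_sub_sq_of_inner_eq_one (hn n) (by simp [hg n hnF n])
  rw [← h1, norm_pow, norm_norm]
  have h2 : f n - g n = u n + (e n - g n) := by simp [hu]
  have h3 : ‖e n - g n‖ ≤ ‖ContinuousLinearMap.adjoint S'‖ *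
      ‖ContinuousLinearMap.adjoint K (e n)‖ := by
    rw [hgS n hnF]; exact ContinuousLinearMap.le_opNorm _ _
  have h4 : ‖f n - g n‖ ≤ ‖u n‖ + ‖e n - g n‖ := h2 ▸ norm_add_le _ _
  have h5 := pow_le_pow_left₀ (norm_nonneg _) h3 2
  rw [mul_pow] at h5
  nlinarith [sq_nonneg (‖u n‖ - ‖e n - g n‖), pow_le_pow_left₀ (norm_nonneg _) h4 2]

open InnerProductSpace in
/-- Gram–Schmidt orthogonalization changes a vector by no more than its biorthogonal vector
deviates from it. -/
theorem norm_sub_gramSchmidtNormed_sq_le {f : ℕ → E} (hf : LinearIndependent ℂ f) (n : ℕ)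
    (hn : ‖f n‖ = 1) (g : E) (hg : ∀ m, inner ℂ g (f m) = if m = n then (1 : ℂ) else 0) :
    ‖f n - gramSchmidtNormed ℂ f n‖ ^ 2 ≤ 2 * (‖g‖ ^ 2 - 1) := by
  set r := gramSchmidt ℂ f n with hr
  have hr0 : r ≠ 0 := gramSchmidt_ne_zero n hf
  have hrn : 0 < ‖r‖ := norm_pos_iff.2 hr0
  set s := ∑ i ∈ Finset.Iio n, (ℂ ∙ gramSchmidt ℂ f i).starProjection (f n) with hs
  have hfrs : f n = r + s := gramSchmidt_def' ℂ f n
  have hs_mem : s ∈ Submodule.span ℂ (gramSchmidt ℂ f '' Set.Iio n) := by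
    refine Submodule.sum_mem _ fun i hi => ?_
    have h1 := Submodule.starProjection_apply_mem (ℂ ∙ gramSchmidt ℂ f i) (f n)
    refine Submodule.span_mono ?_ h1
    rintro _ rfl
    exact ⟨i, by simpa using hi, rfl⟩
  have hrs : inner ℂ r s = (0 : ℂ) := by
    refine Submodule.span_induction (p := fun x _ => inner ℂ r x = (0 : ℂ)) ?_ (by simp)
      (fun x y _ _ hx hy => by rw [inner_add_right, hx, hy, add_zero])
      (fun c x _ hx => by rw [inner_smul_right, hx, mul_zero]) hs_mem
    rintro _ ⟨i, hi, rfl⟩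
    exact gramSchmidt_orthogonal ℂ f (ne_of_gt hi)
  have hgs : inner ℂ g s = (0 : ℂ) := by
    rw [span_gramSchmidt_Iio] at hs_mem
    refine Submodule.span_induction (p := fun x _ => inner ℂ g x = (0 : ℂ)) ?_ (by simp)
      (fun x y _ _ hx hy => by rw [inner_add_right, hx, hy, add_zero])
      (fun c x _ hx => by rw [inner_smul_right, hx, mul_zero]) hs_mem
    rintro _ ⟨i, hi, rfl⟩
    rw [hg i, if_neg (ne_of_lt hi)]
  -- Here `s` lies in the span of the earlier `f i`, which `g` annihilates, so `g` sees only the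
  -- orthogonal residual `r`. Cauchy–Schwarz then bounds `‖r‖` from below by `1 / ‖g‖`.
  have hgr : inner ℂ g r = (1 : ℂ) := by
    have := hg n
    rwa [hfrs, inner_add_right, hgs, add_zero, if_pos rfl] at this
  have h1 : 1 ≤ ‖g‖ * ‖r‖ := by
    have := norm_inner_le_norm (𝕜 := ℂ) g r
    rwa [hgr, norm_one] at this
  have hrf : inner ℂ r (f n) = ((‖r‖ ^ 2 : ℝ) : ℂ) := by
    rw [hfrs, inner_add_right, hrs, add_zero, inner_self_eq_norm_sq_to_K]; norm_cast
  have hr1 : ‖r‖ ≤ 1 := by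
    have := norm_inner_le_norm (𝕜 := ℂ) r (f n)
    rw [hrf, hn, mul_one, Complex.norm_real, Real.norm_of_nonneg (by positivity)] at this
    nlinarith
  have hnorm : ‖gramSchmidtNormed ℂ f n‖ = 1 := gramSchmidtNormed_unit_length n hf
  have h2 : ‖f n - gramSchmidtNormed ℂ f n‖ ^ 2 = 2 - 2 * ‖r‖ := by
    have h3 := @norm_sub_sq ℂ _ _ _ _ (gramSchmidtNormed ℂ f n) (f n)
    have h4 : inner ℂ (gramSchmidtNormed ℂ f n) (f n) = ((‖r‖ : ℝ) : ℂ) := by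
      rw [gramSchmidtNormed, inner_smul_left, ← hr, hrf]
      have : (‖r‖ : ℂ) ≠ 0 := by exact_mod_cast hrn.ne'
      push_cast
      simp
      field_simp
    rw [h4, hn, hnorm] at h3
    rw [norm_sub_rev, h3]; simp; ring
  rw [h2]
  have hg1 : 1 ≤ ‖g‖ := by nlinarith [norm_nonneg g]
  nlinarith

open InnerProductSpace in
/-- A complete linearly independent sequence whose biorthogonal vectors are quadratically close
to it is a Bari basis. -/
theorem isBariBasis_of_biorthogonal [CompleteSpace E] {f g : ℤ → E} (hn : ∀ n, ‖f n‖ = 1)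
    (hli : LinearIndependent ℂ f)
    (hcomp : ⊤ ≤ (Submodule.span ℂ (Set.range f)).topologicalClosure) (F : Finset ℤ)
    (hg : ∀ n, n ∉ F → ∀ m, inner ℂ (g n) (f m) = if m = n then (1 : ℂ) else 0)
    (hs : Summable fun n => ‖g n‖ ^ 2 - 1) : IsBariBasis f := by
  -- Gram–Schmidt needs an order of type `ℕ`. Any enumeration serves, because the estimate for the
  -- single vector does not depend on which vectors precede it.
  let σ : ℤ ≃ ℕ := Equiv.intEquivNat
  let f' : ℕ → E := f ∘ σ.symm
  have hli' : LinearIndependent ℂ f' := hli.comp _ σ.symm.injective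
  let ε : ℤ → E := gramSchmidtNormed ℂ f' ∘ σ
  have hortho : Orthonormal ℂ ε := (gramSchmidtNormed_orthonormal hli').comp σ σ.injective
  have hrange : Submodule.span ℂ (Set.range ε) = Submodule.span ℂ (Set.range f) := by
    rw [show Set.range ε = Set.range (gramSchmidtNormed ℂ f') from σ.surjective.range_comp _,
      span_gramSchmidtNormed_range, span_gramSchmidt,
      show Set.range f' = Set.range f from σ.symm.surjective.range_comp _]
  refine ⟨HilbertBasis.mk hortho (by rw [hrange]; exact hcomp), ?_⟩
  rw [HilbertBasis.coe_mk]
  refine Summable.of_norm_bounded_eventually (hs.mul_left 2) ?_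
  filter_upwards [F.finite_toSet.compl_mem_cofinite] with n hnF
  have hnF : n ∉ F := hnF
  rw [norm_pow, norm_norm]
  have := norm_sub_gramSchmidtNormed_sq_le hli' (σ n) (by simp [f', hn]) (g n) fun m => by
    simp only [f', Function.comp_apply, hg n hnF, Equiv.symm_apply_eq]
  simpa [f', ε] using this

end Hilbert

/-! ### Root subspaces of an unbounded operator -/

section Abstract

variable {E : Type*} [NormedAddCommGroup E] [InnerProductSpace ℂ E]

theorem mem_powKer_succ {T : E →ₗ.[ℂ] E} {z : ℂ} {k : ℕ} {x : E} :
    x ∈ powKer T z (k + 1) ↔ ∃ w, (x, w) ∈ T.graph ∧ w - z • x ∈ powKer T z k := by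
  simp only [powKer, Submodule.mem_map, Submodule.mem_comap, LinearPMap.mem_graph_iff]
  constructor
  · rintro ⟨y, hy, rfl⟩
    exact ⟨T y, ⟨y, rfl, rfl⟩, hy⟩
  · rintro ⟨w, ⟨y, rfl, rfl⟩, hw⟩
    exact ⟨y, hw, rfl⟩

theorem powKer_mono (T : E →ₗ.[ℂ] E) (z : ℂ) : Monotone (powKer T z) := by
  refine monotone_nat_of_le_succ fun k => ?_
  induction k with
  | zero => exact bot_le
  | succ k ih =>
    intro x hx
    obtain ⟨w, hw, hwx⟩ := mem_powKer_succ.1 hx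
    exact mem_powKer_succ.2 ⟨w, hw, ih hwx⟩

theorem mem_rootSubspace {T : E →ₗ.[ℂ] E} {z : ℂ} {x : E} :
    x ∈ rootSubspace T z ↔ ∃ k, x ∈ powKer T z k :=
  Submodule.mem_iSup_of_directed _ (powKer_mono T z).directed_le

/-- A left eigenvector annihilates the root vectors at all other eigenvalues. -/
theorem eq_zero_of_mem_rootSubspace {T : E →ₗ.[ℂ] E} {μ z : ℂ} (φ : E →ₗ[ℂ] ℂ)
    (hφ : ∀ x w, (x, w) ∈ T.graph → φ w = μ * φ x) (hz : z ≠ μ) {x : E}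
    (hx : x ∈ rootSubspace T z) : φ x = 0 := by
  obtain ⟨k, hk⟩ := mem_rootSubspace.1 hx
  clear hx
  induction k generalizing x with
  | zero => rw [(Submodule.mem_bot ℂ).1 hk, map_zero]
  | succ k ih =>
    obtain ⟨w, hw, hwx⟩ := mem_powKer_succ.1 hk
    have h1 := ih hwx
    rw [map_sub, map_smul, hφ x w hw, smul_eq_mul, ← sub_mul] at h1
    exact (mul_eq_zero.1 h1).resolve_left (sub_ne_zero.2 hz.symm)

/-- A system of root vectors is linearly independent. -/
theorem IsNormalizedRootSystem.linearIndependent_all {T : E →ₗ.[ℂ] E} {lam : ℤ → ℂ} {f : ℤ → E}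
    (hf : IsNormalizedRootSystem T lam f) : LinearIndependent ℂ f := by
  -- The algebraic sum of the root subspaces lies in the domain and is invariant, so `T` restricts
  -- to a genuine endomorphism of it. Root vectors then lie in maximal generalized eigenspaces,
  -- which are independent.
  let V : Submodule ℂ E := ⨆ z, rootSubspace T z
  have hdom : V ≤ T.domain := by
    refine iSup_le fun z x hx => ?_
    obtain ⟨k, hk⟩ := mem_rootSubspace.1 hx
    obtain ⟨w, hw, -⟩ := mem_powKer_succ.1 (powKer_mono T z k.le_succ hk)
    exact LinearPMap.mem_domain_of_mem_graph hw
  have hT {z : ℂ} {k : ℕ} (x : T.domain) (hx : (x : E) ∈ powKer T z (k + 1)) :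
      T x - z • (x : E) ∈ powKer T z k := by
    obtain ⟨w, hw, hwx⟩ := mem_powKer_succ.1 hx
    obtain ⟨y, hy, rfl⟩ := (LinearPMap.mem_graph_iff T).1 hw
    obtain rfl : y = x := Subtype.ext hy
    exact hwx
  have hroot {z : ℂ} {x : E} {k : ℕ} (hx : x ∈ powKer T z k) : x ∈ V :=
    le_iSup (rootSubspace T) z (mem_rootSubspace.2 ⟨k, hx⟩)
  have hmap (x : E) (hx : x ∈ V) (hxd : x ∈ T.domain) : T ⟨x, hxd⟩ ∈ V := by
    refine Submodule.iSup_induction' _ (motive := fun x _ => ∀ hxd, T ⟨x, hxd⟩ ∈ V) ?_ ?_ ?_ hx hxd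
    · intro z x hx hxd
      obtain ⟨k, hk⟩ := mem_rootSubspace.1 hx
      have h1 := hT ⟨x, hxd⟩ (powKer_mono T z k.le_succ hk)
      simpa using V.add_mem (hroot h1) (V.smul_mem z (hroot hk))
    · intro hxd
      have : T ⟨0, hxd⟩ = 0 := T.map_zero
      rw [this]; exact V.zero_mem
    · intro x y hx hy h1 h2 hxd
      have : T ⟨x + y, hxd⟩ = T ⟨x, hdom hx⟩ + T ⟨y, hdom hy⟩ := by
        rw [← T.map_add]; rfl
      rw [this]
      exact V.add_mem (h1 _) (h2 _)
  let φ : Module.End ℂ V := LinearMap.codRestrict V (T.toFun ∘ₗ Submodule.inclusion hdom)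
    fun x => hmap x x.2 _
  have hgen {z : ℂ} {k : ℕ} (x : V) (hx : (x : E) ∈ powKer T z k) :
      ((φ - algebraMap ℂ (Module.End ℂ V) z) ^ k) x = 0 := by
    induction k generalizing x with
    | zero => exact Subtype.ext ((Submodule.mem_bot ℂ).1 hx)
    | succ k ih =>
      rw [pow_succ, Module.End.mul_apply]
      exact ih _ (hT ⟨x, hdom x.2⟩ hx)
  have hmem (n : ℤ) : f n ∈ rootSubspace T (lam n) := by
    rw [← hf.span_eq]
    exact Submodule.subset_span ⟨n, rfl, rfl⟩
  let f' (n : ℤ) : V := ⟨f n, le_iSup (rootSubspace T) _ (hmem n)⟩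
  have hf' (n : ℤ) : f' n ∈ φ.maxGenEigenspace (lam n) := by
    obtain ⟨k, hk⟩ := mem_rootSubspace.1 (hmem n)
    exact Module.End.mem_maxGenEigenspace _ _ _ |>.2 ⟨k, hgen (f' n) hk⟩
  have hli : LinearIndependent ℂ f' := by
    have h1 := linearIndependent_iUnion_finite (R := ℂ)
      (f := fun (z : ℂ) (n : {n : ℤ // lam n = z}) => f' n)
      (fun z => LinearIndependent.of_comp V.subtype (hf.linearIndependent z))
      (fun z t _ hzt => by
        have hle (z : ℂ) : Submodule.span ℂ (range fun n : {n : ℤ // lam n = z} => f' n) ≤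
            φ.maxGenEigenspace z := by
          rw [Submodule.span_le]
          rintro _ ⟨n, rfl⟩
          have := hf' n
          rwa [n.2] at this
        exact (φ.independent_maxGenEigenspace.disjoint_biSup hzt).mono (hle z)
          (iSup₂_mono fun i _ => hle i))
    exact h1.comp (fun n => ⟨lam n, n, rfl⟩) fun m n h => by
      simpa using congrArg (fun p : (z : ℂ) × {n : ℤ // lam n = z} => (p.2 : ℤ)) h
  exact hli.map' V.subtype V.ker_subtype

end Abstract

/-! ### Calculus on the unit interval and coordinates in `L²` -/

theorem AbsolutelyContinuousOnInterval.clm_comp {E F : Type*} [NormedAddCommGroup E]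
    [NormedSpace ℝ E] [NormedAddCommGroup F] [NormedSpace ℝ F] (L : E →L[ℝ] F) {f : ℝ → E}
    {a b : ℝ} (hf : AbsolutelyContinuousOnInterval f a b) :
    AbsolutelyContinuousOnInterval (fun x => L (f x)) a b := by
  have h := Filter.Tendsto.const_mul ‖L‖ hf
  rw [mul_zero] at h
  refine squeeze_zero (fun t => Finset.sum_nonneg fun i _ => dist_nonneg) (fun t => ?_) h
  rw [Finset.mul_sum]
  exact Finset.sum_le_sum fun i _ => L.lipschitz.dist_le_mul _ _

/-- Lebesgue measure on the unit interval. -/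
abbrev unitVolume : Measure ℝ := volume.restrict (Icc (0 : ℝ) 1)

/-- The fundamental theorem of calculus for complex absolutely continuous functions. -/
theorem integral_eq_sub_of_absolutelyContinuous {f f' : ℝ → ℂ}
    (hf : AbsolutelyContinuousOnInterval f 0 1)
    (hd : ∀ᵐ x ∂unitVolume, HasDerivAt f (f' x) x) :
    Integrable f' unitVolume ∧ ∫ x, f' x ∂unitVolume = f 1 - f 0 := by
  have key (L : ℂ →L[ℝ] ℝ) : Integrable (fun x => L (f' x)) unitVolume ∧
      ∫ x, L (f' x) ∂unitVolume = L (f 1) - L (f 0) := by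
    have h1 := AbsolutelyContinuousOnInterval.clm_comp L hf
    have h2 : deriv (fun x => L (f x)) =ᵐ[unitVolume] fun x => L (f' x) := by
      filter_upwards [hd] with x hx
      exact (L.hasFDerivAt.comp_hasDerivAt x hx).deriv
    have h3 : Integrable (deriv fun x => L (f x)) unitVolume := by
      have := h1.intervalIntegrable_deriv
      rwa [intervalIntegrable_iff_integrableOn_Icc_of_le zero_le_one] at this
    refine ⟨h3.congr h2, ?_⟩
    rw [← integral_congr_ae h2, ← h1.integral_deriv_eq_sub,
      intervalIntegral.integral_of_le zero_le_one, integral_Icc_eq_integral_Ioc]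
  obtain ⟨hr, hr'⟩ := key Complex.reCLM
  obtain ⟨hi, hi'⟩ := key Complex.imCLM
  have hint : Integrable f' unitVolume := by
    have := hr.ofReal (𝕜 := ℂ) |>.add (hi.ofReal (𝕜 := ℂ) |>.mul_const Complex.I)
    refine this.congr (ae_of_all _ fun x => ?_)
    simp
  refine ⟨hint, Complex.ext ?_ ?_⟩
  · rw [← Complex.reCLM_apply, ← Complex.reCLM.integral_comp_comm hint, hr']; simp
  · rw [← Complex.imCLM_apply, ← Complex.imCLM.integral_comp_comm hint, hi']; simp

/-- The transforms `∫₀¹ (κ x)ⁱ e^{κ z x} h(x) dx`. -/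
def expTransform (h : ℝ → ℂ) (κ : ℂ) (i : ℕ) (z : ℂ) : ℂ :=
  ∫ x, (κ * x) ^ i * Complex.exp (κ * z * x) * h x ∂unitVolume

theorem integrable_continuous_mul {h g : ℝ → ℂ} (hh : Integrable h unitVolume)
    (hg : Continuous g) : Integrable (fun x => g x * h x) unitVolume := by
  obtain ⟨C, hC⟩ := (isCompact_Icc (a := (0 : ℝ)) (b := 1)).exists_bound_of_continuousOn
    hg.continuousOn
  exact hh.bdd_mul (c := C) hg.aestronglyMeasurable
    ((ae_restrict_iff' measurableSet_Icc).2 (ae_of_all _ hC))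

/-- Differentiation under the integral sign brings down a factor `κ x`, which is what the index `i`
counts. On bounded sets of `z` the integrand is dominated by a multiple of `|h|`. -/
theorem hasDerivAt_expTransform {h : ℝ → ℂ} (hh : Integrable h unitVolume) (κ : ℂ) (i : ℕ)
    (z : ℂ) : HasDerivAt (expTransform h κ i) (expTransform h κ (i + 1) z) z := by
  have hcont (j : ℕ) (w : ℂ) : Continuous fun x : ℝ => (κ * x) ^ j * Complex.exp (κ * w * x) := by
    fun_prop
  refine (hasDerivAt_integral_of_dominated_loc_of_deriv_le
    (F := fun w x => (κ * x) ^ i * Complex.exp (κ * w * x) * h x)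
    (F' := fun w x => (κ * x) ^ (i + 1) * Complex.exp (κ * w * x) * h x)
    (bound := fun x => ‖κ‖ ^ (i + 1) * Real.exp (‖κ‖ * (‖z‖ + 1)) * ‖h x‖)
    (Metric.ball_mem_nhds z one_pos) ?_ ?_ ?_ ?_ ?_ ?_).2
  · exact Filter.Eventually.of_forall fun w =>
      (integrable_continuous_mul hh (hcont i w)).aestronglyMeasurable
  · exact integrable_continuous_mul hh (hcont i z)
  · exact (integrable_continuous_mul hh (hcont (i + 1) z)).aestronglyMeasurable
  · refine (ae_restrict_iff' measurableSet_Icc).2 (ae_of_all _ fun x hx w hw => ?_)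
    have hw' : ‖w‖ ≤ ‖z‖ + 1 := by
      have h1 := norm_le_norm_add_norm_sub' w z
      have h2 : ‖w - z‖ < 1 := by simpa [dist_eq_norm] using hw
      linarith
    rw [norm_mul, norm_mul, norm_pow, norm_mul, Complex.norm_real, Real.norm_of_nonneg hx.1]
    have h1 : ‖κ‖ * x ≤ ‖κ‖ := mul_le_of_le_one_right (norm_nonneg _) hx.2
    have h2 : ‖Complex.exp (κ * w * x)‖ ≤ Real.exp (‖κ‖ * (‖z‖ + 1)) := by
      refine (Complex.norm_exp_le_exp_norm _).trans (Real.exp_le_exp.2 ?_)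
      rw [norm_mul, norm_mul, Complex.norm_real, Real.norm_of_nonneg hx.1]
      calc ‖κ‖ * ‖w‖ * x ≤ ‖κ‖ * ‖w‖ := mul_le_of_le_one_right (by positivity) hx.2
        _ ≤ _ := by gcongr
    gcongr
    exact mul_nonneg (norm_nonneg _) hx.1
  · exact hh.norm.const_mul _
  · refine ae_of_all _ fun x w _ => ?_
    have h1 : HasDerivAt (fun w : ℂ => κ * w * x) (κ * x) w := by
      simpa using ((hasDerivAt_id w).const_mul κ).mul_const (x : ℂ)
    have h2 := (h1.cexp.const_mul ((κ * x) ^ i)).mul_const (h x)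
    refine h2.congr_deriv ?_
    ring

theorem differentiable_expTransform {h : ℝ → ℂ} (hh : Integrable h unitVolume) (κ : ℂ) (i : ℕ) :
    Differentiable ℂ (expTransform h κ i) := fun z =>
  (hasDerivAt_expTransform hh κ i z).differentiableAt

theorem iteratedDeriv_expTransform {h : ℝ → ℂ} (hh : Integrable h unitVolume) (κ : ℂ) (i : ℕ) :
    iteratedDeriv i (expTransform h κ 0) = expTransform h κ i := by
  induction i with
  | zero => simp
  | succ i ih =>
    rw [iteratedDeriv_succ, ih]
    exact funext fun z => (hasDerivAt_expTransform hh κ i z).deriv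

theorem integrable_coord (w : L2C2) (l : Fin 2) : Integrable (fun x => w x l) unitVolume := by
  have h1 : Integrable w unitVolume := (Lp.memLp w).integrable (by norm_num)
  exact (EuclideanSpace.proj (𝕜 := ℂ) l).integrable_comp h1

theorem L2C2.ext_coord {v w : L2C2} (h : ∀ l, ∀ᵐ x ∂unitVolume, v x l = w x l) : v = w := by
  refine Lp.ext ?_
  filter_upwards [h 0, h 1] with x h0 h1
  ext l
  fin_cases l
  · exact h0
  · exact h1

theorem L2C2.coord_sub_smul (v w : L2C2) (s : ℂ) (l : Fin 2) :
    ∀ᵐ x ∂unitVolume, (v - s • w) x l = v x l - s * w x l := by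
  filter_upwards [Lp.coeFn_sub v (s • w), Lp.coeFn_smul s w] with x h1 h2
  rw [h1, Pi.sub_apply, h2, Pi.smul_apply, PiLp.sub_apply, PiLp.smul_apply, smul_eq_mul]

theorem continuous_toLp {y : Fin 2 → ℝ → ℂ} (hy : ∀ l, Continuous (y l)) :
    Continuous fun x => (WithLp.toLp 2 fun l => y l x : C2) :=
  (PiLp.continuous_toLp 2 fun _ : Fin 2 => ℂ).comp (continuous_pi hy)

theorem memLp_continuous {y : Fin 2 → ℝ → ℂ} (hy : ∀ l, Continuous (y l)) :
    MemLp (fun x => (WithLp.toLp 2 fun l => y l x : C2)) 2 unitVolume := by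
  obtain ⟨C, hC⟩ := (isCompact_Icc (a := (0 : ℝ)) (b := 1)).exists_bound_of_continuousOn
    (continuous_toLp hy).continuousOn
  exact MemLp.of_bound (continuous_toLp hy).aestronglyMeasurable C
    ((ae_restrict_iff' measurableSet_Icc).2 (ae_of_all _ hC))

/-- The class in `L²` of a vector of two continuous functions. -/
def contLp (y : Fin 2 → ℝ → ℂ) (hy : ∀ l, Continuous (y l)) : L2C2 :=
  (memLp_continuous hy).toLp _

theorem coeFn_contLp (y : Fin 2 → ℝ → ℂ) (hy : ∀ l, Continuous (y l)) :
    ∀ᵐ x ∂unitVolume, ∀ l, contLp y hy x l = y l x := by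
  filter_upwards [(memLp_continuous hy).coeFn_toLp] with x hx l
  rw [contLp, hx]

theorem inner_eq_sum_integral (v w : L2C2) :
    inner ℂ v w = ∑ l, ∫ x, conj (v x l) * w x l ∂unitVolume := by
  rw [L2.inner_def, ← integral_finsetSum]
  · refine integral_congr_ae (ae_of_all _ fun x => ?_)
    simp [PiLp.inner_apply, mul_comm]
  · intro l _
    have h (u : L2C2) : MemLp (fun x => u x l) 2 unitVolume :=
      (EuclideanSpace.proj (𝕜 := ℂ) l).comp_memLp' (Lp.memLp u)
    exact (h v).star.integrable_mul (h w)

theorem inner_contLp (y : Fin 2 → ℝ → ℂ) (hy : ∀ l, Continuous (y l)) (w : L2C2) :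
    inner ℂ (contLp y hy) w = ∑ l, ∫ x, conj (y l x) * w x l ∂unitVolume := by
  rw [inner_eq_sum_integral]
  refine Finset.sum_congr rfl fun l _ => integral_congr_ae ?_
  filter_upwards [coeFn_contLp y hy] with x hx
  simp only [hx]

theorem hasDerivAt_toLp {y : Fin 2 → ℝ → ℂ} {y' : Fin 2 → ℂ} {x : ℝ}
    (h : ∀ l, HasDerivAt (y l) (y' l) x) :
    HasDerivAt (fun x => (WithLp.toLp 2 fun l => y l x : C2)) (WithLp.toLp 2 y') x :=
  (PiLp.continuousLinearEquiv 2 ℝ fun _ : Fin 2 => ℂ).symm.hasFDerivAt.comp_hasDerivAt x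
    (hasDerivAt_pi.2 h)

/-! ### The graph of `L(0)`, the Lagrange identity and chains of root vectors -/

/-- A solution of the differential expression which satisfies the boundary conditions. -/
theorem isInGraph_contLp {β : Fin 2 → ℝ} (hβ : ∀ l, β l ≠ 0) {A : Matrix (Fin 2) (Fin 4) ℂ}
    {y w : Fin 2 → ℝ → ℂ} (hy : ∀ l, Continuous (y l)) (hw : ∀ l, Continuous (w l))
    (hd : ∀ l x, HasDerivAt (y l) (Complex.I * β l * w l x) x)
    (hbc : ∀ j, A j 0 * y 0 0 + A j 1 * y 1 0 + A j 2 * y 0 1 + A j 3 * y 1 1 = 0) :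
    IsInGraph β A (contLp y hy, contLp w hw) := by
  have hdv (x : ℝ) : HasDerivAt (fun x => (WithLp.toLp 2 fun l => y l x : C2))
      (WithLp.toLp 2 fun l => Complex.I * β l * w l x) x :=
    hasDerivAt_toLp fun l => hd l x
  refine ⟨fun x => WithLp.toLp 2 fun l => y l x,
    fun x => WithLp.toLp 2 fun l => Complex.I * β l * w l x, ?_, ae_of_all _ hdv, ?_, ?_, ?_⟩
  · refine ContDiffOn.absolutelyContinuousOnInterval (ContDiff.contDiffOn ?_)
    refine contDiff_one_iff_deriv.2 ⟨fun x => (hdv x).differentiableAt, ?_⟩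
    rw [funext fun x => (hdv x).deriv]
    exact continuous_toLp (y := fun l x => Complex.I * β l * w l x) fun l =>
      continuous_const.mul (hw l)
  · intro j
    exact hbc j
  · exact (memLp_continuous hy).coeFn_toLp
  · filter_upwards [coeFn_contLp w hw] with x hx l
    have : (β l : ℂ) ≠ 0 := by exact_mod_cast hβ l
    simp only [hx]
    field_simp
    rw [Complex.I_sq]; ring

/-- The Lagrange identity for an element of the graph, against the exponentials. -/
theorem IsInGraph.exists_trace {β : Fin 2 → ℝ} (hβ : ∀ l, β l ≠ 0)
    {A : Matrix (Fin 2) (Fin 4) ℂ} {p : L2C2 × L2C2} (hp : IsInGraph β A p) :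
    ∃ u v : Fin 2 → ℂ,
      (∀ j, A j 0 * u 0 + A j 1 * u 1 + A j 2 * v 0 + A j 3 * v 1 = 0) ∧
      (∀ l z, expTransform (fun x => p.2 x l) (-(Complex.I * β l)) 0 z -
        z * expTransform (fun x => p.1 x l) (-(Complex.I * β l)) 0 z =
        -Complex.I * (β l : ℂ)⁻¹ * (Complex.exp (-(Complex.I * β l) * z) * v l - u l)) ∧
      (∀ z, p.2 = z • p.1 → ∀ l, v l = u l * Complex.exp (Complex.I * β l * z) ∧
        ∀ᵐ x ∂unitVolume, p.1 x l = u l * Complex.exp (Complex.I * β l * z * x)) := by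
  obtain ⟨y, y', hac, hd, hbc, h1, h2⟩ := hp
  -- Multiplication by the inverse exponential `e^{-iβzx}` makes the derivative proportional to `p.2
  -- - z • p.1`. Integrating it gives the Lagrange identity; if it is zero, the product is constant
  -- and the component is an exponential.
  have hacl (l : Fin 2) (z : ℂ) : AbsolutelyContinuousOnInterval
      (fun x : ℝ => Complex.exp (-(Complex.I * β l) * z * x) * y x l) 0 1 := by
    have e1 : AbsolutelyContinuousOnInterval
        (fun x : ℝ => Complex.exp (-(Complex.I * β l) * z * x)) 0 1 := by
      refine ContDiffOn.absolutelyContinuousOnInterval (ContDiff.contDiffOn ?_)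
      exact Complex.contDiff_exp.comp (contDiff_const.mul Complex.ofRealCLM.contDiff)
    exact e1.fun_smul (AbsolutelyContinuousOnInterval.clm_comp
      ((EuclideanSpace.proj (𝕜 := ℂ) l).restrictScalars ℝ) hac)
  have hdl (l : Fin 2) (z : ℂ) : ∀ᵐ x : ℝ ∂unitVolume, HasDerivAt
      (fun x : ℝ => Complex.exp (-(Complex.I * β l) * z * x) * y x l)
      (Complex.I * β l * ((-(Complex.I * β l) * x) ^ 0 *
        Complex.exp (-(Complex.I * β l) * z * x) * p.2 x l -
        z * ((-(Complex.I * β l) * x) ^ 0 *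
        Complex.exp (-(Complex.I * β l) * z * x) * p.1 x l))) x := by
    filter_upwards [hd, h1, h2] with x hx h1x h2x
    have d1 : HasDerivAt (fun x : ℝ => -(Complex.I * β l) * z * (x : ℂ))
        (-(Complex.I * β l) * z) x := by
      simpa using (Complex.ofRealCLM.hasDerivAt (x := x)).const_mul (-(Complex.I * β l) * z)
    have d2 : HasDerivAt (fun x => y x l) (y' x l) x :=
      ((EuclideanSpace.proj (𝕜 := ℂ) l).restrictScalars ℝ).hasFDerivAt.comp_hasDerivAt x hx
    refine (d1.cexp.mul d2).congr_deriv ?_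
    have hb : (β l : ℂ) ≠ 0 := by exact_mod_cast hβ l
    rw [h2x l, h1x]
    field_simp
    ring_nf
    rw [Complex.I_sq]; ring
  have hcont (l : Fin 2) (z : ℂ) : Continuous fun x : ℝ => (-(Complex.I * β l) * x) ^ 0 *
        Complex.exp (-(Complex.I * β l) * z * x) := by fun_prop
  refine ⟨fun l => y 0 l, fun l => y 1 l, hbc, fun l z => ?_, fun z hz l => ?_⟩
  · have := (integral_eq_sub_of_absolutelyContinuous (hacl l z) (hdl l z)).2
    rw [integral_const_mul, integral_sub (integrable_continuous_mul (integrable_coord _ l)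
      (hcont l z)) ((integrable_continuous_mul (integrable_coord _ l) (hcont l z)).const_mul _),
      integral_const_mul] at this
    change Complex.I * β l * (expTransform (fun x => p.2 x l) (-(Complex.I * β l)) 0 z -
        z * expTransform (fun x => p.1 x l) (-(Complex.I * β l)) 0 z) = _ at this
    have hb : (β l : ℂ) ≠ 0 := by exact_mod_cast hβ l
    simp only [Complex.ofReal_one, mul_one, Complex.ofReal_zero, mul_zero, Complex.exp_zero,
      one_mul] at this
    rw [← this]
    field_simp
    rw [Complex.I_sq]; ring
  · have hzero : ∀ᵐ x ∂unitVolume, HasDerivAt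
        (fun x : ℝ => Complex.exp (-(Complex.I * β l) * z * x) * y x l) 0 x := by
      filter_upwards [hdl l z, Lp.coeFn_smul z p.1] with x hx hs
      refine hx.congr_deriv ?_
      rw [hz, hs, Pi.smul_apply, PiLp.smul_apply, smul_eq_mul]
      ring
    obtain ⟨C, hC⟩ := (hacl l z).const_of_ae_hasDerivAt_zero (by
      rw [uIcc_of_le zero_le_one]
      exact (ae_restrict_iff' measurableSet_Icc).1 hzero)
    rw [uIcc_of_le zero_le_one] at hC
    have hC0 : y 0 l = C := by simpa using hC 0 (by simp)
    have hyx (x : ℝ) (hx : x ∈ Icc (0 : ℝ) 1) :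
        y x l = y 0 l * Complex.exp (Complex.I * β l * z * x) := by
      rw [hC0, ← hC x hx, mul_right_comm, ← Complex.exp_add]
      simp
    refine ⟨by simpa using hyx 1 (by simp), ?_⟩
    filter_upwards [h1, ae_restrict_mem measurableSet_Icc] with x h1x hx
    rw [h1x, hyx x hx]

/-- The boundary values `e^{i β_l z}` of the exponential solutions. -/
def expEnd (β : Fin 2 → ℝ) (l : Fin 2) (z : ℂ) : ℂ := Complex.exp (Complex.I * β l * z)

theorem expEnd_ne_zero (β : Fin 2 → ℝ) (l : Fin 2) (z : ℂ) : expEnd β l z ≠ 0 :=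
  Complex.exp_ne_zero _

@[fun_prop]
theorem differentiable_expEnd (β : Fin 2 → ℝ) (l : Fin 2) : Differentiable ℂ (expEnd β l) := by
  unfold expEnd; fun_prop

@[fun_prop]
theorem continuous_expEnd (β : Fin 2 → ℝ) (l : Fin 2) : Continuous (expEnd β l) :=
  (differentiable_expEnd β l).continuous

theorem exp_neg_eq_inv_expEnd (β : Fin 2 → ℝ) (l : Fin 2) (z : ℂ) :
    Complex.exp (-(Complex.I * β l) * z) = (expEnd β l z)⁻¹ := by
  rw [expEnd, ← Complex.exp_neg, neg_mul]

theorem charDet_normalForm (β : Fin 2 → ℝ) (a b c d z : ℂ) :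
    charDet β (normalForm a b c d) z =
      (1 + a * expEnd β 0 z) * (d + expEnd β 1 z) - b * (c * expEnd β 0 z) := by
  simp [charDet, Matrix.det_fin_two, bdry, fundCol, normalForm, expEnd]

theorem differentiable_charDet (β : Fin 2 → ℝ) (a b c d : ℂ) :
    Differentiable ℂ (charDet β (normalForm a b c d)) := by
  rw [funext (charDet_normalForm β a b c d)]
  fun_prop

theorem expTransform_add_smul (v w : L2C2) (s κ z : ℂ) (l : Fin 2) :
    expTransform (fun x => (v - s • w) x l) κ 0 z =
      expTransform (fun x => v x l) κ 0 z - s * expTransform (fun x => w x l) κ 0 z := by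
  have hc : Continuous fun x : ℝ => (κ * x) ^ 0 * Complex.exp (κ * z * x) := by fun_prop
  simp only [expTransform]
  rw [← integral_const_mul, ← integral_sub (integrable_continuous_mul (integrable_coord v l) hc)
    ((integrable_continuous_mul (integrable_coord w l) hc).const_mul s)]
  refine integral_congr_ae ?_
  filter_upwards [L2C2.coord_sub_smul v w s l] with x hx
  rw [hx]; ring

theorem mem_powKer_diracOp_succ {β : Fin 2 → ℝ} {A : Matrix (Fin 2) (Fin 4) ℂ} {z : ℂ} {k : ℕ}
    {x : L2C2} : x ∈ powKer (diracOp β A) z (k + 1) ↔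
      ∃ w, IsInGraph β A (x, w) ∧ w - z • x ∈ powKer (diracOp β A) z k := by
  simp only [mem_powKer_succ, mem_graph_diracOp]

/-- The boundary values of the generating polynomial of a chain of root vectors. -/
theorem exists_chain_trace {β : Fin 2 → ℝ} (hβ : ∀ l, β l ≠ 0) {A : Matrix (Fin 2) (Fin 4) ℂ}
    {z : ℂ} {k : ℕ} {x : L2C2} (hx : x ∈ powKer (diracOp β A) z k) :
    ∃ U V : ℂ → Fin 2 → ℂ, (∀ l, Continuous fun μ => U μ l) ∧
      (∀ μ j, A j 0 * U μ 0 + A j 1 * U μ 1 + A j 2 * V μ 0 + A j 3 * V μ 1 = 0) ∧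
      (∀ l μ, -Complex.I * (β l : ℂ)⁻¹ * ((expEnd β l μ)⁻¹ * V μ l - U μ l) =
        -((μ - z) ^ k * expTransform (fun t => x t l) (-(Complex.I * β l)) 0 μ)) ∧
      ((∀ l, U z l = 0) → x ∈ powKer (diracOp β A) z (k - 1)) ∧
      (k = 0 → ∀ μ l, U μ l = 0) := by
  induction k generalizing x with
  | zero =>
    have hx0 : x = 0 := (Submodule.mem_bot ℂ).1 hx
    refine ⟨0, 0, fun l => continuous_const, by simp, fun l μ => ?_, fun _ => hx, by simp⟩
    have h0 := expTransform_add_smul x x 1 (-(Complex.I * β l)) μ l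
    rw [one_smul, sub_self, one_mul, sub_self, ← hx0] at h0
    rw [h0]; simp
  | succ k ih =>
    obtain ⟨w, hw, hwx⟩ := mem_powKer_diracOp_succ.1 hx
    obtain ⟨U', V', hU', hbc', hid', himp, hzero⟩ := ih hwx
    obtain ⟨u, v, hbc, hid, heq⟩ := hw.exists_trace hβ
    -- The chain `x, (L - z)x, …` is collected into a polynomial in `μ - z`. Its Lagrange identities
    -- telescope and leave `(μ - z)^(k+1)` times the transform of `x`. The value at `μ = z` is the
    -- initial value of the last member of the chain, an eigenvector or zero; if it vanishes, so
    -- does that member and the chain is shorter. The clause for `k = 0` makes the polynomial start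
    -- from zero.
    refine ⟨fun μ l => (μ - z) ^ k * u l + U' μ l, fun μ l => (μ - z) ^ k * v l + V' μ l,
      fun l => ?_, fun μ j => ?_, fun l μ => ?_, fun h0 => ?_, fun h => absurd h k.succ_ne_zero⟩
    · have := hU' l
      fun_prop
    · linear_combination (μ - z) ^ k * hbc j + hbc' μ j
    · have h1 := hid l μ
      have h2 := hid' l μ
      rw [expTransform_add_smul] at h2
      rw [exp_neg_eq_inv_expEnd] at h1
      simp only at h1
      linear_combination h2 - (μ - z) ^ k * h1
    · rcases Nat.eq_zero_or_pos k with rfl | hk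
      · have hw0 : w - z • x = 0 := (Submodule.mem_bot ℂ).1 hwx
        have hu (l : Fin 2) : u l = 0 := by simpa [hzero rfl] using h0 l
        refine (Submodule.mem_bot ℂ).2 (L2C2.ext_coord fun l => ?_)
        filter_upwards [(heq z (sub_eq_zero.1 hw0) l).2, Lp.coeFn_zero C2 2 unitVolume] with t ht h0
        rw [h0]
        simpa [hu] using ht
      · have h1 := himp fun l => by simpa [hk.ne'] using h0 l
        rw [Nat.add_sub_cancel]
        obtain ⟨k, rfl⟩ := Nat.exists_eq_succ_of_ne_zero hk.ne'
        exact mem_powKer_diracOp_succ.2 ⟨w, hw, h1⟩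

/-- The ascent of `L(0) - z` is at most the order of the zero of the characteristic determinant. -/
theorem powKer_succ_le {β : Fin 2 → ℝ} (hβ : ∀ l, β l ≠ 0) {a b c d z : ℂ} {m k : ℕ}
    (hm : analyticOrderAt (charDet β (normalForm a b c d)) z = m) (hk : m ≤ k) :
    powKer (diracOp β (normalForm a b c d)) z (k + 1) ≤
      powKer (diracOp β (normalForm a b c d)) z k := by
  intro x hx
  obtain ⟨U, V, hU, hbc, hid, himp, -⟩ := exists_chain_trace hβ hx
  refine himp ?_
  set X : Fin 2 → ℂ → ℂ := fun l => expTransform (fun t => x t l) (-(Complex.I * β l)) 0 with hX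
  have hXc (l : Fin 2) : Continuous (X l) :=
    (differentiable_expTransform (integrable_coord x l) _ _).continuous
  have hV (l : Fin 2) (μ : ℂ) : V μ l = expEnd β l μ *
      (U μ l - Complex.I * β l * (μ - z) ^ (k + 1) * X l μ) := by
    have h1 := hid l μ
    have hb : (β l : ℂ) ≠ 0 := by exact_mod_cast hβ l
    have he := expEnd_ne_zero β l μ
    field_simp at h1
    linear_combination Complex.I * h1 + (V μ l - expEnd β l μ * U μ l) * Complex.I_sq
  obtain ⟨h, hh, hhz, hev⟩ :=
    ((differentiable_charDet β a b c d).analyticAt z).analyticOrderAt_eq_natCast.1 hm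
  have hr0 (μ : ℂ) : (1 + a * expEnd β 0 μ) * U μ 0 + b * U μ 1 =
      (μ - z) ^ (k + 1) * (a * expEnd β 0 μ * Complex.I * β 0 * X 0 μ) := by
    have h1 := hbc μ 0
    simp [normalForm] at h1
    rw [hV 0 μ] at h1
    linear_combination h1
  have hr1 (μ : ℂ) : c * expEnd β 0 μ * U μ 0 + (d + expEnd β 1 μ) * U μ 1 =
      (μ - z) ^ (k + 1) * (c * expEnd β 0 μ * Complex.I * β 0 * X 0 μ +
        expEnd β 1 μ * Complex.I * β 1 * X 1 μ) := by
    have h1 := hbc μ 1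
    simp [normalForm] at h1
    rw [hV 0 μ, hV 1 μ] at h1
    linear_combination h1
  -- Cramer's rule for the system `hr0`, `hr1`, whose determinant is the characteristic determinant.
  have hdet (l : Fin 2) : ∃ C : ℂ → ℂ, Continuous C ∧
      ∀ μ, charDet β (normalForm a b c d) μ * U μ l = (μ - z) ^ (k + 1) * C μ := by
    have := hXc 0
    have := hXc 1
    fin_cases l
    · refine ⟨fun μ => (d + expEnd β 1 μ) * (a * expEnd β 0 μ * Complex.I * β 0 * X 0 μ) -
        b * (c * expEnd β 0 μ * Complex.I * β 0 * X 0 μ + expEnd β 1 μ * Complex.I * β 1 * X 1 μ),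
        by fun_prop, fun μ => ?_⟩
      rw [charDet_normalForm]
      simp only [Fin.zero_eta]
      linear_combination (d + expEnd β 1 μ) * hr0 μ - b * hr1 μ
    · refine ⟨fun μ => (1 + a * expEnd β 0 μ) * (c * expEnd β 0 μ * Complex.I * β 0 * X 0 μ +
        expEnd β 1 μ * Complex.I * β 1 * X 1 μ) - c * expEnd β 0 μ *
        (a * expEnd β 0 μ * Complex.I * β 0 * X 0 μ), by fun_prop, fun μ => ?_⟩
      rw [charDet_normalForm]
      simp only [Fin.mk_one]
      linear_combination (1 + a * expEnd β 0 μ) * hr1 μ - c * expEnd β 0 μ * hr0 μ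
  intro l
  obtain ⟨C, hC, hCU⟩ := hdet l
  -- Cancelling the zero of order `m` leaves at least one factor `μ - z` because `m ≤ k`; letting `μ
  -- → z` then forces `U z l = 0`.
  have h1 : ∀ᶠ μ in nhdsWithin z {z}ᶜ, h μ * U μ l = (μ - z) ^ (k + 1 - m) * C μ := by
    filter_upwards [hev.filter_mono nhdsWithin_le_nhds, self_mem_nhdsWithin] with μ hμ hne
    have hne' : (μ - z) ^ m ≠ 0 := pow_ne_zero _ (sub_ne_zero.2 hne)
    have h2 := hCU μ
    rw [hμ, smul_eq_mul, show k + 1 = m + (k + 1 - m) by omega, pow_add] at h2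
    exact mul_left_cancel₀ hne' (by linear_combination h2)
  have h2 : Filter.Tendsto (fun μ => h μ * U μ l) (nhdsWithin z {z}ᶜ) (nhds (h z * U z l)) :=
    (hh.continuousAt.mul (hU l).continuousAt).tendsto.mono_left nhdsWithin_le_nhds
  have h3 : Filter.Tendsto (fun μ => (μ - z) ^ (k + 1 - m) * C μ) (nhdsWithin z {z}ᶜ)
      (nhds ((z - z) ^ (k + 1 - m) * C z)) :=
    (Continuous.tendsto (by fun_prop) z).mono_left nhdsWithin_le_nhds
  have h4 := tendsto_nhds_unique (h2.congr' h1) h3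
  rw [sub_self, zero_pow (by omega), zero_mul] at h4
  exact (mul_eq_zero.1 h4).resolve_left hhz

theorem rootSubspace_eq_powKer {β : Fin 2 → ℝ} (hβ : ∀ l, β l ≠ 0) {a b c d z : ℂ} {m : ℕ}
    (hm : analyticOrderAt (charDet β (normalForm a b c d)) z = m) :
    rootSubspace (diracOp β (normalForm a b c d)) z =
      powKer (diracOp β (normalForm a b c d)) z m := by
  refine le_antisymm (iSup_le fun k => ?_) (le_iSup (powKer _ z) m)
  rcases le_total k m with h | h
  · exact powKer_mono _ _ h
  · induction k, h using Nat.le_induction with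
    | base => exact le_rfl
    | succ k hk ih => exact (powKer_succ_le hβ hm hk).trans ih

/-! ### Exponential solutions, eigenvectors and their norms -/

/-- The exponential solution with initial value `u`. -/
def expVec (β : Fin 2 → ℝ) (z : ℂ) (u : Fin 2 → ℂ) : L2C2 :=
  contLp (fun l x => u l * Complex.exp (Complex.I * β l * z * x)) fun l => by fun_prop

theorem expVec_coord (β : Fin 2 → ℝ) (z : ℂ) (u : Fin 2 → ℂ) :
    ∀ᵐ x ∂unitVolume, ∀ l, expVec β z u x l = u l * Complex.exp (Complex.I * β l * z * x) :=
  coeFn_contLp _ _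

theorem expVec_add_smul (β : Fin 2 → ℝ) (z : ℂ) (u v : Fin 2 → ℂ) (s : ℂ) :
    expVec β z (u - s • v) = expVec β z u - s • expVec β z v := by
  refine L2C2.ext_coord fun l => ?_
  filter_upwards [expVec_coord β z u, expVec_coord β z v, expVec_coord β z (u - s • v),
    L2C2.coord_sub_smul (expVec β z u) (expVec β z v) s l] with x h1 h2 h3 h4
  rw [h4, h1, h2, h3]
  simp; ring

/-- The eigenvectors are the exponential solutions satisfying the boundary conditions. -/
theorem isInGraph_smul_self_iff {β : Fin 2 → ℝ} (hβ : ∀ l, β l ≠ 0) {a b c d z : ℂ} {x : L2C2} :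
    IsInGraph β (normalForm a b c d) (x, z • x) ↔ ∃ u : Fin 2 → ℂ, x = expVec β z u ∧
      (1 + a * expEnd β 0 z) * u 0 + b * u 1 = 0 ∧
      c * expEnd β 0 z * u 0 + (d + expEnd β 1 z) * u 1 = 0 := by
  constructor
  · intro h
    obtain ⟨u, v, hbc, -, heq⟩ := h.exists_trace hβ
    have heq := heq z rfl
    refine ⟨u, L2C2.ext_coord fun l => ?_, ?_, ?_⟩
    · filter_upwards [(heq l).2, expVec_coord β z u] with t h1 h2
      rw [h2]; exact h1
    · have := hbc 0
      simp [normalForm] at this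
      rw [(heq 0).1] at this
      rw [expEnd]
      linear_combination this
    · have := hbc 1
      simp [normalForm] at this
      rw [(heq 0).1, (heq 1).1] at this
      rw [expEnd, expEnd]
      linear_combination this
  · rintro ⟨u, rfl, h0, h1⟩
    have hz : z • expVec β z u = contLp
        (fun l x => z * (u l * Complex.exp (Complex.I * β l * z * x))) fun l => by fun_prop := by
      refine L2C2.ext_coord fun l => ?_
      filter_upwards [expVec_coord β z u, Lp.coeFn_smul z (expVec β z u),
        coeFn_contLp (fun l x => z * (u l * Complex.exp (Complex.I * β l * z * x)))
        fun l => by fun_prop] with x hx hs hc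
      rw [hs, hc, Pi.smul_apply, PiLp.smul_apply, hx, smul_eq_mul]
    rw [hz]
    refine isInGraph_contLp hβ _ _ (fun l x => ?_) fun j => ?_
    · have h2 : HasDerivAt (fun x : ℝ => Complex.I * β l * z * (x : ℂ))
          (Complex.I * β l * z) x := by
        simpa using (Complex.ofRealCLM.hasDerivAt (x := x)).const_mul (Complex.I * β l * z)
      refine (h2.cexp.const_mul (u l)).congr_deriv ?_
      ring
    · fin_cases j
      · simp [normalForm]
        rw [expEnd] at h0
        linear_combination h0
      · simp [normalForm]
        rw [expEnd, expEnd] at h1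
        linear_combination h1

theorem expVec_mem_span (β : Fin 2 → ℝ) (z : ℂ) (u : Fin 2 → ℂ) :
    expVec β z u ∈ Submodule.span ℂ {expVec β z ![1, 0], expVec β z ![0, 1]} := by
  rw [Submodule.mem_span_pair]
  refine ⟨u 0, u 1, L2C2.ext_coord fun l => ?_⟩
  filter_upwards [expVec_coord β z u, expVec_coord β z ![1, 0], expVec_coord β z ![0, 1],
    Lp.coeFn_add (u 0 • expVec β z ![1, 0]) (u 1 • expVec β z ![0, 1]),
    Lp.coeFn_smul (u 0) (expVec β z ![1, 0]), Lp.coeFn_smul (u 1) (expVec β z ![0, 1])]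
    with x h1 h2 h3 h4 h5 h6
  rw [h4, Pi.add_apply, h5, h6, PiLp.add_apply, Pi.smul_apply, Pi.smul_apply, PiLp.smul_apply,
    PiLp.smul_apply, h1, h2, h3]
  fin_cases l <;> simp

/-- `L(0) - z` maps each kernel into the preceding one, and its own kernel is contained in the span
of two exponential solutions, so the dimension stays finite by induction. -/
theorem finiteDimensional_powKer {β : Fin 2 → ℝ} (hβ : ∀ l, β l ≠ 0) (a b c d z : ℂ) (k : ℕ) :
    FiniteDimensional ℂ (powKer (diracOp β (normalForm a b c d)) z k) := by
  rw [FiniteDimensional, Module.Finite.iff_fg]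
  induction k with
  | zero => exact Submodule.fg_bot
  | succ k ih =>
    refine Submodule.FG.map _ (Submodule.fg_of_fg_map_of_fg_inf_ker
      ((diracOp β (normalForm a b c d)).toFun - z • (diracOp β (normalForm a b c d)).domain.subtype)
      ?_ ?_)
    · exact Submodule.FG.of_le ih (Submodule.map_comap_le _ _)
    · refine Submodule.fg_of_fg_map_injective
        (diracOp β (normalForm a b c d)).domain.subtype Subtype.val_injective ?_
      refine Submodule.FG.of_le (Submodule.fg_span (s := {expVec β z ![1, 0], expVec β z ![0, 1]})
        (by simp)) ?_
      rintro _ ⟨y, ⟨-, hy⟩, rfl⟩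
      have h1 : (diracOp β (normalForm a b c d)) y = z • (y : L2C2) :=
        sub_eq_zero.1 (LinearMap.mem_ker.1 hy)
      have h2 := (mem_graph_diracOp _ _ _).1 ((diracOp β (normalForm a b c d)).mem_graph y)
      rw [h1] at h2
      obtain ⟨u, hu, -⟩ := (isInGraph_smul_self_iff hβ).1 h2
      change (y : L2C2) ∈ _
      rw [hu]
      exact expVec_mem_span β z u

/-- `∫₀¹ e^{s(1-2x)} dx = sinh s / s`. -/
def sinhc (s : ℝ) : ℝ := ∫ x, Real.exp (s * (1 - 2 * x)) ∂unitVolume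

theorem integrable_unitVolume {g : ℝ → ℝ} (hg : Continuous g) : Integrable g unitVolume :=
  hg.integrableOn_Icc

theorem integral_unitVolume (g : ℝ → ℝ) : ∫ x, g x ∂unitVolume = ∫ x in (0 : ℝ)..1, g x := by
  rw [intervalIntegral.integral_of_le zero_le_one, integral_Icc_eq_integral_Ioc]

theorem sinhc_neg (s : ℝ) : sinhc (-s) = sinhc s := by
  simp only [sinhc, integral_unitVolume]
  have := intervalIntegral.integral_comp_sub_left (a := 0) (b := 1)
    (fun x => Real.exp (-s * (1 - 2 * x))) 1
  rw [sub_zero, sub_self] at this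
  rw [← this]
  refine intervalIntegral.integral_congr fun x _ => congrArg Real.exp ?_
  ring

theorem sinhc_eq_integral_cosh (s : ℝ) :
    sinhc s = ∫ x, Real.cosh (s * (1 - 2 * x)) ∂unitVolume := by
  have h1 : sinhc s = (sinhc s + sinhc (-s)) / 2 := by rw [sinhc_neg]; ring
  rw [h1, sinhc, sinhc, ← integral_add, ← integral_div]
  · refine integral_congr_ae (ae_of_all _ fun x => ?_)
    simp only [Real.cosh_eq, neg_mul]
  all_goals exact integrable_unitVolume (by fun_prop)

theorem one_add_sq_div_two_le_cosh (x : ℝ) : 1 + x ^ 2 / 2 ≤ Real.cosh x := by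
  have h1 : |x / 2| ≤ |Real.sinh (x / 2)| := by
    rw [Real.abs_sinh]; exact Real.self_le_sinh_iff.2 (abs_nonneg _)
  have h2 := sq_le_sq.2 h1
  have h3 := Real.cosh_two_mul (x / 2)
  rw [mul_div_cancel₀ x two_ne_zero, Real.cosh_sq] at h3
  rw [h3]; linarith

/-- Integrating the quadratic minorant of `cosh`. Together with the upper bound
`sinhc_sq_sub_one_le` this makes `sinhc s ^ 2 - 1` comparable to `s ^ 2` on bounded sets, which is
how `|Im λ|²` enters the criterion. -/
theorem one_add_sq_div_six_le_sinhc (s : ℝ) : 1 + s ^ 2 / 6 ≤ sinhc s := by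
  have h1 : ∫ x, (1 + (s * (1 - 2 * x)) ^ 2 / 2) ∂unitVolume = 1 + s ^ 2 / 6 := by
    rw [integral_unitVolume]
    have hd (x : ℝ) : HasDerivAt (fun x : ℝ => x - s ^ 2 * (1 - 2 * x) ^ 3 / 12)
        (1 + (s * (1 - 2 * x)) ^ 2 / 2) x := by
      have h2 : HasDerivAt (fun x : ℝ => 1 - 2 * x) (-2) x := by
        simpa using ((hasDerivAt_id x).const_mul 2).const_sub 1
      refine ((hasDerivAt_id x).sub (((h2.pow 3).const_mul (s ^ 2)).div_const 12)).congr_deriv ?_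
      push_cast; ring
    rw [intervalIntegral.integral_eq_sub_of_hasDerivAt (fun x _ => hd x)
      (Continuous.intervalIntegrable (by fun_prop) _ _)]
    ring
  rw [← h1, sinhc_eq_integral_cosh]
  refine integral_mono (integrable_unitVolume (by fun_prop)) (integrable_unitVolume (by fun_prop))
    fun x => ?_
  exact one_add_sq_div_two_le_cosh _

theorem one_le_sinhc (s : ℝ) : 1 ≤ sinhc s := by
  nlinarith [one_add_sq_div_six_le_sinhc s, sq_nonneg s]

theorem sinhc_le_exp (s : ℝ) : sinhc s ≤ Real.exp (s ^ 2 / 2) := by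
  rw [sinhc_eq_integral_cosh]
  have h1 : ∫ _x : ℝ, Real.exp (s ^ 2 / 2) ∂unitVolume = Real.exp (s ^ 2 / 2) := by simp
  rw [← h1]
  refine integral_mono_ae (integrable_unitVolume (by fun_prop))
    (integrable_unitVolume (by fun_prop)) ?_
  refine (ae_restrict_iff' measurableSet_Icc).2 (ae_of_all _ fun x hx => ?_)
  refine (Real.cosh_le_exp_half_sq _).trans (Real.exp_le_exp.2 ?_)
  have h2 : (1 - 2 * x) ^ 2 ≤ 1 := by nlinarith [hx.1, hx.2]
  rw [mul_pow]
  nlinarith [sq_nonneg s]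

theorem norm_expEnd (β : Fin 2 → ℝ) (l : Fin 2) (z : ℂ) :
    ‖expEnd β l z‖ = Real.exp (-(β l * z.im)) := by
  rw [expEnd, Complex.norm_exp]; simp

/-- Taking the midpoint value out of `|e^{iβzx}|² = e^{-2β x Im z}` leaves `e^{β Im z (1 - 2x)}`,
whose integral is even in `Im z`. -/
theorem norm_expVec_sq (β : Fin 2 → ℝ) (z : ℂ) (u : Fin 2 → ℂ) :
    ‖expVec β z u‖ ^ 2 =
      ∑ l, ‖u l‖ ^ 2 * (Real.exp (-(β l * z.im)) * sinhc (β l * z.im)) := by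
  have h1 := inner_self_eq_norm_sq_to_K (𝕜 := ℂ) (expVec β z u)
  rw [inner_eq_sum_integral] at h1
  have h2 (l : Fin 2) : ∫ x, conj (expVec β z u x l) * expVec β z u x l ∂unitVolume =
      ((‖u l‖ ^ 2 * (Real.exp (-(β l * z.im)) * sinhc (β l * z.im)) : ℝ) : ℂ) := by
    rw [sinhc, ← integral_const_mul, ← integral_const_mul, ← integral_complex_ofReal]
    refine integral_congr_ae ?_
    filter_upwards [expVec_coord β z u] with x hx
    rw [hx, Complex.conj_mul', norm_mul, Complex.norm_exp, ← Real.exp_add]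
    norm_cast
    rw [mul_pow, ← Real.exp_nat_mul]
    congr 2
    simp; ring
  simp only [h2, ← Complex.ofReal_sum] at h1
  exact Complex.ofReal_injective ((Complex.ofReal_pow _ _).trans h1.symm)

/-! ### Adjoint eigenvectors and the biorthogonal vector at a simple zero -/

theorem inner_expVec_conj (β : Fin 2 → ℝ) (z : ℂ) (G : Fin 2 → ℂ) (w : L2C2) :
    inner ℂ (expVec β (conj z) fun l => conj (G l)) w =
      ∑ l, G l * expTransform (fun x => w x l) (-(Complex.I * β l)) 0 z := by
  rw [expVec, inner_contLp]
  refine Finset.sum_congr rfl fun l _ => ?_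
  rw [expTransform, ← integral_const_mul]
  refine integral_congr_ae (ae_of_all _ fun x => ?_)
  simp only [map_mul, Complex.conj_conj, ← Complex.exp_conj, Complex.conj_I, Complex.conj_ofReal]
  rw [pow_zero]; ring_nf

/-- With the conjugate spectral parameter on the left the exponentials cancel, and the integrands
are constant. -/
theorem inner_expVec_conj_expVec (β : Fin 2 → ℝ) (z : ℂ) (G u : Fin 2 → ℂ) :
    inner ℂ (expVec β (conj z) fun l => conj (G l)) (expVec β z u) = ∑ l, G l * u l := by
  rw [inner_expVec_conj]
  refine Finset.sum_congr rfl fun l _ => ?_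
  congr 1
  have : ∫ _x : ℝ, u l ∂unitVolume = u l := by simp
  refine Eq.trans (integral_congr_ae ?_) this
  filter_upwards [expVec_coord β z u] with x hx
  rw [hx, pow_zero, one_mul, mul_left_comm, ← Complex.exp_add]
  simp

/-- The adjoint eigenvector, as a left eigenvector of `L(0)`. -/
theorem inner_adjoint_eigenvector {β : Fin 2 → ℝ} (hβ : ∀ l, β l ≠ 0) {a b c d z s t : ℂ}
    (h0 : s * (1 + a * expEnd β 0 z) + t * (c * expEnd β 0 z) = 0)
    (h1 : s * b + t * (d + expEnd β 1 z) = 0) {x w : L2C2}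
    (hx : IsInGraph β (normalForm a b c d) (x, w)) :
    inner ℂ (expVec β (conj z) fun l => conj (![-(β 0 * s), β 1 * expEnd β 1 z * t] l)) w =
      z * inner ℂ (expVec β (conj z)
        fun l => conj (![-(β 0 * s), β 1 * expEnd β 1 z * t] l)) x := by
  obtain ⟨u, v, hbc, hid, -⟩ := hx.exists_trace hβ
  rw [inner_expVec_conj, inner_expVec_conj, Fin.sum_univ_two, Fin.sum_univ_two]
  have k0 := hid 0 z
  have k1 := hid 1 z
  rw [exp_neg_eq_inv_expEnd] at k0 k1
  have b0 := hbc 0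
  have b1 := hbc 1
  simp [normalForm] at b0 b1
  have n0 := expEnd_ne_zero β 0 z
  have n1 := expEnd_ne_zero β 1 z
  have m0 : (β 0 : ℂ) ≠ 0 := by exact_mod_cast hβ 0
  have m1 : (β 1 : ℂ) ≠ 0 := by exact_mod_cast hβ 1
  simp only [Matrix.cons_val_zero, Matrix.cons_val_one]
  simp only at k0 k1
  -- The boundary terms cancel because `(s, t)` is a left null vector of the characteristic matrix;
  -- the coefficients of `G` are chosen to match its combination of the two boundary conditions.
  have key : -(β 0 * s) * (-Complex.I * (β 0 : ℂ)⁻¹ * ((expEnd β 0 z)⁻¹ * v 0 - u 0)) +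
      β 1 * expEnd β 1 z * t * (-Complex.I * (β 1 : ℂ)⁻¹ * ((expEnd β 1 z)⁻¹ * v 1 - u 1)) = 0 := by
    field_simp
    linear_combination Complex.I * (v 0 * h0 + expEnd β 0 z * u 1 * h1 - s * expEnd β 0 z * b0
      - t * expEnd β 0 z * b1)
  linear_combination -(β 0 * s) * k0 + β 1 * expEnd β 1 z * t * k1 + key

/-- A singular 2 × 2 matrix is a column times a row. Applied to the adjugate of the characteristic
matrix at a zero of its determinant, the column is a right null vector and the row a left one. -/
theorem exists_outer_product {x₁ x₂ x₃ x₄ : ℂ} (h : x₁ * x₄ = x₂ * x₃) :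
    ∃ p q s t : ℂ, x₁ = p * s ∧ x₂ = p * t ∧ x₃ = q * s ∧ x₄ = q * t := by
  by_cases h1 : x₁ = 0
  · rcases mul_eq_zero.1 (h.symm.trans (by rw [h1, zero_mul])) with h2 | h3
    · exact ⟨0, 1, x₃, x₄, by simp [h1], by simp [h2], by simp, by simp⟩
    · exact ⟨x₂, x₄, 0, 1, by simp [h1], by simp, by simp [h3], by simp⟩
  · refine ⟨1, x₃ / x₁, x₁, x₂, by simp, by simp, by field_simp, ?_⟩
    field_simp
    linear_combination h

theorem hasDerivAt_expEnd (β : Fin 2 → ℝ) (l : Fin 2) (z : ℂ) :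
    HasDerivAt (expEnd β l) (Complex.I * β l * expEnd β l z) z := by
  have h1 : HasDerivAt (fun z : ℂ => Complex.I * β l * z) (Complex.I * β l) z := by
    simpa using (hasDerivAt_id z).const_mul (Complex.I * (β l : ℂ))
  exact h1.cexp.congr_deriv (mul_comm _ _)

/-- Writing `δ` for the nonvanishing expression, `Δ₀' = i β₀ Δ₀ + i δ`; at a zero, `δ` is therefore
`Δ₀'` up to the factor `i`. -/
theorem deriv_charDet_ne_zero {β : Fin 2 → ℝ} {a b c d z : ℂ}
    (hz : analyticOrderAt (charDet β (normalForm a b c d)) z = 1) :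
    charDet β (normalForm a b c d) z = 0 ∧
      -(β 0 * (d + expEnd β 1 z)) + β 1 * expEnd β 1 z * (1 + a * expEnd β 0 z) ≠ 0 := by
  have han := (differentiable_charDet β a b c d).analyticAt z
  have h0 : charDet β (normalForm a b c d) z = 0 := by
    by_contra h
    rw [han.analyticOrderAt_eq_zero.2 h] at hz
    exact zero_ne_one hz
  refine ⟨h0, fun h => ?_⟩
  have hd : HasDerivAt (charDet β (normalForm a b c d)) 0 z := by
    have h1 := (((hasDerivAt_expEnd β 0 z).const_mul a).const_add 1).mul
      ((hasDerivAt_expEnd β 1 z).const_add d)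
    have h2 := h1.sub (((hasDerivAt_expEnd β 0 z).const_mul c).const_mul b)
    rw [funext (charDet_normalForm β a b c d)]
    refine h2.congr_deriv ?_
    rw [charDet_normalForm] at h0
    linear_combination Complex.I * β 0 * h0 + Complex.I * h
  have h2 : ((2 : ℕ) : ℕ∞) ≤ analyticOrderAt (charDet β (normalForm a b c d)) z := by
    rw [natCast_le_analyticOrderAt_iff_iteratedDeriv_eq_zero han]
    intro i hi
    interval_cases i
    · simpa using h0
    · simpa using hd.deriv
  rw [hz] at h2
  exact absurd h2 (by decide)

/-- The root subspace at a simple zero, and the biorthogonal vector. -/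
theorem exists_biorthogonal_of_simple {β : Fin 2 → ℝ} (h0 : β 0 < 0) (h1 : 0 < β 1)
    {a b c d z : ℂ} (hz : analyticOrderAt (charDet β (normalForm a b c d)) z = 1) {f : L2C2}
    (hf : f ∈ rootSubspace (diracOp β (normalForm a b c d)) z) (hfn : ‖f‖ = 1) :
    rootSubspace (diracOp β (normalForm a b c d)) z ≤ Submodule.span ℂ {f} ∧
    ∃ g : L2C2, inner ℂ g f = (1 : ℂ) ∧
      (∀ z' x, z' ≠ z → x ∈ rootSubspace (diracOp β (normalForm a b c d)) z' →
        inner ℂ g x = (0 : ℂ)) ∧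
      ∃ p q s t : ℂ, d + expEnd β 1 z = p * s ∧ -b = p * t ∧ -(c * expEnd β 0 z) = q * s ∧
        1 + a * expEnd β 0 z = q * t ∧
        -(β 0 * (d + expEnd β 1 z)) + β 1 * expEnd β 1 z * (1 + a * expEnd β 0 z) ≠ 0 ∧
        ‖g‖ ^ 2 * ‖-(β 0 * (d + expEnd β 1 z)) + β 1 * expEnd β 1 z * (1 + a * expEnd β 0 z)‖ ^ 2 =
          ‖expVec β z ![p, q]‖ ^ 2 *
          ‖expVec β (conj z) fun l => conj (![-(β 0 * s), β 1 * expEnd β 1 z * t] l)‖ ^ 2 := by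
  have hβ : ∀ l, β l ≠ 0 := Fin.forall_fin_two.2 ⟨h0.ne, h1.ne'⟩
  obtain ⟨hdet, hδ⟩ := deriv_charDet_ne_zero hz
  set δ := -(β 0 * (d + expEnd β 1 z)) + β 1 * expEnd β 1 z * (1 + a * expEnd β 0 z) with hδdef
  rw [charDet_normalForm] at hdet
  obtain ⟨p, q, s, t, e1, e2, e3, e4⟩ := exists_outer_product
    (x₁ := d + expEnd β 1 z) (x₂ := -b) (x₃ := -(c * expEnd β 0 z)) (x₄ := 1 + a * expEnd β 0 z)
    (by linear_combination hdet)
  have hpq : p ≠ 0 ∨ q ≠ 0 := by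
    by_contra! h
    apply hδ
    rw [hδdef, e1, e4, h.1, h.2]; ring
  have hst : s ≠ 0 ∨ t ≠ 0 := by
    by_contra! h
    apply hδ
    rw [hδdef, e1, e4, h.1, h.2]; ring
  set y := expVec β z ![p, q] with hy
  set G : Fin 2 → ℂ := ![-(β 0 * s), β 1 * expEnd β 1 z * t] with hG
  set g := expVec β (conj z) fun l => conj (G l) with hg
  have hroot : ∀ x ∈ rootSubspace (diracOp β (normalForm a b c d)) z, ∃ κ : ℂ, x = κ • y := by
    intro x hx
    rw [rootSubspace_eq_powKer hβ (m := 1) (by simpa using hz)] at hx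
    obtain ⟨w, hw, hw0⟩ := mem_powKer_diracOp_succ.1 hx
    have hw0 : w - z • x = 0 := (Submodule.mem_bot ℂ).1 hw0
    rw [sub_eq_zero.1 hw0] at hw
    obtain ⟨u, rfl, k0, k1⟩ := (isInGraph_smul_self_iff hβ).1 hw
    have k0' : t * (q * u 0 - p * u 1) = 0 := by
      rw [e4] at k0
      linear_combination k0 + u 1 * e2
    have k1' : s * (q * u 0 - p * u 1) = 0 := by
      rw [e1] at k1
      linear_combination -k1 - u 0 * e3
    have hqp : q * u 0 - p * u 1 = 0 := by
      rcases hst with h | h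
      · exact (mul_eq_zero.1 k1').resolve_left h
      · exact (mul_eq_zero.1 k0').resolve_left h
    have hu : ∃ κ : ℂ, u = κ • ![p, q] := by
      rcases hpq with h | h
      · refine ⟨u 0 / p, funext (Fin.forall_fin_two.2 ⟨?_, ?_⟩)⟩
        · simp [h]
        · simp; field_simp; linear_combination -hqp
      · refine ⟨u 1 / q, funext (Fin.forall_fin_two.2 ⟨?_, ?_⟩)⟩
        · simp; field_simp; linear_combination hqp
        · simp [h]
    obtain ⟨κ, rfl⟩ := hu
    refine ⟨κ, ?_⟩
    have := expVec_add_smul β z 0 ![p, q] (-κ)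
    have hz0 : expVec β z 0 = 0 := by
      have h := expVec_add_smul β z 0 0 1
      simpa using h
    simpa [hz0] using this
  have hleft : ∀ x w, (x, w) ∈ (diracOp β (normalForm a b c d)).graph →
      inner ℂ g w = z * inner ℂ g x := fun x w hx =>
    inner_adjoint_eigenvector hβ (by rw [e4]; linear_combination -t * e3)
      (by rw [e1]; linear_combination -s * e2) ((mem_graph_diracOp _ _ _).1 hx)
  -- The pairing of the two eigenvectors is the derivative of the determinant up to `i`, so at a
  -- simple zero they can be normalized against each other.
  have hgy : inner ℂ g y = δ := by
    rw [hg, hy, inner_expVec_conj_expVec, Fin.sum_univ_two, hδdef, e1, e4]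
    simp [hG]; ring
  obtain ⟨κ, hκ⟩ := hroot f hf
  have hκ0 : κ ≠ 0 := by
    rintro rfl
    rw [hκ, zero_smul, norm_zero] at hfn
    exact zero_ne_one hfn
  -- The scalar is conjugated because the inner product is conjugate-linear in its first argument.
  refine ⟨fun x hx => ?_, (conj (κ * δ)⁻¹ : ℂ) • g, ?_, fun z' x hz' hx => ?_,
    p, q, s, t, e1, e2, e3, e4, hδ, ?_⟩
  · obtain ⟨κ', rfl⟩ := hroot x hx
    rw [Submodule.mem_span_singleton]
    exact ⟨κ' / κ, by rw [hκ, smul_smul, div_mul_cancel₀ _ hκ0]⟩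
  · rw [hκ, inner_smul_left, inner_smul_right, hgy, Complex.conj_conj]
    field_simp
  · rw [inner_smul_left, eq_zero_of_mem_rootSubspace (innerSL ℂ g).toLinearMap
      (fun x w h => hleft x w h) hz' hx |> fun h : inner ℂ g x = 0 => h, mul_zero]
  · have hky : ‖κ‖ * ‖y‖ = 1 := by rw [← norm_smul, ← hκ, hfn]
    rw [norm_smul, RCLike.norm_conj, norm_inv, norm_mul]
    have hn1 : ‖κ‖ ≠ 0 := norm_ne_zero_iff.2 hκ0
    have hn2 : ‖δ‖ ≠ 0 := norm_ne_zero_iff.2 hδ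
    have : ‖y‖ = ‖κ‖⁻¹ := eq_inv_of_mul_eq_one_right hky
    rw [this]
    field_simp
    rfl

theorem sinhc_sq_sub_one_le {s B : ℝ} (hs : |s| ≤ B) :
    sinhc s ^ 2 - 1 ≤ Real.exp (B ^ 2) * s ^ 2 := by
  have h1 : sinhc s ^ 2 ≤ Real.exp (s ^ 2) := by
    refine (pow_le_pow_left₀ (zero_le_one.trans (one_le_sinhc s)) (sinhc_le_exp s) 2).trans_eq ?_
    rw [← Real.exp_nat_mul]; congr 1; push_cast; ring
  have h2 : Real.exp (s ^ 2) ≤ Real.exp (B ^ 2) :=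
    Real.exp_le_exp.2 (sq_le_sq.2 (hs.trans (le_abs_self B)))
  have h3 : 1 - s ^ 2 ≤ Real.exp (-s ^ 2) := by
    have := Real.add_one_le_exp (-s ^ 2); linarith
  have h4 : Real.exp (s ^ 2) * Real.exp (-s ^ 2) = 1 := by rw [← Real.exp_add]; simp
  nlinarith [Real.exp_pos (s ^ 2), sq_nonneg s]

/-! ### The exact formula for the squared norm of the biorthogonal vector -/

/-- The factor `1 + d e^{-i β₁ z}`. -/
def dFactor (β : Fin 2 → ℝ) (d z : ℂ) : ℂ := 1 + d * (expEnd β 1 z)⁻¹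

/-- The factor `1 + a e^{i β₀ z}`. -/
def aFactor (β : Fin 2 → ℝ) (a z : ℂ) : ℂ := 1 + a * expEnd β 0 z

theorem zVal_eq (β : Fin 2 → ℝ) (a d z : ℂ) :
    zVal (β 0) (β 1) a d z = dFactor β d z * conj (aFactor β a z) := by
  rw [zVal, dFactor, aFactor, ← exp_neg_eq_inv_expEnd, expEnd, neg_mul]

/-- The numerator of the excess of the squared norm of the biorthogonal vector. -/
def excess (β : Fin 2 → ℝ) (a b c d z : ℂ) : ℝ :=
  β 0 ^ 2 * ‖dFactor β d z‖ ^ 2 * (sinhc (β 0 * z.im) ^ 2 - 1) +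
  β 1 ^ 2 * ‖aFactor β a z‖ ^ 2 * (sinhc (β 1 * z.im) ^ 2 - 1) +
  (β 0 * ‖c‖ + β 1 * ‖b‖) ^ 2 * Real.exp ((β 1 - β 0) * z.im) *
    (sinhc (β 0 * z.im) * sinhc (β 1 * z.im)) +
  2 * (-β 0 * β 1) * ‖zVal (β 0) (β 1) a d z‖ *
    (sinhc (β 0 * z.im) * sinhc (β 1 * z.im) - 1) +
  2 * (-β 0 * β 1) * (‖zVal (β 0) (β 1) a d z‖ - (zVal (β 0) (β 1) a d z).re)

/-- The denominator of the excess of the squared norm of the biorthogonal vector. -/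
def excessDen (β : Fin 2 → ℝ) (a d z : ℂ) : ℝ :=
  β 0 ^ 2 * ‖dFactor β d z‖ ^ 2 + β 1 ^ 2 * ‖aFactor β a z‖ ^ 2 +
    2 * (-β 0 * β 1) * (zVal (β 0) (β 1) a d z).re

/-- At a zero of the determinant the product of the two factors is `bc` times a quotient of
exponentials. Hence in a strip `|z_n|` is bounded away from zero, unless `bc = 0` and all `z_n`
vanish. -/
theorem norm_zVal {β : Fin 2 → ℝ} {a b c d z : ℂ}
    (hz : charDet β (normalForm a b c d) z = 0) :
    ‖zVal (β 0) (β 1) a d z‖ = ‖b‖ * ‖c‖ * Real.exp ((β 1 - β 0) * z.im) := by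
  rw [charDet_normalForm] at hz
  have n1 := expEnd_ne_zero β 1 z
  have h1 : dFactor β d z * aFactor β a z = b * c * (expEnd β 0 z * (expEnd β 1 z)⁻¹) := by
    rw [dFactor, aFactor]; field_simp; linear_combination hz
  rw [zVal_eq, norm_mul, RCLike.norm_conj, ← norm_mul, h1, norm_mul, norm_mul, norm_mul, norm_inv,
    norm_expEnd, norm_expEnd, ← Real.exp_neg, ← Real.exp_add]
  congr 2; ring

/-- After extracting `expEnd β 1 z`, the pairing is the real combination `-β₀ D + β₁ A` of the two
factors. Expanding its squared modulus produces `Re z_n` as the cross term. -/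
theorem norm_delta_sq (β : Fin 2 → ℝ) (a d z : ℂ) :
    ‖-(β 0 * (d + expEnd β 1 z)) + β 1 * expEnd β 1 z * (1 + a * expEnd β 0 z)‖ ^ 2 =
      ‖expEnd β 1 z‖ ^ 2 * excessDen β a d z := by
  have n1 := expEnd_ne_zero β 1 z
  have h1 : -(β 0 * (d + expEnd β 1 z)) + β 1 * expEnd β 1 z * (1 + a * expEnd β 0 z) =
      expEnd β 1 z * (((-β 0 : ℝ) : ℂ) * dFactor β d z + ((β 1 : ℝ) : ℂ) * aFactor β a z) := by
    rw [dFactor, aFactor]; push_cast; field_simp; ring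
  have h2 : ‖((-β 0 : ℝ) : ℂ) * dFactor β d z + ((β 1 : ℝ) : ℂ) * aFactor β a z‖ ^ 2 =
      excessDen β a d z := by
    rw [← Complex.normSq_eq_norm_sq, Complex.normSq_add, excessDen, zVal_eq,
      ← Complex.normSq_eq_norm_sq, ← Complex.normSq_eq_norm_sq]
    simp only [Complex.normSq_ofReal, map_mul, Complex.conj_ofReal]
    rw [show ((-β 0 : ℝ) : ℂ) * dFactor β d z * (((β 1 : ℝ) : ℂ) * conj (aFactor β a z)) =
      ((-β 0 * β 1 : ℝ) : ℂ) * (dFactor β d z * conj (aFactor β a z)) by push_cast; ring,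
      Complex.re_ofReal_mul]
    ring
  rw [h1, norm_mul, mul_pow, h2]

/-- The product of the norms of an eigenvector and the adjoint eigenvector. -/
theorem norm_expVec_mul_norm_expVec {β : Fin 2 → ℝ} {a b c d z p q s t : ℂ}
    (hz : charDet β (normalForm a b c d) z = 0)
    (e1 : d + expEnd β 1 z = p * s) (e2 : -b = p * t) (e3 : -(c * expEnd β 0 z) = q * s)
    (e4 : 1 + a * expEnd β 0 z = q * t) :
    ‖expVec β z ![p, q]‖ ^ 2 *
      ‖expVec β (conj z) fun l => conj (![-(β 0 * s), β 1 * expEnd β 1 z * t] l)‖ ^ 2 =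
      ‖expEnd β 1 z‖ ^ 2 * (excess β a b c d z + excessDen β a d z) := by
  have n1 := expEnd_ne_zero β 1 z
  -- The outer product expresses all products of norms through `D`, `A`, `b` and `c`. The mixed
  -- terms give `β₀²|c|² + β₁²|b|²`; completing this to `(β₀|c| + β₁|b|)²` leaves a multiple of
  -- `|b||c|`, that is, of `|z_n|`.
  have k1 : ‖expEnd β 1 z‖ * ‖dFactor β d z‖ = ‖p‖ * ‖s‖ := by
    rw [← norm_mul, ← norm_mul, ← e1, dFactor]; congr 1; field_simp; ring
  have k2 : ‖b‖ = ‖p‖ * ‖t‖ := by rw [← norm_mul, ← e2, norm_neg]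
  have k3 : ‖c‖ * ‖expEnd β 0 z‖ = ‖q‖ * ‖s‖ := by rw [← norm_mul, ← norm_mul, ← e3, norm_neg]
  have k4 : ‖aFactor β a z‖ = ‖q‖ * ‖t‖ := by rw [← norm_mul, ← e4, aFactor]
  rw [norm_expVec_sq, norm_expVec_sq, excess, excessDen, norm_zVal hz, Fin.sum_univ_two,
    Fin.sum_univ_two]
  simp only [RCLike.norm_conj, Matrix.cons_val_zero, Matrix.cons_val_one, norm_neg, norm_mul,
    Complex.norm_real, Complex.conj_im, mul_neg, neg_neg, sinhc_neg, mul_pow, Real.norm_eq_abs,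
    sq_abs]
  rw [norm_expEnd] at k1 k3 ⊢
  set S0 := sinhc (β 0 * z.im)
  set S1 := sinhc (β 1 * z.im)
  set r0 := Real.exp (β 0 * z.im) with hr0
  set r1 := Real.exp (β 1 * z.im) with hr1
  have hw : Real.exp ((β 1 - β 0) * z.im) = r1 / r0 := by
    rw [hr1, hr0, ← Real.exp_sub]; congr 1; ring
  have i0 : Real.exp (-(β 0 * z.im)) = r0⁻¹ := Real.exp_neg _
  have i1 : Real.exp (-(β 1 * z.im)) = r1⁻¹ := Real.exp_neg _
  have p0 : r0 ≠ 0 := (Real.exp_pos _).ne'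
  have p1 : r1 ≠ 0 := (Real.exp_pos _).ne'
  rw [i1] at k1
  rw [i0] at k3
  rw [hw, i0, i1]
  have k1' : ‖dFactor β d z‖ = ‖p‖ * ‖s‖ * r1 := by rw [← k1]; field_simp
  have k3' : ‖c‖ = ‖q‖ * ‖s‖ * r0 := by rw [← k3]; field_simp
  rw [k1', k2, k3', k4]
  field_simp
  ring

theorem excess_identity {β : Fin 2 → ℝ} {a b c d z p q s t : ℂ} {R : ℝ}
    (hz : charDet β (normalForm a b c d) z = 0)
    (e1 : d + expEnd β 1 z = p * s) (e2 : -b = p * t) (e3 : -(c * expEnd β 0 z) = q * s)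
    (e4 : 1 + a * expEnd β 0 z = q * t)
    (hδ : -(β 0 * (d + expEnd β 1 z)) + β 1 * expEnd β 1 z * (1 + a * expEnd β 0 z) ≠ 0)
    (hR : R * ‖-(β 0 * (d + expEnd β 1 z)) +
        β 1 * expEnd β 1 z * (1 + a * expEnd β 0 z)‖ ^ 2 =
      ‖expVec β z ![p, q]‖ ^ 2 *
        ‖expVec β (conj z) fun l => conj (![-(β 0 * s), β 1 * expEnd β 1 z * t] l)‖ ^ 2) :
    0 < excessDen β a d z ∧ (R - 1) * excessDen β a d z = excess β a b c d z := by
  have h1 : 0 < ‖expEnd β 1 z‖ ^ 2 := pow_pos (norm_pos_iff.2 (expEnd_ne_zero β 1 z)) 2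
  have h2 := pow_pos (norm_pos_iff.2 hδ) 2
  rw [norm_expVec_mul_norm_expVec hz e1 e2 e3 e4, norm_delta_sq] at hR
  rw [norm_delta_sq] at h2
  refine ⟨(mul_pos_iff_of_pos_left h1).1 h2, ?_⟩
  have := mul_left_cancel₀ h1.ne' (a := ‖expEnd β 1 z‖ ^ 2) (b := R * excessDen β a d z)
    (c := excess β a b c d z + excessDen β a d z) (by linear_combination hR)
  linear_combination this

/-! ### Two-sided estimates of the excess in a horizontal strip -/

section Bounds

variable {β : Fin 2 → ℝ} {a b c d z : ℂ} {K : ℝ}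

theorem exp_le_of_abs_im_le (s : ℝ) (hz : |z.im| ≤ K) :
    Real.exp (s * z.im) ≤ Real.exp (|s| * K) := by
  refine Real.exp_le_exp.2 ((le_abs_self _).trans ?_)
  rw [abs_mul]; gcongr

theorem norm_aFactor_le (hz : |z.im| ≤ K) :
    ‖aFactor β a z‖ ≤ 1 + ‖a‖ * Real.exp (|β 0| * K) := by
  refine (norm_add_le _ _).trans ?_
  rw [norm_one, norm_mul, norm_expEnd, ← neg_mul]
  have := exp_le_of_abs_im_le (-β 0) hz
  rw [abs_neg] at this
  gcongr

theorem norm_dFactor_le (hz : |z.im| ≤ K) :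
    ‖dFactor β d z‖ ≤ 1 + ‖d‖ * Real.exp (|β 1| * K) := by
  refine (norm_add_le _ _).trans ?_
  rw [norm_one, norm_mul, norm_inv, norm_expEnd, ← Real.exp_neg, neg_neg]
  have := exp_le_of_abs_im_le (β 1) hz
  gcongr

theorem exp_neg_le_exp_of_abs_im_le (s : ℝ) (hz : |z.im| ≤ K) :
    Real.exp (-(|s| * K)) ≤ Real.exp (s * z.im) := by
  refine Real.exp_le_exp.2 (le_trans ?_ (neg_abs_le _))
  rw [abs_mul]
  have : |s| * |z.im| ≤ |s| * K := by gcongr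
  linarith

theorem zVal_re_le_norm : (zVal (β 0) (β 1) a d z).re ≤ ‖zVal (β 0) (β 1) a d z‖ :=
  (le_abs_self _).trans (Complex.abs_re_le_norm _)

theorem excessDen_le (h0 : β 0 < 0) (h1 : 0 < β 1) {MA MD : ℝ} (hA : ‖aFactor β a z‖ ≤ MA)
    (hD : ‖dFactor β d z‖ ≤ MD) :
    excessDen β a d z ≤ β 0 ^ 2 * MD ^ 2 + β 1 ^ 2 * MA ^ 2 + 2 * (-β 0 * β 1) * (MD * MA) := by
  have hP : 0 < -β 0 * β 1 := by nlinarith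
  have h2 : (zVal (β 0) (β 1) a d z).re ≤ MD * MA := by
    refine zVal_re_le_norm.trans ?_
    rw [zVal_eq, norm_mul, RCLike.norm_conj]
    have := (norm_nonneg _).trans hD
    gcongr
  rw [excessDen]
  gcongr

variable (β a b c d K)

/-- The excess controls the quantities in the criterion. -/
theorem exists_le_mul_excess (h0 : β 0 < 0) (h1 : 0 < β 1) :
    ∃ C : ℝ, ∀ z R, |z.im| ≤ K → charDet β (normalForm a b c d) z = 0 → 0 < excessDen β a d z →
      R * excessDen β a d z = excess β a b c d z →
      0 ≤ R ∧ (β 0 * ‖c‖ + β 1 * ‖b‖) ^ 2 ≤ C * R ∧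
      (β 0 * ‖c‖ + β 1 * ‖b‖ = 0 → z.im ^ 2 ≤ C * R) ∧
      ‖zVal (β 0) (β 1) a d z‖ - (zVal (β 0) (β 1) a d z).re ≤ C * R := by
  have hP : 0 < -β 0 * β 1 := by nlinarith
  set MA := 1 + ‖a‖ * Real.exp (|β 0| * K)
  set MD := 1 + ‖d‖ * Real.exp (|β 1| * K)
  have hMA : 0 ≤ MA := by positivity
  have hMD : 0 ≤ MD := by positivity
  set M := β 0 ^ 2 * MD ^ 2 + β 1 ^ 2 * MA ^ 2 + 2 * (-β 0 * β 1) * (MD * MA)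
  have hM : 0 ≤ M := by positivity
  set w := Real.exp (-(|β 1 - β 0| * K))
  have hw : 0 < w := Real.exp_pos _
  -- `M` bounds the denominator from above, and `C₁`, `C₃`, `C₄` are `M` divided by a lower bound
  -- for the coefficient of one term of the excess. If `bc = 0`, then `C₃` is a division by zero and
  -- equals `0`; the bound on `Im z` then comes from `C₂`. The sum of all four serves every
  -- estimate.
  set C₁ := M / w
  set C₂ := 3 / β 0 ^ 2 + 3 / β 1 ^ 2
  set C₃ := M / (2 * (-β 0 * β 1) * (‖b‖ * ‖c‖ * w) * (β 0 ^ 2 / 6))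
  set C₄ := M / (2 * (-β 0 * β 1))
  have hC₁ : 0 ≤ C₁ := by positivity
  have hC₂ : 0 ≤ C₂ := by positivity
  have hC₃ : 0 ≤ C₃ := by positivity
  have hC₄ : 0 ≤ C₄ := by positivity
  refine ⟨C₁ + C₂ + C₃ + C₄, fun z R hz hdet hden hR => ?_⟩
  have hnz := norm_zVal hdet
  have hdenM : excessDen β a d z ≤ M := excessDen_le h0 h1 (norm_aFactor_le hz) (norm_dFactor_le hz)
  have hwz : w ≤ Real.exp ((β 1 - β 0) * z.im) := exp_neg_le_exp_of_abs_im_le _ hz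
  have hre : 0 ≤ ‖zVal (β 0) (β 1) a d z‖ - (zVal (β 0) (β 1) a d z).re :=
    sub_nonneg.2 zVal_re_le_norm
  have hS0 := one_le_sinhc (β 0 * z.im)
  have hS1 := one_le_sinhc (β 1 * z.im)
  have hS0' := one_add_sq_div_six_le_sinhc (β 0 * z.im)
  have hS1' := one_add_sq_div_six_le_sinhc (β 1 * z.im)
  set S0 := sinhc (β 0 * z.im)
  set S1 := sinhc (β 1 * z.im)
  have hSS : 1 ≤ S0 * S1 := one_le_mul_of_one_le_of_one_le hS0 hS1
  have q0 : 0 ≤ S0 ^ 2 - 1 := sub_nonneg.2 (one_le_pow₀ hS0)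
  have q1 : 0 ≤ S1 ^ 2 - 1 := sub_nonneg.2 (one_le_pow₀ hS1)
  have X1 : 0 ≤ β 0 ^ 2 * ‖dFactor β d z‖ ^ 2 * (S0 ^ 2 - 1) := by positivity
  have X2 : 0 ≤ β 1 ^ 2 * ‖aFactor β a z‖ ^ 2 * (S1 ^ 2 - 1) := by positivity
  have X3 : (β 0 * ‖c‖ + β 1 * ‖b‖) ^ 2 * w * 1 ≤ (β 0 * ‖c‖ + β 1 * ‖b‖) ^ 2 *
      Real.exp ((β 1 - β 0) * z.im) * (S0 * S1) := by gcongr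
  have X4 : 2 * (-β 0 * β 1) * (‖b‖ * ‖c‖ * w) * ((β 0 * z.im) ^ 2 / 6) ≤
      2 * (-β 0 * β 1) * ‖zVal (β 0) (β 1) a d z‖ * (S0 * S1 - 1) := by
    rw [hnz]
    have : (β 0 * z.im) ^ 2 / 6 ≤ S0 * S1 - 1 := by nlinarith only [hS0, hS1, hS0']
    gcongr
  have X5 : 0 ≤ 2 * (-β 0 * β 1) *
      (‖zVal (β 0) (β 1) a d z‖ - (zVal (β 0) (β 1) a d z).re) := by positivity
  have X3' : 0 ≤ (β 0 * ‖c‖ + β 1 * ‖b‖) ^ 2 * w * 1 := by positivity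
  have X4' : 0 ≤ 2 * (-β 0 * β 1) * (‖b‖ * ‖c‖ * w) * ((β 0 * z.im) ^ 2 / 6) := by positivity
  have hR' := hR
  rw [excess] at hR'
  have hR0 : 0 ≤ R := by
    by_contra! h
    have := mul_neg_of_neg_of_pos h hden
    linarith
  have hRM : R * excessDen β a d z ≤ M * R :=
    (mul_le_mul_of_nonneg_left hdenM hR0).trans_eq (mul_comm _ _)
  have hCR (t : ℝ) (ht : 0 < t) (y : ℝ) (hy : y * t ≤ M * R) : y ≤ M / t * R := by
    rw [div_mul_eq_mul_div, le_div_iff₀ ht]; exact hy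
  refine ⟨hR0, ?_, fun hbc => ?_, ?_⟩
  · have : (β 0 * ‖c‖ + β 1 * ‖b‖) ^ 2 ≤ C₁ * R := hCR w hw _ (by linarith)
    linarith [mul_nonneg hC₂ hR0, mul_nonneg hC₃ hR0, mul_nonneg hC₄ hR0]
  · suffices z.im ^ 2 ≤ C₂ * R ∨ z.im ^ 2 ≤ C₃ * R by
      rcases this with h | h <;>
      linarith [mul_nonneg hC₁ hR0, mul_nonneg hC₂ hR0, mul_nonneg hC₃ hR0, mul_nonneg hC₄ hR0]
    rcases (mul_nonneg (norm_nonneg b) (norm_nonneg c)).eq_or_lt with hz0 | hpos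
    -- Since `z_n = 0`, one of the two factors vanishes; the other cancels from the quotient, which
    -- is exactly `sinhc² - 1 ≥ s² / 3`. No comparison with `M` is needed.
    · left
      have hzv : dFactor β d z * conj (aFactor β a z) = 0 := by
        rw [← zVal_eq, ← norm_eq_zero, hnz, ← hz0, zero_mul]
      have hzv' : zVal (β 0) (β 1) a d z = 0 := by rw [zVal_eq, hzv]
      have hden' := hden
      rw [excessDen, hzv', Complex.zero_re, mul_zero, add_zero] at hR hden'
      rw [excess, hzv', norm_zero, hbc, Complex.zero_re] at hR
      have c0 : 0 ≤ 3 / β 0 ^ 2 * R := by positivity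
      have c1 : 0 ≤ 3 / β 1 ^ 2 * R := by positivity
      rcases mul_eq_zero.1 hzv with h | h
      · rw [h, norm_zero] at hR hden'
        have h3 : R = S1 ^ 2 - 1 := by
          refine mul_right_cancel₀ (b := β 1 ^ 2 * ‖aFactor β a z‖ ^ 2)
            (by simpa using hden'.ne') ?_
          linear_combination hR
        have h4 : z.im ^ 2 ≤ 3 / β 1 ^ 2 * R := by
          rw [div_mul_eq_mul_div, le_div_iff₀ (by positivity), h3]
          nlinarith only [hS1', sq_nonneg (β 1 * z.im)]
        linarith
      · rw [map_eq_zero] at h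
        rw [h, norm_zero] at hR hden'
        have h3 : R = S0 ^ 2 - 1 := by
          refine mul_right_cancel₀ (b := β 0 ^ 2 * ‖dFactor β d z‖ ^ 2)
            (by simpa using hden'.ne') ?_
          linear_combination hR
        have hb0 : 0 < β 0 ^ 2 := sq_pos_of_neg h0
        have h4 : z.im ^ 2 ≤ 3 / β 0 ^ 2 * R := by
          rw [div_mul_eq_mul_div, le_div_iff₀ hb0, h3]
          nlinarith only [hS0', sq_nonneg (β 0 * z.im)]
        linarith
    · right
      have hb0 : 0 < β 0 ^ 2 := sq_pos_of_neg h0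
      refine hCR _ (by positivity) _ ?_
      linarith
  · have : ‖zVal (β 0) (β 1) a d z‖ - (zVal (β 0) (β 1) a d z).re ≤ C₄ * R :=
      hCR _ (by positivity) _ (by linarith)
    linarith [mul_nonneg hC₁ hR0, mul_nonneg hC₂ hR0, mul_nonneg hC₃ hR0]

/-- The quantities in the criterion control the excess. -/
theorem exists_excess_le (h0 : β 0 < 0) (h1 : 0 < β 1) (hbc : β 0 * ‖c‖ + β 1 * ‖b‖ = 0) :
    ∃ C ε : ℝ, 0 < ε ∧ ∀ z R, |z.im| ≤ K → charDet β (normalForm a b c d) z = 0 →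
      0 < excessDen β a d z → R * excessDen β a d z = excess β a b c d z →
      ‖zVal (β 0) (β 1) a d z‖ - (zVal (β 0) (β 1) a d z).re < ε →
      R ≤ C * (z.im ^ 2 + (‖zVal (β 0) (β 1) a d z‖ - (zVal (β 0) (β 1) a d z).re)) := by
  have hP : 0 < -β 0 * β 1 := by nlinarith
  set MA := 1 + ‖a‖ * Real.exp (|β 0| * K)
  set MD := 1 + ‖d‖ * Real.exp (|β 1| * K)
  have hMA : 0 ≤ MA := by positivity
  have hMD : 0 ≤ MD := by positivity
  set B0 := Real.exp ((|β 0| * K) ^ 2) * β 0 ^ 2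
  set B1 := Real.exp ((|β 1| * K) ^ 2) * β 1 ^ 2
  have hB0 : 0 ≤ B0 := by positivity
  have hB1 : 0 ≤ B1 := by positivity
  have hS (z : ℂ) (hz : |z.im| ≤ K) (l : Fin 2) : sinhc (β l * z.im) ^ 2 - 1 ≤
      Real.exp ((|β l| * K) ^ 2) * β l ^ 2 * z.im ^ 2 := by
    rw [mul_assoc, ← mul_pow]
    refine sinhc_sq_sub_one_le ?_
    rw [abs_mul]; gcongr
  rcases (mul_nonneg (norm_nonneg b) (norm_nonneg c)).eq_or_lt with hz0 | hpos
  -- If `bc = 0`, all `z_n` vanish and the quotient is a weighted average of the two values `sinhc²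
  -- - 1`, so its denominator needs no lower bound. The value of `ε` plays no role here.
  · refine ⟨B0 + B1, 1, one_pos, fun z R hz hdet hden hR _ => ?_⟩
    have hzv : zVal (β 0) (β 1) a d z = 0 := by
      rw [← norm_eq_zero, norm_zVal hdet, ← hz0, zero_mul]
    have h2 := hS z hz 0
    have h3 := hS z hz 1
    have hS0 := one_le_sinhc (β 0 * z.im)
    have hS1 := one_le_sinhc (β 1 * z.im)
    have q0 : 0 ≤ sinhc (β 0 * z.im) ^ 2 - 1 := sub_nonneg.2 (one_le_pow₀ hS0)
    have q1 : 0 ≤ sinhc (β 1 * z.im) ^ 2 - 1 := sub_nonneg.2 (one_le_pow₀ hS1)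
    rw [hzv, norm_zero, Complex.zero_re, sub_zero, add_zero]
    have h4 : R ≤ (sinhc (β 0 * z.im) ^ 2 - 1) + (sinhc (β 1 * z.im) ^ 2 - 1) := by
      refine le_of_mul_le_mul_right ?_ hden
      rw [hR, excess, excessDen, hzv, hbc, norm_zero, Complex.zero_re]
      have y0 : 0 ≤ β 0 ^ 2 * ‖dFactor β d z‖ ^ 2 := by positivity
      have y1 : 0 ≤ β 1 ^ 2 * ‖aFactor β a z‖ ^ 2 := by positivity
      linarith [mul_nonneg y0 q1, mul_nonneg y1 q0]
    linarith
  · set w := Real.exp (-(|β 1 - β 0| * K))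
    have hw : 0 < w := Real.exp_pos _
    set κ := ‖b‖ * ‖c‖ * w
    have hκ : 0 < κ := by positivity
    set M := β 0 ^ 2 * MD ^ 2 * B0 + β 1 ^ 2 * MA ^ 2 * B1 +
      2 * (-β 0 * β 1) * (MD * MA) * (B0 + B1) + 2 * (-β 0 * β 1)
    -- `κ` is a lower bound for `|z_n|` in the strip. With `|z_n| - Re z_n < κ / 2`, the real part
    -- is at least `κ / 2`, and this keeps the denominator away from zero.
    refine ⟨M / ((-β 0 * β 1) * κ), κ / 2, by positivity, fun z R hz hdet hden hR hε => ?_⟩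
    have h2 := hS z hz 0
    have h3 := hS z hz 1
    have hA : ‖aFactor β a z‖ ≤ MA := norm_aFactor_le hz
    have hD : ‖dFactor β d z‖ ≤ MD := norm_dFactor_le hz
    have hre : 0 ≤ ‖zVal (β 0) (β 1) a d z‖ - (zVal (β 0) (β 1) a d z).re :=
      sub_nonneg.2 zVal_re_le_norm
    have hzle : ‖zVal (β 0) (β 1) a d z‖ ≤ MD * MA := by
      rw [zVal_eq, norm_mul, RCLike.norm_conj]; gcongr
    have hzge : κ ≤ ‖zVal (β 0) (β 1) a d z‖ := by
      rw [norm_zVal hdet]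
      exact mul_le_mul_of_nonneg_left (exp_neg_le_exp_of_abs_im_le _ hz) (by positivity)
    have hS0 := one_le_sinhc (β 0 * z.im)
    have hS1 := one_le_sinhc (β 1 * z.im)
    have hden2 : (-β 0 * β 1) * κ ≤ excessDen β a d z := by
      rw [excessDen]
      have y0 : 0 ≤ β 0 ^ 2 * ‖dFactor β d z‖ ^ 2 := by positivity
      have y1 : 0 ≤ β 1 ^ 2 * ‖aFactor β a z‖ ^ 2 := by positivity
      have y2 : κ ≤ 2 * (zVal (β 0) (β 1) a d z).re := by linarith
      linarith [mul_le_mul_of_nonneg_left y2 hP.le]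
    set ρ := ‖zVal (β 0) (β 1) a d z‖ - (zVal (β 0) (β 1) a d z).re
    set S0 := sinhc (β 0 * z.im)
    set S1 := sinhc (β 1 * z.im)
    have hSS : 1 ≤ S0 * S1 := one_le_mul_of_one_le_of_one_le hS0 hS1
    have q0 : 0 ≤ S0 ^ 2 - 1 := sub_nonneg.2 (one_le_pow₀ hS0)
    have q1 : 0 ≤ S1 ^ 2 - 1 := sub_nonneg.2 (one_le_pow₀ hS1)
    have h4 : S0 * S1 - 1 ≤ (B0 + B1) * z.im ^ 2 := by
      linarith [sq_nonneg (S0 - S1)]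
    have hX : R * excessDen β a d z ≤ M * (z.im ^ 2 + ρ) := by
      rw [hR, excess, hbc]
      have x1 : β 0 ^ 2 * ‖dFactor β d z‖ ^ 2 * (S0 ^ 2 - 1) ≤
          β 0 ^ 2 * MD ^ 2 * (B0 * z.im ^ 2) := by gcongr
      have x2 : β 1 ^ 2 * ‖aFactor β a z‖ ^ 2 * (S1 ^ 2 - 1) ≤
          β 1 ^ 2 * MA ^ 2 * (B1 * z.im ^ 2) := by gcongr
      have x4 : 2 * (-β 0 * β 1) * ‖zVal (β 0) (β 1) a d z‖ * (S0 * S1 - 1) ≤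
          2 * (-β 0 * β 1) * (MD * MA) * ((B0 + B1) * z.im ^ 2) := by
        gcongr
      have x6 : 0 ≤ (β 0 ^ 2 * MD ^ 2 * B0 + β 1 ^ 2 * MA ^ 2 * B1 +
        2 * (-β 0 * β 1) * (MD * MA) * (B0 + B1)) * ρ := by positivity
      have x7 : 0 ≤ 2 * (-β 0 * β 1) * z.im ^ 2 := by positivity
      linarith
    rw [div_mul_eq_mul_div, le_div_iff₀ (by positivity)]
    rcases le_or_gt R 0 with hR0 | hR0
    · have : 0 ≤ M * (z.im ^ 2 + ρ) := by positivity
      have : R * (-β 0 * β 1 * κ) ≤ 0 := mul_nonpos_of_nonpos_of_nonneg hR0 (by positivity)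
      linarith
    · exact (mul_le_mul_of_nonneg_left hden2 hR0.le).trans hX

end Bounds

/-! ### Jets of exponential families as root vectors -/

/-- The `j`-th derivatives, with respect to the spectral parameter, of the exponential solutions
with coefficients `v`. -/
def jet (β : Fin 2 → ℝ) (v : Fin 2 → ℂ → ℂ) (z : ℂ) (j : ℕ) (l : Fin 2) (x : ℝ) : ℂ :=
  ∑ i ∈ Finset.range (j + 1), (j.choose i : ℂ) *
    ((Complex.I * β l * x) ^ i * Complex.exp (Complex.I * β l * z * x)) *
    iteratedDeriv (j - i) (v l) z

theorem continuous_jet (β : Fin 2 → ℝ) (v : Fin 2 → ℂ → ℂ) (z : ℂ) (j : ℕ) (l : Fin 2) :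
    Continuous (jet β v z j l) := by
  unfold jet; fun_prop

theorem jet_eq_iteratedDeriv (β : Fin 2 → ℝ) {v : Fin 2 → ℂ → ℂ} (hv : ∀ l, Differentiable ℂ (v l))
    (z : ℂ) (j : ℕ) (l : Fin 2) (x : ℝ) :
    jet β v z j l x =
      iteratedDeriv j (fun μ => Complex.exp (Complex.I * β l * x * μ) * v l μ) z := by
  rw [iteratedDeriv_fun_mul (by fun_prop) (hv l).contDiff.contDiffAt, jet]
  refine Finset.sum_congr rfl fun i _ => ?_
  rw [iteratedDeriv_cexp_const_mul]
  ring_nf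

/-- Applying `∂_μ^j` to `y' = iβμy` gives `iβ(μ ∂^j y + j ∂^{j-1} y)`, so `L(0) - z` lowers the
order of a jet by one. For `j = 0` the truncated index `j - 1` is harmless, its coefficient being
zero. -/
theorem hasDerivAt_jet (β : Fin 2 → ℝ) (v : Fin 2 → ℂ → ℂ) (z : ℂ) (j : ℕ) (l : Fin 2) (x : ℝ) :
    HasDerivAt (jet β v z j l)
      (Complex.I * β l * (z * jet β v z j l x + j * jet β v z (j - 1) l x)) x := by
  have hlin (κ : ℂ) : HasDerivAt (fun x : ℝ => κ * (x : ℂ)) κ x := by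
    simpa using (Complex.ofRealCLM.hasDerivAt (x := x)).const_mul κ
  have h1 (i : ℕ) := ((((hlin (Complex.I * β l)).pow i).mul
    (hlin (Complex.I * β l * z)).cexp).const_mul
    (j.choose i : ℂ)).mul_const (iteratedDeriv (j - i) (v l) z)
  refine (HasDerivAt.fun_sum fun i (_ : i ∈ Finset.range (j + 1)) => h1 i).congr_deriv ?_
  have h2 : (j : ℂ) * jet β v z (j - 1) l x = ∑ i ∈ Finset.range (j + 1), (j.choose i : ℂ) *
      ((i * (Complex.I * β l * x) ^ (i - 1)) * Complex.exp (Complex.I * β l * z * x)) *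
      iteratedDeriv (j - i) (v l) z := by
    cases j with
    | zero => simp
    | succ j =>
      rw [Finset.sum_range_succ', Nat.add_sub_cancel, jet, Finset.mul_sum]
      simp only [Nat.cast_zero, zero_mul, mul_zero, add_zero, Nat.add_sub_cancel]
      refine Finset.sum_congr rfl fun i _ => ?_
      have h3 : ((j + 1 : ℕ) : ℂ) * (j.choose i : ℂ) =
          ((j + 1).choose (i + 1) : ℂ) * ((i + 1 : ℕ) : ℂ) := by
        exact_mod_cast Nat.add_one_mul_choose_eq j i
      rw [Nat.add_sub_add_right]
      linear_combination ((Complex.I * β l * x) ^ i * Complex.exp (Complex.I * β l * z * x)) *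
        iteratedDeriv (j - i) (v l) z * h3
  rw [h2, jet, Finset.mul_sum, ← Finset.sum_add_distrib, Finset.mul_sum]
  refine Finset.sum_congr rfl fun i _ => ?_
  rw [Pi.pow_apply]
  ring

/-- The jets of an analytic family of solutions are root vectors, up to the order to which the
boundary conditions hold. -/
theorem contLp_jet_mem_powKer {β : Fin 2 → ℝ} (hβ : ∀ l, β l ≠ 0) {a b c d z : ℂ}
    {v : Fin 2 → ℂ → ℂ} (hv : ∀ l, Differentiable ℂ (v l)) {m : ℕ}
    (h0 : ∀ j < m, iteratedDeriv j (fun μ => (1 + a * expEnd β 0 μ) * v 0 μ + b * v 1 μ) z = 0)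
    (h1 : ∀ j < m,
      iteratedDeriv j (fun μ => c * expEnd β 0 μ * v 0 μ + (d + expEnd β 1 μ) * v 1 μ) z = 0)
    (j : ℕ) (hj : j < m) :
    contLp (jet β v z j) (continuous_jet β v z j) ∈
      powKer (diracOp β (normalForm a b c d)) z (j + 1) := by
  have hcw (j : ℕ) (l : Fin 2) :
      Continuous fun x => z * jet β v z j l x + j * jet β v z (j - 1) l x := by
    have := continuous_jet β v z j l
    have := continuous_jet β v z (j - 1) l
    fun_prop
  have hbc (j : ℕ) (hj : j < m) (i : Fin 2) :
      normalForm a b c d i 0 * jet β v z j 0 0 + normalForm a b c d i 1 * jet β v z j 1 0 +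
      normalForm a b c d i 2 * jet β v z j 0 1 + normalForm a b c d i 3 * jet β v z j 1 1 = 0 := by
    have c0 : ContDiff ℂ (j : ℕ) (v 0) := (hv 0).contDiff
    have c1 : ContDiff ℂ (j : ℕ) (v 1) := (hv 1).contDiff
    have c2 : ContDiff ℂ (j : ℕ) (expEnd β 0) := (differentiable_expEnd β 0).contDiff
    have c3 : ContDiff ℂ (j : ℕ) (expEnd β 1) := (differentiable_expEnd β 1).contDiff
    have k0 (l : Fin 2) : jet β v z j l 0 = iteratedDeriv j (v l) z := by
      rw [jet_eq_iteratedDeriv β hv]; simp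
    have k1 (l : Fin 2) : jet β v z j l 1 = iteratedDeriv j (fun μ => expEnd β l μ * v l μ) z := by
      rw [jet_eq_iteratedDeriv β hv]; simp [expEnd]
    rw [k0, k0, k1, k1]
    simp only [← iteratedDeriv_const_mul_field]
    fin_cases i
    · rw [← h0 j hj]
      simp only [normalForm]
      simp only [Fin.zero_eta, Matrix.of_apply, Matrix.cons_val, Matrix.cons_val_zero,
        Matrix.cons_val_one, zero_mul, one_mul]
      rw [← iteratedDeriv_fun_add (by fun_prop) (by fun_prop),
        ← iteratedDeriv_fun_add (by fun_prop) (by fun_prop),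
        ← iteratedDeriv_fun_add (by fun_prop) (by fun_prop)]
      congr 1; ext μ; ring
    · rw [← h1 j hj]
      simp only [normalForm]
      simp only [Fin.mk_one, Matrix.of_apply, Matrix.cons_val, Matrix.cons_val_zero,
        Matrix.cons_val_one, zero_mul, one_mul]
      rw [← iteratedDeriv_fun_add (by fun_prop) (by fun_prop),
        ← iteratedDeriv_fun_add (by fun_prop) (by fun_prop),
        ← iteratedDeriv_fun_add (by fun_prop) (by fun_prop)]
      congr 1; ext μ; ring
  induction j with
  | zero =>
    refine mem_powKer_diracOp_succ.2 ⟨_, isInGraph_contLp hβ (continuous_jet β v z 0) (hcw 0)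
      (hasDerivAt_jet β v z 0) (hbc 0 hj), (Submodule.mem_bot ℂ).2 (sub_eq_zero.2 ?_)⟩
    refine L2C2.ext_coord fun l => ?_
    filter_upwards [coeFn_contLp _ (hcw 0), coeFn_contLp _ (continuous_jet β v z 0),
      Lp.coeFn_smul z (contLp _ (continuous_jet β v z 0))] with x k1 k2 k3
    rw [k3, Pi.smul_apply, PiLp.smul_apply, k1, k2]
    simp
  | succ j ih =>
    refine mem_powKer_diracOp_succ.2 ⟨_, isInGraph_contLp hβ (continuous_jet β v z (j + 1))
      (hcw (j + 1)) (hasDerivAt_jet β v z (j + 1)) (hbc (j + 1) hj), ?_⟩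
    have : contLp _ (hcw (j + 1)) - z • contLp _ (continuous_jet β v z (j + 1)) =
        ((j + 1 : ℕ) : ℂ) • contLp _ (continuous_jet β v z j) := by
      refine L2C2.ext_coord fun l => ?_
      filter_upwards [coeFn_contLp _ (hcw (j + 1)), coeFn_contLp _ (continuous_jet β v z (j + 1)),
        coeFn_contLp _ (continuous_jet β v z j),
        Lp.coeFn_smul ((j + 1 : ℕ) : ℂ) (contLp _ (continuous_jet β v z j)),
        L2C2.coord_sub_smul (contLp _ (hcw (j + 1))) (contLp _ (continuous_jet β v z (j + 1))) z l]
        with x k1 k2 k3 k4 k5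
      rw [k5, k4, Pi.smul_apply, PiLp.smul_apply, k1, k2, k3]
      simp
    rw [this]
    exact Submodule.smul_mem _ _ (ih (by omega))

/-- The transforms of the components of `h`, which evaluate it on exponential solutions. -/
def compTransform (β : Fin 2 → ℝ) (h : L2C2) (l : Fin 2) : ℂ → ℂ :=
  expTransform (fun x => conj (h x l)) (Complex.I * β l) 0

theorem integrable_conj_coord (h : L2C2) (l : Fin 2) :
    Integrable (fun x => conj (h x l)) unitVolume :=
  Complex.conjCLE.toContinuousLinearMap.integrable_comp (integrable_coord h l)

theorem differentiable_compTransform (β : Fin 2 → ℝ) (h : L2C2) (l : Fin 2) :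
    Differentiable ℂ (compTransform β h l) :=
  differentiable_expTransform (integrable_conj_coord h l) _ _

/-- The pairing commutes with differentiation in the spectral parameter. Orthogonality to a chain of
jets thus becomes a zero of an entire function, of order the length of the chain. -/
theorem inner_contLp_jet (β : Fin 2 → ℝ) {v : Fin 2 → ℂ → ℂ} (hv : ∀ l, Differentiable ℂ (v l))
    (z : ℂ) (j : ℕ) (h : L2C2) :
    inner ℂ h (contLp (jet β v z j) (continuous_jet β v z j)) =
      iteratedDeriv j
        (fun μ => compTransform β h 0 μ * v 0 μ + compTransform β h 1 μ * v 1 μ) z := by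
  have hH (l : Fin 2) : ContDiff ℂ (j : ℕ) (compTransform β h l) :=
    (differentiable_compTransform β h l).contDiff
  have hv' (l : Fin 2) : ContDiff ℂ (j : ℕ) (v l) := (hv l).contDiff
  have h0 := hH 0
  have h1 := hH 1
  have h2 := hv' 0
  have h3 := hv' 1
  rw [iteratedDeriv_fun_add (by fun_prop) (by fun_prop), inner_eq_sum_integral, Fin.sum_univ_two]
  have key (l : Fin 2) : ∫ x, conj (h x l) *
      contLp (jet β v z j) (continuous_jet β v z j) x l ∂unitVolume =
      iteratedDeriv j (fun μ => compTransform β h l μ * v l μ) z := by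
    rw [iteratedDeriv_fun_mul (hH l).contDiffAt (hv' l).contDiffAt]
    have h4 : ∫ x, conj (h x l) * contLp (jet β v z j) (continuous_jet β v z j) x l ∂unitVolume =
        ∫ x, ∑ i ∈ Finset.range (j + 1), ((j.choose i : ℂ) * iteratedDeriv (j - i) (v l) z) *
          ((Complex.I * β l * x) ^ i * Complex.exp (Complex.I * β l * z * x) * conj (h x l))
          ∂unitVolume := by
      refine integral_congr_ae ?_
      filter_upwards [coeFn_contLp _ (continuous_jet β v z j)] with x hx
      rw [hx, jet, Finset.mul_sum]
      exact Finset.sum_congr rfl fun i _ => by ring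
    rw [h4, integral_finsetSum]
    · refine Finset.sum_congr rfl fun i _ => ?_
      rw [integral_const_mul, compTransform,
        iteratedDeriv_expTransform (integrable_conj_coord h l), expTransform]
      ring
    · intro i _
      exact (integrable_continuous_mul (integrable_conj_coord h l) (by fun_prop)).const_mul _
  rw [key, key]

/-! ### Entire quotients, moments and Laplace-type limits -/

/-- An entire function whose zeros include those of another is a multiple of it. -/
theorem exists_entire_quotient {F D : ℂ → ℂ} (hF : Differentiable ℂ F) (hD : Differentiable ℂ D)
    (hord : ∀ z, ∃ m : ℕ, analyticOrderAt D z = m ∧ (m : ℕ∞) ≤ analyticOrderAt F z) :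
    ∃ G : ℂ → ℂ, Differentiable ℂ G ∧ ∀ z, F z = D z * G z := by
  have hloc (z : ℂ) : ∃ g : ℂ → ℂ, AnalyticAt ℂ g z ∧ ∀ᶠ w in nhds z, F w = D w * g w := by
    obtain ⟨m, hm, hmF⟩ := hord z
    obtain ⟨D', hD', hD'z, hDe⟩ := (hD.analyticAt z).analyticOrderAt_eq_natCast.1 hm
    obtain ⟨F', hF', hFe⟩ := (natCast_le_analyticOrderAt (hF.analyticAt z)).1 hmF
    refine ⟨fun w => F' w / D' w, hF'.div hD' hD'z, ?_⟩
    filter_upwards [hDe, hFe, hD'.continuousAt.eventually_ne hD'z] with w h1 h2 h3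
    rw [h1, h2, smul_eq_mul, smul_eq_mul]
    field_simp
  choose g hg hge using hloc
  -- The local quotients agree wherever `D ≠ 0`, hence on punctured neighbourhoods. This makes the
  -- diagonal choice `g w w` coincide with the analytic `g z` near `z`.
  have hG (z : ℂ) : (fun w => g w w) =ᶠ[nhds z] g z := by
    have hne : ∀ᶠ w in nhdsWithin z {z}ᶜ, D w ≠ 0 := by
      rcases (hD.analyticAt z).eventually_eq_zero_or_eventually_ne_zero with h | h
      · obtain ⟨m, hm, -⟩ := hord z
        rw [analyticOrderAt_eq_top.2 h] at hm
        exact absurd hm.symm (ENat.natCast_ne_top m)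
      · exact h
    have h1 : ∀ᶠ w in nhdsWithin z {z}ᶜ, g w w = g z w := by
      filter_upwards [hne, (hge z).filter_mono nhdsWithin_le_nhds] with w h2 h3
      have h4 := (hge w).self_of_nhds
      rw [h3] at h4
      exact (mul_left_cancel₀ h2 h4).symm
    rw [eventually_nhdsWithin_iff] at h1
    filter_upwards [h1] with w hw
    by_cases h : w = z
    · rw [h]
    · exact hw h
  exact ⟨fun w => g w w, fun z => ((hg z).congr (hG z).symm).differentiableAt,
    fun z => (hge z).self_of_nhds⟩

/-- A function on the unit interval all of whose moments vanish is zero. -/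
theorem ae_eq_zero_of_moments {g : ℝ → ℂ} (hg : Integrable g unitVolume)
    (hm : ∀ i : ℕ, ∫ x : ℝ, (x : ℂ) ^ i * g x ∂unitVolume = 0) : ∀ᵐ x ∂unitVolume, g x = 0 := by
  have hpint (p : Polynomial ℝ) : Integrable (fun x : ℝ => ((p.eval x : ℝ) : ℂ) * g x) unitVolume :=
    integrable_continuous_mul hg (by fun_prop)
  have hpoly (p : Polynomial ℝ) : ∫ x : ℝ, ((p.eval x : ℝ) : ℂ) * g x ∂unitVolume = 0 := by
    induction p using Polynomial.induction_on' with
    | add p q hp hq =>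
      simp only [Polynomial.eval_add, Complex.ofReal_add, add_mul]
      rw [integral_add (hpint p) (hpint q), hp, hq, add_zero]
    | monomial n r =>
      simp only [Polynomial.eval_monomial, Complex.ofReal_mul, Complex.ofReal_pow, mul_assoc]
      rw [integral_const_mul, hm n, mul_zero]
  -- It suffices to test against smooth functions, and by Weierstrass each is uniformly close on the
  -- interval to a polynomial, whose integral against `g` vanishes.
  refine ae_eq_zero_of_integral_contDiff_smul_eq_zero hg.locallyIntegrable fun φ hφ _ => ?_
  have hφc : Continuous φ := hφ.continuous
  have hφi : Integrable (fun x => φ x • g x) unitVolume := by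
    simpa only [Complex.real_smul] using integrable_continuous_mul hg
      (g := fun x => ((φ x : ℝ) : ℂ)) (by fun_prop)
  rw [← norm_le_zero_iff]
  refine le_of_forall_pos_le_add fun ε hε => ?_
  set I := ∫ x, ‖g x‖ ∂unitVolume with hI
  have hI0 : 0 ≤ I := integral_nonneg fun x => norm_nonneg _
  obtain ⟨p, hp⟩ := exists_polynomial_near_of_continuousOn 0 1 φ hφc.continuousOn (ε / (I + 1))
    (by positivity)
  have h1 : ∫ x, φ x • g x ∂unitVolume =
      ∫ x, (φ x • g x - ((p.eval x : ℝ) : ℂ) * g x) ∂unitVolume := by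
    rw [integral_sub hφi (hpint p), hpoly p, sub_zero]
  rw [h1, zero_add]
  calc ‖∫ x, (φ x • g x - ((p.eval x : ℝ) : ℂ) * g x) ∂unitVolume‖
      ≤ ∫ x, ε / (I + 1) * ‖g x‖ ∂unitVolume := by
        refine norm_integral_le_of_norm_le (hg.norm.const_mul _) ?_
        refine (ae_restrict_iff' measurableSet_Icc).2 (ae_of_all _ fun x hx => ?_)
        rw [Complex.real_smul, ← sub_mul, norm_mul, ← Complex.ofReal_sub, Complex.norm_real,
          Real.norm_eq_abs, abs_sub_comm]
        exact mul_le_mul_of_nonneg_right (hp x hx).le (norm_nonneg _)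
    _ = ε / (I + 1) * I := by rw [integral_const_mul]
    _ ≤ ε := by
        rw [div_mul_eq_mul_div, div_le_iff₀ (by positivity)]
        nlinarith

/-- Laplace-type integrals tend to zero. -/
theorem tendsto_laplace_zero {g : ℝ → ℂ} (hg : Integrable g unitVolume) {φ : ℝ → ℝ}
    (hφ : Continuous φ) (hpos : ∀ x ∈ Ioo (0 : ℝ) 1, 0 < φ x) :
    Filter.Tendsto (fun τ : ℝ => ∫ x, ((Real.exp (-(τ * φ x)) : ℝ) : ℂ) * g x ∂unitVolume)
      Filter.atTop (nhds 0) := by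
  have hIoo : ∀ᵐ x ∂unitVolume, x ∈ Ioo (0 : ℝ) 1 := by
    rw [unitVolume, ← restrict_Ioo_eq_restrict_Icc]
    exact ae_restrict_mem measurableSet_Ioo
  have h0 : (0 : ℂ) = ∫ _x : ℝ, (0 : ℂ) ∂unitVolume := by simp
  rw [h0]
  refine tendsto_integral_filter_of_dominated_convergence (fun x => ‖g x‖) ?_ ?_ hg.norm ?_
  · exact Filter.Eventually.of_forall fun τ =>
      (integrable_continuous_mul hg (by fun_prop)).aestronglyMeasurable
  · filter_upwards [Filter.eventually_ge_atTop 0] with τ hτ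
    filter_upwards [hIoo] with x hx
    rw [norm_mul, Complex.norm_real, Real.norm_of_nonneg (Real.exp_pos _).le]
    refine mul_le_of_le_one_left (norm_nonneg _) (Real.exp_le_one_iff.2 ?_)
    have := mul_nonneg hτ (hpos x hx).le
    linarith
  · filter_upwards [hIoo] with x hx
    have h1 : Filter.Tendsto (fun τ : ℝ => Real.exp (-(τ * φ x))) Filter.atTop (nhds 0) :=
      Real.tendsto_exp_neg_atTop_nhds_zero.comp
        (Filter.tendsto_id.atTop_mul_const (hpos x hx))
    have h2 := (Complex.continuous_ofReal.tendsto 0).comp h1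
    simpa using h2.mul_const (g x)

/-! ### Lower bounds for the characteristic determinant -/

/-- The translates of the characteristic determinant along the real axis belong to this family,
with `u₀`, `u₁` of modulus one. -/
def torusDet (β : Fin 2 → ℝ) (a b c d : ℂ) (u : ℂ × ℂ) (z : ℂ) : ℂ :=
  d + a * (u.1 * u.2) * (expEnd β 0 z * expEnd β 1 z) + (a * d - b * c) * u.1 * expEnd β 0 z +
    u.2 * expEnd β 1 z

theorem expEnd_add (β : Fin 2 → ℝ) (l : Fin 2) (z w : ℂ) :
    expEnd β l (z + w) = expEnd β l z * expEnd β l w := by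
  rw [expEnd, expEnd, expEnd, ← Complex.exp_add, mul_add]

theorem norm_expEnd_ofReal (β : Fin 2 → ℝ) (l : Fin 2) (t : ℝ) : ‖expEnd β l t‖ = 1 := by
  rw [norm_expEnd]; simp

theorem charDet_add_ofReal (β : Fin 2 → ℝ) (a b c d : ℂ) (t : ℝ) (z : ℂ) :
    charDet β (normalForm a b c d) (t + z) =
      torusDet β a b c d (expEnd β 0 t, expEnd β 1 t) z := by
  rw [charDet_normalForm, expEnd_add, expEnd_add, torusDet]; ring

/-- `x` stands for the large exponential with coefficient `j`, `y` for the small one with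
coefficient `e`, and `T` for the modulus of the determinant; the same estimate serves both
half-planes. -/
theorem dominant_term_bound {x y D A e j δ T : ℝ} (hD : 0 ≤ D) (hA : 0 ≤ A) (he : 0 ≤ e)
    (hj : 0 ≤ j) (hx : 0 < x) (hδ1 : δ ≤ 1) (hxδ : 1 ≤ δ * x)
    (hyδ : y ≤ δ) (hδj : δ * (D + A + e) ≤ j / 2) (tri : j * x ≤ T + D + A * (x * y) + e * y) :
    j / 4 * (x + y) ≤ T := by
  have s1 : D * 1 ≤ D * (δ * x) := mul_le_mul_of_nonneg_left hxδ hD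
  have s2 : A * x * y ≤ A * x * δ := mul_le_mul_of_nonneg_left hyδ (mul_nonneg hA hx.le)
  have s3 : y ≤ δ * x := hyδ.trans (hδ1.trans hxδ)
  have s4 : e * y ≤ e * (δ * x) := mul_le_mul_of_nonneg_left s3 he
  have s5 : δ * (D + A + e) * x ≤ j / 2 * x := mul_le_mul_of_nonneg_right hδj hx.le
  have s6 : δ * x ≤ 1 * x := mul_le_mul_of_nonneg_right hδ1 hx.le
  have s7 : j / 4 * (x + y) ≤ j / 4 * (x + x) :=
    mul_le_mul_of_nonneg_left (by linarith) (by linarith)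
  linarith

/-- High in the upper half-plane the first exponential dominates, with coefficient `ad - bc`; low in
the lower one the second does, with coefficient 1. The unimodular parameters do not affect the
moduli, so the bound is uniform in them. -/
theorem exists_torusDet_growth {β : Fin 2 → ℝ} (h0 : β 0 < 0) (h1 : 0 < β 1) {a b c d : ℂ}
    (hJ : a * d - b * c ≠ 0) :
    ∃ K κ : ℝ, 0 < K ∧ 0 < κ ∧ ∀ u : ℂ × ℂ, ‖u.1‖ = 1 → ‖u.2‖ = 1 → ∀ z : ℂ, K ≤ |z.im| →
      κ * (‖expEnd β 0 z‖ + ‖expEnd β 1 z‖) ≤ ‖torusDet β a b c d u z‖ := by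
  set j := ‖a * d - b * c‖ with hj
  have hj0 : 0 < j := norm_pos_iff.2 hJ
  set N := ‖d‖ + ‖a‖ + j + 1 with hN
  have hN0 : 0 < N := by positivity
  set δ := min j 1 / (2 * N) with hδ
  have hmin : 0 < min j 1 := lt_min hj0 one_pos
  have hδ0 : 0 < δ := by positivity
  have hδN : δ * N = min j 1 / 2 := by rw [hδ]; field_simp
  have hδj : δ * N ≤ j / 2 := by rw [hδN]; linarith [min_le_left j 1]
  have hδ1 : δ * N ≤ 1 / 2 := by rw [hδN]; linarith [min_le_right j 1]
  have hN1 : 1 ≤ N := by rw [hN]; linarith [norm_nonneg d, norm_nonneg a]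
  have hδle : δ ≤ 1 := by nlinarith
  have hlim (B : ℝ) (hB : 0 < B) : ∀ᶠ τ : ℝ in Filter.atTop, Real.exp (-(τ * B)) ≤ δ := by
    have : Filter.Tendsto (fun τ : ℝ => Real.exp (-(τ * B))) Filter.atTop (nhds 0) :=
      Real.tendsto_exp_neg_atTop_nhds_zero.comp (Filter.tendsto_id.atTop_mul_const hB)
    exact this.eventually_le_const hδ0
  obtain ⟨K, hK⟩ := Filter.eventually_atTop.1
    (((hlim (-β 0) (by linarith)).and (hlim (β 1) h1)).and (Filter.eventually_gt_atTop 0))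
  refine ⟨K, min j 1 / 4, (hK K le_rfl).2, by positivity, fun u hu0 hu1 z hz => ?_⟩
  set x := ‖expEnd β 0 z‖ with hx
  set y := ‖expEnd β 1 z‖ with hy
  have hx0 : 0 < x := norm_pos_iff.2 (expEnd_ne_zero _ _ _)
  have hy0 : 0 < y := norm_pos_iff.2 (expEnd_ne_zero _ _ _)
  have ta : ‖a * (u.1 * u.2) * (expEnd β 0 z * expEnd β 1 z)‖ = ‖a‖ * (x * y) := by
    simp only [norm_mul, hu0, hu1, mul_one, hx, hy]
  have tj : ‖(a * d - b * c) * u.1 * expEnd β 0 z‖ = j * x := by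
    rw [norm_mul, norm_mul, hu0, mul_one]
  have t1 : ‖u.2 * expEnd β 1 z‖ = y := by rw [norm_mul, hu1, one_mul]
  rcases le_abs.1 hz with hτ | hτ
  · obtain ⟨⟨k0, k1⟩, -⟩ := hK z.im hτ
    have k0' : 1 ≤ δ * x := by
      have : Real.exp (-(z.im * -β 0)) * x = 1 := by
        rw [hx, norm_expEnd, ← Real.exp_add]; simp; ring
      exact this ▸ mul_le_mul_of_nonneg_right k0 hx0.le
    have k1' : y ≤ δ := by
      rw [hy, norm_expEnd, mul_comm]; exact k1
    have tri : j * x ≤ ‖torusDet β a b c d u z‖ + ‖d‖ + ‖a‖ * (x * y) + 1 * y := by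
      rw [one_mul]
      rw [← tj, ← ta, ← t1]
      have : (a * d - b * c) * u.1 * expEnd β 0 z = torusDet β a b c d u z - d -
        a * (u.1 * u.2) * (expEnd β 0 z * expEnd β 1 z) - u.2 * expEnd β 1 z := by
        rw [torusDet]; ring
      rw [this]
      exact (norm_sub_le _ _).trans (add_le_add_left ((norm_sub_le _ _).trans
        (add_le_add_left (norm_sub_le _ _) _)) _)
    have hmj : min j 1 / 4 ≤ j / 4 := by linarith [min_le_left j 1]
    refine (mul_le_mul_of_nonneg_right hmj (add_pos hx0 hy0).le).trans ?_
    refine dominant_term_bound (norm_nonneg d) (norm_nonneg a) zero_le_one hj0.le hx0 hδle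
      k0' k1' ((mul_le_mul_of_nonneg_left ?_ hδ0.le).trans hδj) tri
    linarith
  · obtain ⟨⟨k0, k1⟩, -⟩ := hK (-z.im) hτ
    have k1' : 1 ≤ δ * y := by
      have : Real.exp (-(-z.im * β 1)) * y = 1 := by
        rw [hy, norm_expEnd, ← Real.exp_add]; simp; ring
      exact this ▸ mul_le_mul_of_nonneg_right k1 hy0.le
    have k0' : x ≤ δ := by
      rw [hx, norm_expEnd]
      rwa [show -(β 0 * z.im) = -(-z.im * -β 0) by ring]
    have tri : y ≤ ‖torusDet β a b c d u z‖ + ‖d‖ + ‖a‖ * (y * x) + j * x := by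
      rw [mul_comm y x]
      rw [← tj, ← ta]
      nth_rewrite 1 [← t1]
      have : u.2 * expEnd β 1 z = torusDet β a b c d u z - d -
        a * (u.1 * u.2) * (expEnd β 0 z * expEnd β 1 z) -
          (a * d - b * c) * u.1 * expEnd β 0 z := by
        rw [torusDet]; ring
      rw [this]
      exact (norm_sub_le _ _).trans (add_le_add_left ((norm_sub_le _ _).trans
        (add_le_add_left (norm_sub_le _ _) _)) _)
    have hmj : min j 1 / 4 ≤ 1 / 4 := by linarith [min_le_right j 1]
    refine (mul_le_mul_of_nonneg_right hmj (add_pos hx0 hy0).le).trans ?_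
    rw [add_comm x y]
    refine dominant_term_bound (norm_nonneg d) (norm_nonneg a) hj0.le zero_le_one hy0 hδle
      k1' k0' ((mul_le_mul_of_nonneg_left ?_ hδ0.le).trans hδ1) (by rwa [one_mul])
    linarith

theorem exists_charDet_growth {β : Fin 2 → ℝ} (h0 : β 0 < 0) (h1 : 0 < β 1) {a b c d : ℂ}
    (hJ : a * d - b * c ≠ 0) :
    ∃ K κ : ℝ, 0 < K ∧ 0 < κ ∧ ∀ z : ℂ, K ≤ |z.im| →
      κ * (‖expEnd β 0 z‖ + ‖expEnd β 1 z‖) ≤ ‖charDet β (normalForm a b c d) z‖ := by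
  obtain ⟨K, κ, hK, hκ, h⟩ := exists_torusDet_growth h0 h1 hJ
  refine ⟨K, κ, hK, hκ, fun z hz => ?_⟩
  have h2 := charDet_add_ofReal β a b c d 0 z
  rw [Complex.ofReal_zero, zero_add] at h2
  rw [h2]
  refine h _ ?_ ?_ z hz <;> simp [expEnd]

theorem norm_expEnd_add_pos (β : Fin 2 → ℝ) (z : ℂ) : 0 < ‖expEnd β 0 z‖ + ‖expEnd β 1 z‖ :=
  add_pos (norm_pos_iff.2 (expEnd_ne_zero _ _ _)) (norm_pos_iff.2 (expEnd_ne_zero _ _ _))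

theorem exists_analyticOrderAt_eq {F : ℂ → ℂ} (hF : Differentiable ℂ F) {w : ℂ} (hw : F w ≠ 0)
    (z : ℂ) : ∃ m : ℕ, analyticOrderAt F z = m := by
  have : analyticOrderAt F z ≠ ⊤ := by
    intro h
    have h1 : ∃ᶠ x in nhdsWithin z {z}ᶜ, F x = (fun _ => (0 : ℂ)) x :=
      ((analyticOrderAt_eq_top.1 h).filter_mono nhdsWithin_le_nhds).frequently
    exact hw (congrFun (AnalyticOnNhd.eq_of_frequently_eq (fun x _ => hF.analyticAt x)
      (fun x _ => analyticAt_const) h1) w)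
  exact ⟨_, (ENat.natCast_toNat this).symm⟩

/-- A zero on each of these infinitely many circles would give zeros accumulating in a compact disc,
forcing `F` to vanish identically. -/
theorem exists_radius_ne_zero {F : ℂ → ℂ} (hF : Differentiable ℂ F) {w : ℂ} (hw : F w ≠ 0) (K : ℝ) :
    ∃ r ∈ Icc K (K + 1), ∀ z ∈ Metric.sphere (0 : ℂ) r, F z ≠ 0 := by
  by_contra! hcon
  choose! ζ hζ hζ0 using hcon
  have hinj : InjOn ζ (Icc K (K + 1)) := by
    intro r hr s hs hrs
    have h1 := hζ r hr
    have h2 := hζ s hs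
    rw [mem_sphere_zero_iff_norm] at h1 h2
    rw [← h1, ← h2, hrs]
  have hinf : (ζ '' Icc K (K + 1)).Infinite := (Icc_infinite (lt_add_one K)).image hinj
  obtain ⟨x, -, hx⟩ := hinf.exists_accPt_of_subset_isCompact
    (isCompact_closedBall (0 : ℂ) (K + 1)) (by
      rintro _ ⟨r, hr, rfl⟩
      have h1 := hζ r hr
      rw [mem_sphere_zero_iff_norm] at h1
      rw [mem_closedBall_zero_iff, h1]
      exact hr.2)
  have h1 : ∃ᶠ y in nhdsWithin x {x}ᶜ, F y = (fun _ => (0 : ℂ)) y := by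
    refine (accPt_iff_frequently_nhdsNE.1 hx).mono ?_
    rintro _ ⟨r, hr, rfl⟩
    exact hζ0 r hr
  exact hw (congrFun (AnalyticOnNhd.eq_of_frequently_eq (fun x _ => hF.analyticAt x)
    (fun x _ => analyticAt_const) h1) w)

/-- The characteristic determinant is bounded from below on circles around all real points. -/
theorem exists_circle_bound {β : Fin 2 → ℝ} (h0 : β 0 < 0) (h1 : 0 < β 1) {a b c d : ℂ}
    (hJ : a * d - b * c ≠ 0) (K : ℝ) :
    ∃ m : ℝ, 0 < m ∧ ∀ t : ℝ, ∃ r ∈ Icc K (K + 1), ∀ z ∈ Metric.sphere (t : ℂ) r,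
      m ≤ ‖charDet β (normalForm a b c d) z‖ := by
  have hcont : Continuous fun p : (ℂ × ℂ) × ℂ => torusDet β a b c d p.1 p.2 := by
    unfold torusDet; fun_prop
  have hdiff (u : ℂ × ℂ) : Differentiable ℂ (torusDet β a b c d u) := by
    unfold torusDet; fun_prop
  obtain ⟨K₁, κ, -, hκ, hgr⟩ := exists_torusDet_growth h0 h1 hJ
  have hcomp : IsCompact (Metric.sphere (0 : ℂ) 1 ×ˢ Metric.sphere (0 : ℂ) 1) :=
    (isCompact_sphere 0 1).prod (isCompact_sphere 0 1)
  have key : ∃ m : ℝ, 0 < m ∧ ∀ u ∈ Metric.sphere (0 : ℂ) 1 ×ˢ Metric.sphere (0 : ℂ) 1,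
      ∃ r ∈ Icc K (K + 1), ∀ z ∈ Metric.sphere (0 : ℂ) r, m ≤ ‖torusDet β a b c d u z‖ := by
    -- Real translations only move the parameter on the torus, which is compact. For each parameter
    -- some circle avoids the zeros, and by continuity it works nearby with a common bound; finitely
    -- many such neighbourhoods suffice.
    refine hcomp.induction_on (p := fun S => ∃ m : ℝ, 0 < m ∧ ∀ u ∈ S,
      ∃ r ∈ Icc K (K + 1), ∀ z ∈ Metric.sphere (0 : ℂ) r, m ≤ ‖torusDet β a b c d u z‖)
      ⟨1, one_pos, by simp⟩ ?_ ?_ ?_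
    · rintro s t hst ⟨m, hm, h⟩
      exact ⟨m, hm, fun u hu => h u (hst hu)⟩
    · rintro s t ⟨m, hm, h⟩ ⟨m', hm', h'⟩
      refine ⟨min m m', lt_min hm hm', fun u hu => ?_⟩
      rcases hu with hu | hu
      · obtain ⟨r, hr, hz⟩ := h u hu
        exact ⟨r, hr, fun z hzr => (min_le_left _ _).trans (hz z hzr)⟩
      · obtain ⟨r, hr, hz⟩ := h' u hu
        exact ⟨r, hr, fun z hzr => (min_le_right _ _).trans (hz z hzr)⟩
    · intro u hu
      have hw : torusDet β a b c d u (K₁ * Complex.I) ≠ 0 := by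
        have := hgr u (by simpa using hu.1) (by simpa using hu.2) (K₁ * Complex.I)
          (by simpa using le_abs_self K₁)
        intro h
        rw [h, norm_zero] at this
        exact absurd this (not_le.2 (mul_pos hκ (norm_expEnd_add_pos _ _)))
      obtain ⟨r, hr, hne⟩ := exists_radius_ne_zero (hdiff u) hw K
      obtain ⟨m, hm, hmz⟩ : ∃ m : ℝ, 0 < m ∧ ∀ z ∈ Metric.sphere (0 : ℂ) r,
          m < ‖torusDet β a b c d u z‖ := by
        have hK := isCompact_sphere (0 : ℂ) r
        rcases (Metric.sphere (0 : ℂ) r).eq_empty_or_nonempty with he | hn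
        · exact ⟨1, one_pos, by simp [he]⟩
        · obtain ⟨z₀, hz₀, hmin⟩ := hK.exists_isMinOn hn (hdiff u).continuous.norm.continuousOn
          have hpos := norm_pos_iff.2 (hne z₀ hz₀)
          exact ⟨_, half_pos hpos, fun z hz => (half_lt_self hpos).trans_le (hmin hz)⟩
      refine ⟨_, mem_nhdsWithin_of_mem_nhds
        ((isCompact_sphere (0 : ℂ) r).eventually_forall_of_forall_eventually
        (P := fun u z => m < ‖torusDet β a b c d u z‖) fun z hz => ?_), m, hm,
        fun u' hu' => ⟨r, hr, fun z hz => (hu' z hz).le⟩⟩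
      exact hcont.norm.continuousAt.eventually_const_lt (hmz z hz)
  obtain ⟨m, hm, hmu⟩ := key
  refine ⟨m, hm, fun t => ?_⟩
  obtain ⟨r, hr, hz⟩ := hmu (expEnd β 0 t, expEnd β 1 t)
    ⟨by simp [norm_expEnd_ofReal], by simp [norm_expEnd_ofReal]⟩
  refine ⟨r, hr, fun z hzs => ?_⟩
  have h2 := hz (z - t) (by simpa [dist_eq_norm] using hzs)
  rwa [← charDet_add_ofReal, add_sub_cancel] at h2

/-! ### Completeness of the root vectors -/

theorem norm_compTransform_le (β : Fin 2 → ℝ) (h : L2C2) (l : Fin 2) (z : ℂ) :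
    ‖compTransform β h l z‖ ≤ (∫ x, ‖conj (h x l)‖ ∂unitVolume) * max 1 ‖expEnd β l z‖ := by
  rw [compTransform, expTransform, ← integral_mul_const]
  refine norm_integral_le_of_norm_le ((integrable_conj_coord h l).norm.mul_const _) ?_
  refine (ae_restrict_iff' measurableSet_Icc).2 (ae_of_all _ fun x hx => ?_)
  rw [norm_mul, pow_zero, one_mul, mul_comm]
  refine mul_le_mul_of_nonneg_left ?_ (norm_nonneg _)
  rw [norm_expEnd, Complex.norm_exp, ← Real.exp_zero, ← Real.exp_monotone.map_max]
  refine Real.exp_le_exp.2 ?_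
  have : (Complex.I * β l * z * x).re = -(β l * z.im) * x := by simp
  rw [this]
  rcases le_total 0 (-(β l * z.im)) with h2 | h2
  · exact (mul_le_of_le_one_right h2 hx.2).trans (le_max_right _ _)
  · exact (mul_nonpos_of_nonpos_of_nonneg h2 hx.1).trans (le_max_left _ _)

/-- As `β 0` and `β 1` have opposite signs, one of the exponentials has modulus at most 1, so the
product of the maxima is a single exponential. -/
theorem max_mul_max_le {β : Fin 2 → ℝ} (h0 : β 0 < 0) (h1 : 0 < β 1) (z : ℂ) :
    max 1 ‖expEnd β 0 z‖ * max 1 ‖expEnd β 1 z‖ ≤ ‖expEnd β 0 z‖ + ‖expEnd β 1 z‖ := by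
  have p0 := norm_nonneg (expEnd β 0 z)
  have p1 := norm_nonneg (expEnd β 1 z)
  rcases le_total 0 z.im with h | h
  · have k0 : 1 ≤ ‖expEnd β 0 z‖ := by rw [norm_expEnd]; exact Real.one_le_exp (by nlinarith)
    have k1 : ‖expEnd β 1 z‖ ≤ 1 := by rw [norm_expEnd]; exact Real.exp_le_one_iff.2 (by nlinarith)
    rw [max_eq_right k0, max_eq_left k1]; linarith
  · have k0 : ‖expEnd β 0 z‖ ≤ 1 := by rw [norm_expEnd]; exact Real.exp_le_one_iff.2 (by nlinarith)
    have k1 : 1 ≤ ‖expEnd β 1 z‖ := by rw [norm_expEnd]; exact Real.one_le_exp (by nlinarith)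
    rw [max_eq_left k0, max_eq_right k1]; linarith

theorem exists_charDet_ne_zero {β : Fin 2 → ℝ} (h0 : β 0 < 0) (h1 : 0 < β 1) {a b c d : ℂ}
    (hJ : a * d - b * c ≠ 0) : ∃ w, charDet β (normalForm a b c d) w ≠ 0 := by
  obtain ⟨K, κ, -, hκ, hgr⟩ := exists_charDet_growth h0 h1 hJ
  refine ⟨K * Complex.I, fun h => ?_⟩
  have := hgr (K * Complex.I) (by simpa using le_abs_self K)
  rw [h, norm_zero] at this
  exact absurd this (not_le.2 (mul_pos hκ (norm_expEnd_add_pos _ _)))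

theorem tendsto_compTransform_one {β : Fin 2 → ℝ} (h1 : 0 < β 1) (h : L2C2) :
    Filter.Tendsto (fun τ : ℝ => compTransform β h 1 (τ * Complex.I)) Filter.atTop (nhds 0) := by
  refine (tendsto_laplace_zero (integrable_conj_coord h 1) (φ := fun x => β 1 * x) (by fun_prop)
    fun x hx => mul_pos h1 hx.1).congr fun τ => ?_
  rw [compTransform, expTransform]
  refine integral_congr_ae (ae_of_all _ fun x => ?_)
  simp only [pow_zero, one_mul, Complex.ofReal_exp]
  congr 2
  push_cast
  linear_combination (-(β 1 * τ * x : ℂ)) * Complex.I_mul_I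

theorem tendsto_compTransform_zero {β : Fin 2 → ℝ} (h0 : β 0 < 0) (h : L2C2) :
    Filter.Tendsto (fun τ : ℝ => compTransform β h 0 (τ * Complex.I) / expEnd β 0 (τ * Complex.I))
      Filter.atTop (nhds 0) := by
  refine (tendsto_laplace_zero (integrable_conj_coord h 0) (φ := fun x => -β 0 * (1 - x))
    (by fun_prop) fun x hx => mul_pos (by linarith) (by linarith [hx.2])).congr fun τ => ?_
  rw [compTransform, expTransform, ← integral_div]
  refine integral_congr_ae (ae_of_all _ fun x => ?_)
  simp only [pow_zero, one_mul, Complex.ofReal_exp]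
  rw [mul_div_right_comm, expEnd, ← Complex.exp_sub]
  congr 2
  push_cast
  linear_combination (β 0 * τ * (1 - x) : ℂ) * Complex.I_mul_I

/-- Entire quotients by the characteristic determinant of functions of exponential growth are
bounded. -/
theorem exists_norm_quotient_le {β : Fin 2 → ℝ} (h0 : β 0 < 0) (h1 : 0 < β 1) {a b c d : ℂ}
    (hJ : a * d - b * c ≠ 0) {G : ℂ → ℂ} (hG : Differentiable ℂ G) {C : ℝ}
    (hC : ∀ z, ‖charDet β (normalForm a b c d) z * G z‖ ≤
      C * (‖expEnd β 0 z‖ + ‖expEnd β 1 z‖)) : ∃ M, ∀ z, ‖G z‖ ≤ M := by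
  obtain ⟨K, κ, hK, hκ, hgr⟩ := exists_charDet_growth h0 h1 hJ
  obtain ⟨m, hm, hcirc⟩ := exists_circle_bound h0 h1 hJ K
  have hC0 : 0 ≤ C := nonneg_of_mul_nonneg_left ((norm_nonneg _).trans (hC 0))
    (norm_expEnd_add_pos β 0)
  set N := Real.exp (|β 0| * (K + 1)) + Real.exp (|β 1| * (K + 1))
  refine ⟨max (C / κ) (C * N / m), fun z => ?_⟩
  rcases le_total K |z.im| with hz | hz
  · refine le_max_of_le_left ((le_div_iff₀ hκ).2 ?_)
    have e := norm_expEnd_add_pos β z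
    refine le_of_mul_le_mul_right ?_ e
    calc ‖G z‖ * κ * (‖expEnd β 0 z‖ + ‖expEnd β 1 z‖)
        = κ * (‖expEnd β 0 z‖ + ‖expEnd β 1 z‖) * ‖G z‖ := by ring
      _ ≤ ‖charDet β (normalForm a b c d) z‖ * ‖G z‖ :=
          mul_le_mul_of_nonneg_right (hgr z hz) (norm_nonneg _)
      _ ≤ _ := by rw [← norm_mul]; exact hC z
  · refine le_max_of_le_right ?_
    -- In the strip the maximum principle is applied on a disc centred at `Re z`: its radius is at
    -- least `K ≥ |Im z|`, so it contains `z`, and the determinant is bounded below on its boundary.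
    obtain ⟨r, hr, hcr⟩ := hcirc z.re
    have hr0 : r ≠ 0 := (hK.trans_le hr.1).ne'
    refine Complex.norm_le_of_forall_mem_frontier_norm_le (U := Metric.ball (z.re : ℂ) r)
      Metric.isBounded_ball hG.diffContOnCl (fun w hw => ?_) ?_
    · rw [frontier_ball _ hr0] at hw
      have him : |w.im| ≤ K + 1 := by
        have := Complex.abs_im_le_norm (w - z.re)
        rw [mem_sphere_iff_norm.1 hw] at this
        simpa using this.trans hr.2
      have hexp (l : Fin 2) : ‖expEnd β l w‖ ≤ Real.exp (|β l| * (K + 1)) := by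
        rw [norm_expEnd]
        refine Real.exp_le_exp.2 ((neg_le_abs _).trans ?_)
        rw [abs_mul]
        exact mul_le_mul_of_nonneg_left him (abs_nonneg _)
      refine (le_div_iff₀ hm).2 ?_
      calc ‖G w‖ * m ≤ ‖G w‖ * ‖charDet β (normalForm a b c d) w‖ :=
            mul_le_mul_of_nonneg_left (hcr w hw) (norm_nonneg _)
        _ ≤ C * (‖expEnd β 0 w‖ + ‖expEnd β 1 w‖) := by rw [mul_comm, ← norm_mul]; exact hC w
        _ ≤ C * N := mul_le_mul_of_nonneg_left (add_le_add (hexp 0) (hexp 1)) hC0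
    · rw [closure_ball _ hr0, mem_closedBall_iff_norm]
      have : z - z.re = (z.im : ℂ) * Complex.I := by
        linear_combination -(Complex.re_add_im z)
      rw [this, norm_mul, Complex.norm_I, mul_one, Complex.norm_real, Real.norm_eq_abs]
      exact hz.trans hr.1

/-- A vector orthogonal to all root vectors pairs trivially with the exponential solutions that
solve the boundary value problem up to a multiple of the characteristic determinant. -/
theorem pairing_eq_zero {β : Fin 2 → ℝ} (h0 : β 0 < 0) (h1 : 0 < β 1) {a b c d : ℂ}
    (hJ : a * d - b * c ≠ 0) {h : L2C2}
    (hh : ∀ z, ∀ x ∈ rootSubspace (diracOp β (normalForm a b c d)) z, inner ℂ h x = 0)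
    {v : Fin 2 → ℂ → ℂ} (hv : ∀ l, Differentiable ℂ (v l)) {C : ℝ}
    (hv0 : ∀ μ, ‖v 0 μ‖ ≤ C * max 1 ‖expEnd β 1 μ‖)
    (hv1 : ∀ μ, ‖v 1 μ‖ ≤ C * max 1 ‖expEnd β 0 μ‖) (w : Fin 2 → ℂ)
    (hw0 : ∀ μ, (1 + a * expEnd β 0 μ) * v 0 μ + b * v 1 μ =
      charDet β (normalForm a b c d) μ * w 0)
    (hw1 : ∀ μ, c * expEnd β 0 μ * v 0 μ + (d + expEnd β 1 μ) * v 1 μ =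
      charDet β (normalForm a b c d) μ * w 1) (μ : ℂ) :
    compTransform β h 0 μ * v 0 μ + compTransform β h 1 μ * v 1 μ = 0 := by
  have hβ : ∀ l, β l ≠ 0 := Fin.forall_fin_two.2 ⟨h0.ne, h1.ne'⟩
  set D := charDet β (normalForm a b c d) with hD
  have hDd : Differentiable ℂ D := differentiable_charDet β a b c d
  obtain ⟨p, hp⟩ := exists_charDet_ne_zero h0 h1 hJ
  set F : ℂ → ℂ := fun μ => compTransform β h 0 μ * v 0 μ + compTransform β h 1 μ * v 1 μ with hF
  have hFd : Differentiable ℂ F :=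
    ((differentiable_compTransform β h 0).mul (hv 0)).add
      ((differentiable_compTransform β h 1).mul (hv 1))
  -- The boundary forms of `v` are multiples of the determinant, so at a zero of order `m` the jets
  -- of order below `m` are root vectors. Orthogonality makes `F` vanish to order `m` there.
  obtain ⟨G, hG, hFG⟩ := exists_entire_quotient hFd hDd fun z => by
    obtain ⟨m, hm⟩ := exists_analyticOrderAt_eq hDd hp z
    refine ⟨m, hm, (natCast_le_analyticOrderAt_iff_iteratedDeriv_eq_zero (hFd.analyticAt z)).2
      fun j hj => ?_⟩
    have hz := (natCast_le_analyticOrderAt_iff_iteratedDeriv_eq_zero (hDd.analyticAt z)).1 hm.ge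
    rw [← inner_contLp_jet β hv z j h]
    refine hh z _ (mem_rootSubspace.2 ⟨j + 1, contLp_jet_mem_powKer hβ hv (fun i hi => ?_)
      (fun i hi => ?_) j hj⟩)
    · rw [funext hw0]
      simp only [mul_comm _ (w 0)]
      rw [iteratedDeriv_const_mul_field, hz i hi, mul_zero]
    · rw [funext hw1]
      simp only [mul_comm _ (w 1)]
      rw [iteratedDeriv_const_mul_field, hz i hi, mul_zero]
  have hC0 : 0 ≤ C := nonneg_of_mul_nonneg_left ((norm_nonneg _).trans (hv0 0)) (by positivity)
  obtain ⟨M, hM⟩ : ∃ M, ∀ z, ‖G z‖ ≤ M := by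
    set N : Fin 2 → ℝ := fun l => ∫ x, ‖conj (h x l)‖ ∂unitVolume with hN
    have hN0 (l : Fin 2) : 0 ≤ N l := integral_nonneg fun x => norm_nonneg _
    refine exists_norm_quotient_le h0 h1 hJ hG (C := (N 0 + N 1) * C) fun z => ?_
    rw [← hFG]
    have m0 : (0 : ℝ) ≤ max 1 ‖expEnd β 0 z‖ := by positivity
    have m1 : (0 : ℝ) ≤ max 1 ‖expEnd β 1 z‖ := by positivity
    calc ‖F z‖ ≤ ‖compTransform β h 0 z‖ * ‖v 0 z‖ + ‖compTransform β h 1 z‖ * ‖v 1 z‖ := by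
          rw [← norm_mul, ← norm_mul]; exact norm_add_le _ _
      _ ≤ (N 0 * max 1 ‖expEnd β 0 z‖) * (C * max 1 ‖expEnd β 1 z‖) +
          (N 1 * max 1 ‖expEnd β 1 z‖) * (C * max 1 ‖expEnd β 0 z‖) := by
          refine add_le_add (mul_le_mul (norm_compTransform_le β h 0 z) (hv0 z) (norm_nonneg _)
            (mul_nonneg (hN0 0) m0)) (mul_le_mul (norm_compTransform_le β h 1 z) (hv1 z)
            (norm_nonneg _) (mul_nonneg (hN0 1) m1))
      _ = (N 0 + N 1) * C * (max 1 ‖expEnd β 0 z‖ * max 1 ‖expEnd β 1 z‖) := by ring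
      _ ≤ _ := mul_le_mul_of_nonneg_left (max_mul_max_le h0 h1 z)
          (mul_nonneg (add_nonneg (hN0 0) (hN0 1)) hC0)
  have hconst (z w : ℂ) : G z = G w := by
    refine hG.apply_eq_apply_of_bounded ?_ z w
    refine (Metric.isBounded_closedBall (x := (0 : ℂ)) (r := M)).subset ?_
    rintro _ ⟨x, rfl⟩
    simpa using hM x
  obtain ⟨K, κ, hK, hκ, hgr⟩ := exists_charDet_growth h0 h1 hJ
  -- By Liouville the quotient is constant, and on the positive imaginary axis it is at most this
  -- expression, which tends to zero; so the constant is zero.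
  have hlim : Filter.Tendsto (fun τ : ℝ => C / κ *
      (‖compTransform β h 0 (τ * Complex.I) / expEnd β 0 (τ * Complex.I)‖ +
        ‖compTransform β h 1 (τ * Complex.I)‖)) Filter.atTop (nhds 0) := by
    simpa using ((tendsto_compTransform_zero h0 h).norm.add
      (tendsto_compTransform_one h1 h).norm).const_mul (C / κ)
  have hle : ‖G μ‖ ≤ 0 := by
    refine ge_of_tendsto hlim ?_
    filter_upwards [Filter.eventually_ge_atTop K] with τ hτ
    have hτ0 : 0 < τ := hK.trans_le hτ
    rw [hconst μ (τ * Complex.I)]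
    set ζ : ℂ := τ * Complex.I with hζ
    have him : ζ.im = τ := by simp [hζ]
    have e0 : 1 ≤ ‖expEnd β 0 ζ‖ := by
      rw [norm_expEnd, him]; exact Real.one_le_exp (by nlinarith)
    have e1 : ‖expEnd β 1 ζ‖ ≤ 1 := by
      rw [norm_expEnd, him]; exact Real.exp_le_one_iff.2 (by nlinarith)
    have g0 := hv0 ζ
    have g1 := hv1 ζ
    rw [max_eq_left e1, mul_one] at g0
    rw [max_eq_right e0] at g1
    have hpos : 0 < ‖expEnd β 0 ζ‖ := zero_lt_one.trans_le e0
    have hgrz := hgr ζ (by rw [him]; exact hτ.trans (le_abs_self τ))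
    have hF0 : ‖F ζ‖ ≤ ‖compTransform β h 0 ζ‖ * C +
        ‖compTransform β h 1 ζ‖ * (C * ‖expEnd β 0 ζ‖) := by
      refine (norm_add_le _ _).trans ?_
      rw [norm_mul, norm_mul]
      gcongr
    have hDG : κ * ‖expEnd β 0 ζ‖ * ‖G ζ‖ ≤ ‖F ζ‖ := by
      rw [hFG, norm_mul]
      refine mul_le_mul_of_nonneg_right (le_trans ?_ hgrz) (norm_nonneg _)
      exact mul_le_mul_of_nonneg_left (le_add_of_nonneg_right (norm_nonneg _)) hκ.le
    have hfin := hDG.trans hF0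
    rw [norm_div]
    refine le_of_mul_le_mul_left (hfin.trans_eq ?_) (mul_pos hκ hpos)
    field_simp
  show F μ = 0
  rw [hFG, norm_le_zero_iff.1 hle, mul_zero]

theorem norm_add_mul_le_max (x y z : ℂ) : ‖x + y * z‖ ≤ (‖x‖ + ‖y‖) * max 1 ‖z‖ := by
  refine (norm_add_le _ _).trans ?_
  rw [norm_mul, add_mul]
  exact add_le_add (le_mul_of_one_le_right (norm_nonneg _) (le_max_left _ _))
    (mul_le_mul_of_nonneg_left (le_max_right _ _) (norm_nonneg _))

/-- The two columns of the adjugate of the characteristic matrix are admissible families `v`. The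
row of transforms annihilates the adjugate, and multiplying by the matrix itself leaves the
determinant times each transform. -/
theorem compTransform_mul_charDet {β : Fin 2 → ℝ} (h0 : β 0 < 0) (h1 : 0 < β 1) {a b c d : ℂ}
    (hJ : a * d - b * c ≠ 0) {h : L2C2}
    (hh : ∀ z, ∀ x ∈ rootSubspace (diracOp β (normalForm a b c d)) z, inner ℂ h x = 0)
    (l : Fin 2) (μ : ℂ) :
    compTransform β h l μ * charDet β (normalForm a b c d) μ = 0 := by
  have n0 := norm_nonneg a
  have n1 := norm_nonneg b
  have n2 := norm_nonneg c
  have n3 := norm_nonneg d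
  have k1 := pairing_eq_zero h0 h1 hJ hh
    (v := ![fun μ => d + expEnd β 1 μ, fun μ => -(c * expEnd β 0 μ)])
    (Fin.forall_fin_two.2 ⟨by simpa using by fun_prop, by simpa using by fun_prop⟩)
    (C := ‖d‖ + 1 + ‖c‖)
    (fun μ => by
      have := norm_add_mul_le_max d 1 (expEnd β 1 μ)
      rw [one_mul, norm_one] at this
      exact this.trans (mul_le_mul_of_nonneg_right (by linarith) (by positivity)))
    (fun μ => by
      have := norm_add_mul_le_max 0 (-c) (expEnd β 0 μ)
      rw [zero_add, norm_zero, norm_neg, zero_add, neg_mul] at this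
      exact this.trans (mul_le_mul_of_nonneg_right (by linarith) (by positivity)))
    ![1, 0]
    (fun μ => by simp [charDet_normalForm]; ring)
    (fun μ => by simp; ring) μ
  have k2 := pairing_eq_zero h0 h1 hJ hh
    (v := ![fun _ => -b, fun μ => 1 + a * expEnd β 0 μ])
    (Fin.forall_fin_two.2 ⟨by simp, by simpa using by fun_prop⟩)
    (C := ‖b‖ + 1 + ‖a‖)
    (fun μ => by
      have := norm_add_mul_le_max (-b) 0 (expEnd β 1 μ)
      rw [norm_neg, norm_zero, zero_mul, add_zero, add_zero] at this
      exact this.trans (mul_le_mul_of_nonneg_right (by linarith) (by positivity)))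
    (fun μ => by
      have := norm_add_mul_le_max 1 a (expEnd β 0 μ)
      rw [norm_one] at this
      exact this.trans (mul_le_mul_of_nonneg_right (by linarith) (by positivity)))
    ![0, 1]
    (fun μ => by simp; ring)
    (fun μ => by simp [charDet_normalForm]; ring) μ
  simp only [Matrix.cons_val_zero, Matrix.cons_val_one] at k1 k2
  rw [charDet_normalForm]
  fin_cases l
  · simp only [Fin.zero_eta]
    linear_combination (1 + a * expEnd β 0 μ) * k1 + c * expEnd β 0 μ * k2
  · simp only [Fin.mk_one]
    linear_combination b * k1 + (d + expEnd β 1 μ) * k2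

/-- A vector orthogonal to all root vectors vanishes. -/
theorem eq_zero_of_orthogonal_rootSubspace {β : Fin 2 → ℝ} (h0 : β 0 < 0) (h1 : 0 < β 1)
    {a b c d : ℂ} (hJ : a * d - b * c ≠ 0) {h : L2C2}
    (hh : ∀ z, ∀ x ∈ rootSubspace (diracOp β (normalForm a b c d)) z, inner ℂ h x = 0) :
    h = 0 := by
  have hβ : ∀ l, β l ≠ 0 := Fin.forall_fin_two.2 ⟨h0.ne, h1.ne'⟩
  obtain ⟨p, hp⟩ := exists_charDet_ne_zero h0 h1 hJ
  refine L2C2.ext_coord fun l => ?_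
  have hint := integrable_conj_coord h l
  have hloc : compTransform β h l =ᶠ[nhds p] fun _ => 0 := by
    filter_upwards [(differentiable_charDet β a b c d).continuous.continuousAt.eventually_ne hp]
      with μ hμ
    exact (mul_eq_zero.1 (compTransform_mul_charDet h0 h1 hJ hh l μ)).resolve_right hμ
  -- Near a point where the determinant is nonzero the transform vanishes identically; its
  -- derivatives there are, up to powers of `iβ`, the moments of an exponential times the conjugate
  -- of `h`.
  have hder (i : ℕ) : expTransform (fun x => conj (h x l)) (Complex.I * β l) i p = 0 := by
    rw [← iteratedDeriv_expTransform hint]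
    exact (hloc.iteratedDeriv_eq i).trans (by simp)
  have hmom := ae_eq_zero_of_moments
    (g := fun x => Complex.exp (Complex.I * β l * p * x) * conj (h x l))
    (integrable_continuous_mul hint (by fun_prop)) fun i => by
      have hκ : (Complex.I * β l) ^ i ≠ 0 :=
        pow_ne_zero _ (mul_ne_zero Complex.I_ne_zero (Complex.ofReal_ne_zero.2 (hβ l)))
      refine (mul_eq_zero.1 ?_).resolve_left hκ
      rw [← integral_const_mul, ← hder i, expTransform]
      refine integral_congr_ae (ae_of_all _ fun x => ?_)
      simp only [mul_pow]
      ring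
  filter_upwards [hmom, Lp.coeFn_zero C2 2 unitVolume] with x hx hx0
  rw [hx0]
  simpa [Complex.exp_ne_zero] using hx

theorem IsNormalizedRootSystem.topologicalClosure_span_eq_top {β : Fin 2 → ℝ} (h0 : β 0 < 0)
    (h1 : 0 < β 1) {a b c d : ℂ} (hJ : a * d - b * c ≠ 0) {lam : ℤ → ℂ} {f : ℤ → L2C2}
    (hf : IsNormalizedRootSystem (diracOp β (normalForm a b c d)) lam f) :
    (Submodule.span ℂ (range f)).topologicalClosure = ⊤ := by
  rw [Submodule.topologicalClosure_eq_top_iff, Submodule.eq_bot_iff]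
  intro h hmem
  refine eq_zero_of_orthogonal_rootSubspace h0 h1 hJ fun z x hx => ?_
  rw [← hf.span_eq] at hx
  exact (Submodule.mem_orthogonal' _ _).1 hmem x
    (Submodule.span_mono (image_subset_range _ _) hx)

/-! ### Simplicity of almost all eigenvalues and the criterion -/

theorem det_ne_zero_of_isRegularBC {a b c d : ℂ} (h : IsRegularBC (normalForm a b c d)) :
    a * d - b * c ≠ 0 := by
  have h1 : colMinor (normalForm a b c d) 2 1 = a * d - b * c := by
    simp [colMinor, normalForm, Matrix.det_fin_two]
  rw [← h1]
  exact right_ne_zero_of_mul h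

/-- A multiple zero is listed at two different indices. Separation forbids both to exceed `N` in
modulus, so it is one of finitely many listed values. -/
theorem IsStrictlyRegularBC.finite_multiple {β : Fin 2 → ℝ} {A : Matrix (Fin 2) (Fin 4) ℂ}
    (h : IsStrictlyRegularBC β A) : {z | 2 ≤ analyticOrderAt (charDet β A) z}.Finite := by
  obtain ⟨-, mu, hmu, N, τ, hτ, hsep⟩ := h
  refine ((finite_Icc (-(N : ℤ)) N).image mu).subset fun z hz => ?_
  rw [mem_ofPred_eq, ← hmu z] at hz
  obtain ⟨j, k, hj, hk, hjk⟩ := one_lt_encard_iff.1 (lt_of_lt_of_le (by norm_num) hz)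
  rcases le_or_gt |j| (N : ℤ) with hjN | hjN
  · exact ⟨j, abs_le.1 hjN, hj⟩
  rcases le_or_gt |k| (N : ℤ) with hkN | hkN
  · exact ⟨k, abs_le.1 hkN, hk⟩
  have := hsep j k hjN hkN hjk
  rw [show mu j = z from hj, show mu k = z from hk, sub_self, norm_zero] at this
  linarith

section RootSystem

variable {β : Fin 2 → ℝ} {a b c d : ℂ} {lam : ℤ → ℂ} {f : ℤ → L2C2}

theorem IsNormalizedRootSystem.mem_rootSubspace {E : Type*} [NormedAddCommGroup E]
    [InnerProductSpace ℂ E] {T : E →ₗ.[ℂ] E} {lam : ℤ → ℂ} {f : ℤ → E}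
    (hf : IsNormalizedRootSystem T lam f) (n : ℤ) : f n ∈ rootSubspace T (lam n) := by
  rw [← hf.span_eq]
  exact Submodule.subset_span ⟨n, rfl, rfl⟩

theorem IsNormalizedRootSystem.finite_fiber (h0 : β 0 < 0) (h1 : 0 < β 1)
    (hJ : a * d - b * c ≠ 0)
    (hf : IsNormalizedRootSystem (diracOp β (normalForm a b c d)) lam f) (z : ℂ) :
    {n | lam n = z}.Finite := by
  have hβ : ∀ l, β l ≠ 0 := Fin.forall_fin_two.2 ⟨h0.ne, h1.ne'⟩
  obtain ⟨p, hp⟩ := exists_charDet_ne_zero h0 h1 hJ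
  obtain ⟨m, hm⟩ := exists_analyticOrderAt_eq (differentiable_charDet β a b c d) hp z
  have hfin := finiteDimensional_powKer hβ a b c d z m
  rw [← rootSubspace_eq_powKer hβ hm, ← hf.span_eq] at hfin
  have hrange : range (fun n : {n : ℤ // lam n = z} => f n) = f '' {n | lam n = z} := by
    ext x; simp
  rw [← hrange] at hfin
  exact Module.Finite.finite_basis (Module.Basis.span (hf.linearIndependent z))

theorem IsNormalizedRootSystem.charDet_eq_zero (h0 : β 0 < 0) (h1 : 0 < β 1)
    (hf : IsNormalizedRootSystem (diracOp β (normalForm a b c d)) lam f) (n : ℤ) :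
    charDet β (normalForm a b c d) (lam n) = 0 := by
  have hβ : ∀ l, β l ≠ 0 := Fin.forall_fin_two.2 ⟨h0.ne, h1.ne'⟩
  by_contra hne
  have hord : analyticOrderAt (charDet β (normalForm a b c d)) (lam n) = (0 : ℕ) :=
    ((differentiable_charDet β a b c d).analyticAt _).analyticOrderAt_eq_zero.2 hne
  have h2 := hf.mem_rootSubspace n
  rw [rootSubspace_eq_powKer hβ hord, powKer, Submodule.mem_bot] at h2
  have := hf.norm_eq_one n
  rw [h2, norm_zero] at this
  exact zero_ne_one this

theorem IsNormalizedRootSystem.finite_not_simple (h0 : β 0 < 0) (h1 : 0 < β 1)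
    (hBC : IsStrictlyRegularBC β (normalForm a b c d))
    (hf : IsNormalizedRootSystem (diracOp β (normalForm a b c d)) lam f) :
    {n | analyticOrderAt (charDet β (normalForm a b c d)) (lam n) ≠ 1}.Finite := by
  have hJ := det_ne_zero_of_isRegularBC hBC.1
  refine (hBC.finite_multiple.biUnion fun z _ => hf.finite_fiber h0 h1 hJ z).subset
    fun n hn => mem_biUnion (x := lam n) ?_ rfl
  obtain ⟨p, hp⟩ := exists_charDet_ne_zero h0 h1 hJ
  obtain ⟨m, hm⟩ := exists_analyticOrderAt_eq (differentiable_charDet β a b c d) hp (lam n)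
  have hz : m ≠ 0 := by
    rintro rfl
    exact ((differentiable_charDet β a b c d).analyticAt _).analyticOrderAt_ne_zero.2
      (hf.charDet_eq_zero h0 h1 n) hm
  rw [mem_ofPred_eq, hm] at hn ⊢
  have : m ≠ 1 := fun h => hn (by rw [h]; rfl)
  exact_mod_cast (show 2 ≤ m by omega)

/-- Outside finitely many indices there are biorthogonal vectors, whose norms are given by the
excess. -/
theorem IsNormalizedRootSystem.exists_biorthogonal (h0 : β 0 < 0) (h1 : 0 < β 1)
    (hBC : IsStrictlyRegularBC β (normalForm a b c d))
    (hf : IsNormalizedRootSystem (diracOp β (normalForm a b c d)) lam f) :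
    ∃ (F : Finset ℤ) (g : ℤ → L2C2), ∀ n, n ∉ F →
      (∀ m, inner ℂ (g n) (f m) = if m = n then (1 : ℂ) else 0) ∧
      0 < excessDen β a d (lam n) ∧
      (‖g n‖ ^ 2 - 1) * excessDen β a d (lam n) = excess β a b c d (lam n) := by
  have key (n : ℤ) (hn : analyticOrderAt (charDet β (normalForm a b c d)) (lam n) = 1) :
      ∃ g : L2C2, (∀ m, inner ℂ g (f m) = if m = n then (1 : ℂ) else 0) ∧
        0 < excessDen β a d (lam n) ∧
        (‖g‖ ^ 2 - 1) * excessDen β a d (lam n) = excess β a b c d (lam n) := by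
    obtain ⟨hle, g, hg1, hg0, p, q, s, t, e1, e2, e3, e4, hδ, hR⟩ :=
      exists_biorthogonal_of_simple h0 h1 hn (hf.mem_rootSubspace n) (hf.norm_eq_one n)
    refine ⟨g, fun m => ?_, excess_identity (hf.charDet_eq_zero h0 h1 n) e1 e2 e3 e4 hδ hR⟩
    split_ifs with hmn
    · rw [hmn, hg1]
    · refine hg0 (lam m) (f m) (fun hl => ?_) (hf.mem_rootSubspace m)
      -- A second root vector at this eigenvalue would be a multiple of `f n`, as the root subspace
      -- is one-dimensional, contradicting linear independence.
      have hmem := hle (hl ▸ hf.mem_rootSubspace m)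
      refine hf.linearIndependent_all.notMem_span_image (s := {n}) (x := m) (by simpa using hmn) ?_
      rwa [image_singleton]
  choose! g hg using key
  refine ⟨(hf.finite_not_simple h0 h1 hBC).toFinset, g, fun n hn => hg n ?_⟩
  simpa using hn

theorem IsNormalizedRootSystem.exists_abs_im_le (h0 : β 0 < 0) (h1 : 0 < β 1)
    (hJ : a * d - b * c ≠ 0)
    (hf : IsNormalizedRootSystem (diracOp β (normalForm a b c d)) lam f) :
    ∃ K : ℝ, ∀ n, |(lam n).im| ≤ K := by
  obtain ⟨K, κ, -, hκ, hgr⟩ := exists_charDet_growth h0 h1 hJ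
  refine ⟨K, fun n => le_of_not_gt fun hlt => ?_⟩
  have := hgr _ hlt.le
  rw [hf.charDet_eq_zero h0 h1 n, norm_zero] at this
  exact absurd this (not_le.2 (mul_pos hκ (norm_expEnd_add_pos _ _)))

theorem IsNormalizedRootSystem.isBariBasis_iff (h0 : β 0 < 0) (h1 : 0 < β 1)
    (hBC : IsStrictlyRegularBC β (normalForm a b c d))
    (hf : IsNormalizedRootSystem (diracOp β (normalForm a b c d)) lam f) :
    IsBariBasis f ↔ (β 0 * ‖c‖ + β 1 * ‖b‖ = 0 ∧
      Summable (fun n : ℤ => |(lam n).im| ^ 2) ∧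
      Summable (fun n : ℤ =>
        ‖zVal (β 0) (β 1) a d (lam n)‖ - (zVal (β 0) (β 1) a d (lam n)).re)) := by
  have hJ := det_ne_zero_of_isRegularBC hBC.1
  obtain ⟨K, hK⟩ := hf.exists_abs_im_le h0 h1 hJ
  obtain ⟨F, g, hg⟩ := hf.exists_biorthogonal h0 h1 hBC
  have hF : ∀ᶠ n in Filter.cofinite, n ∉ F := F.eventually_cofinite_notMem
  obtain ⟨C, hC⟩ := exists_le_mul_excess β a b c d K h0 h1
  have hbound (n : ℤ) (hn : n ∉ F) := hC (lam n) (‖g n‖ ^ 2 - 1) (hK n)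
    (hf.charDet_eq_zero h0 h1 n) (hg n hn).2.1 (hg n hn).2.2
  constructor
  · intro hbari
    have hs := hbari.summable_biorthogonal hf.norm_eq_one F
      (hf.linearIndependent_all.comp _ Subtype.val_injective) fun n hn => (hg n hn).1
    have hsC := hs.mul_left C
    have hbc : β 0 * ‖c‖ + β 1 * ‖b‖ = 0 := by
      refine pow_eq_zero_iff two_ne_zero |>.1 (le_antisymm ?_ (sq_nonneg _))
      -- The squared constant is bounded by the terms of a summable sequence, which tend to zero.
      refine ge_of_tendsto hsC.tendsto_cofinite_zero ?_
      filter_upwards [hF] with n hn using (hbound n hn).2.1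
    refine ⟨hbc, Summable.of_norm_bounded_eventually hsC ?_,
      Summable.of_norm_bounded_eventually hsC ?_⟩
    · filter_upwards [hF] with n hn
      rw [Real.norm_of_nonneg (by positivity), sq_abs]
      exact (hbound n hn).2.2.1 hbc
    · filter_upwards [hF] with n hn
      rw [Real.norm_of_nonneg (sub_nonneg.2 (Complex.re_le_norm _))]
      exact (hbound n hn).2.2.2
  · rintro ⟨hbc, hs1, hs2⟩
    obtain ⟨C', ε, hε, hC'⟩ := exists_excess_le β a b c d K h0 h1 hbc
    refine isBariBasis_of_biorthogonal hf.norm_eq_one hf.linearIndependent_all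
      (hf.topologicalClosure_span_eq_top h0 h1 hJ).ge F (fun n hn => (hg n hn).1)
      (Summable.of_norm_bounded_eventually ((hs1.add hs2).mul_left C') ?_)
    -- Convergence of the last series supplies the smallness of `|z_n| - Re z_n` required for the
    -- upper estimate, outside finitely many indices.
    filter_upwards [hF, hs2.tendsto_cofinite_zero.eventually_lt_const hε] with n hn hlt
    rw [Real.norm_of_nonneg (hbound n hn).1, sq_abs]
    exact hC' (lam n) _ (hK n) (hf.charDet_eq_zero h0 h1 n) (hg n hn).2.1 (hg n hn).2.2 hlt

end RootSystem

end DiracBari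

end

open DiracBari in
theorem mainTheorem11 (b₁ b₂ : ℝ) (hb₁ : b₁ < 0) (hb₂ : 0 < b₂) (a b c d : ℂ)
    (hBC : IsStrictlyRegularBC ![b₁, b₂] (normalForm a b c d))
    (lam : ℤ → ℂ) (f : ℤ → L2C2)
    (hf : IsNormalizedRootSystem (diracOp ![b₁, b₂] (normalForm a b c d)) lam f) :
    IsBariBasis f ↔
      (b₁ * ‖c‖ + b₂ * ‖b‖ = 0 ∧
        Summable (fun n : ℤ => |(lam n).im| ^ 2) ∧
        Summable (fun n : ℤ =>
          ‖zVal b₁ b₂ a d (lam n)‖ - (zVal b₁ b₂ a d (lam n)).re)) := by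
  exact hf.isBariBasis_iff (β := ![b₁, b₂]) hb₁ hb₂ hBC
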